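/- Let $G(x,y)\in\mathbb R[x,y]$ be a real polynomial having finitely many critical points in $\mathbb C^2$ (points where $G_x=G_y=0$), and let $\xi$ be the number of these points counted with multiplicity, the multiplicity of $p$ being the Milnor number $\dim_{\mathbb C}\mathcal O_{\mathbb C^2,p}/(G_x,G_y)$. Assume that the real zero set $V_{\mathbb R}(G)=\{q\in\mathbb R^2: G(q)=0\}$ is nonempty and that every real singular point $q$ of the curve $G=0$ (that is, $q\in\mathbb R^2$ with $G(q)=G_x(q)=G_y(q)=0$) is a hyperbolic node: a transversal intersection of two smooth real local branches, i.e. $\det\operatorname{Hess}G(q)<0$. A divide in the disk $\mathbf D_R=\{x^2+y^2\le R^2\}$ is the image of a generic relative immersion of finitely many intervals and circles into $\mathbf D_R$: the circles lie in the open disk; the endpoints of the intervals are pairwise distinct and lie on $\partial\mathbf D_R$, the intervals meet $\partial\mathbf D_R$ transversally and only at their endpoints; all intersections and self-intersections are transversal double points. For all sufficiently large $R$, the set $V_{\mathbb R}(G)\cap\mathbf D_R$ is a divide, and the number $\iota$ of its interval branches (immersed intervals) does not depend on $R$. Let $\nu$ be the (finite) number of hyperbolic nodes of $V_{\mathbb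 R}(G)$. Then $$\xi\ \ge\ 2\nu-\iota+1,$$ with equality if and only if $G$ is expressive. Here $G$ is called expressive if all its critical points in $\mathbb C^2$ are real and have nondegenerate Hessian, each bounded connected component of $\mathbb R^2\setminus V_{\mathbb R}(G)$ contains exactly one critical point of $G$, each unbounded component contains none, and $V_{\mathbb R}(G)$ is connected and contains at least two points. -/

import Mathlib

open Set Filter Topology
open scoped ContDiff

noncomputable section

namespace PlaneCurve

/-- The real affine plane. -/
abbrev Plane : Type := Fin 2 → ℝ

/-! ### Critical points and their multiplicities -/

/-- The complex critical points of a real bivariate polynomial `G`: the points of `ℂ²` at which both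
partial derivatives of `G` vanish. -/
def criticalPoints (G : MvPolynomial (Fin 2) ℝ) : Set (Fin 2 → ℂ) :=
  {p | ∀ i, MvPolynomial.aeval p (MvPolynomial.pderiv i G) = 0}

/-- A point of `ℝ²`, viewed as a point of `ℂ²`. -/
def toComplex (q : Plane) : Fin 2 → ℂ := fun i => (q i : ℂ)

instance ker_eval_isPrime (p : Fin 2 → ℂ) :
    (RingHom.ker (MvPolynomial.eval p) : Ideal (MvPolynomial (Fin 2) ℂ)).IsPrime :=
  RingHom.ker_isPrime _

/-- The local ring of the affine plane `ℂ²` at the point `p`. -/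
abbrev LocalRing (p : Fin 2 → ℂ) : Type :=
  Localization.AtPrime (RingHom.ker (MvPolynomial.eval p) : Ideal (MvPolynomial (Fin 2) ℂ))

/-- The intersection number at `p` of the plane curves `f = 0` and `g = 0`: the dimension over `ℂ` of
the quotient of the local ring at `p` by the ideal `(f, g)`. It is `⊤` if that dimension is infinite. -/
def intersectionNumber (f g : MvPolynomial (Fin 2) ℂ) (p : Fin 2 → ℂ) : ℕ∞ :=
  Cardinal.toENat (Module.rank ℂ (LocalRing p ⧸
    (Ideal.span {algebraMap (MvPolynomial (Fin 2) ℂ) (LocalRing p) f,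
      algebraMap (MvPolynomial (Fin 2) ℂ) (LocalRing p) g} : Ideal (LocalRing p))))

/-- The Milnor number of `G` at `p`, i.e. the multiplicity of `p` as a critical point of `G`. -/
def milnorNumber (G : MvPolynomial (Fin 2) ℝ) (p : Fin 2 → ℂ) : ℕ∞ :=
  intersectionNumber
    (MvPolynomial.pderiv 0 (MvPolynomial.map (algebraMap ℝ ℂ) G))
    (MvPolynomial.pderiv 1 (MvPolynomial.map (algebraMap ℝ ℂ) G)) p

/-- The number of complex critical points of `G`, counted with multiplicities
(meaningful when there are finitely many critical points). -/
def numCriticalPoints (G : MvPolynomial (Fin 2) ℝ) : ℕ∞ :=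
  ∑ᶠ p ∈ criticalPoints G, milnorNumber G p

/-- The Hessian matrix of `G`, with polynomial entries. -/
def hessian (G : MvPolynomial (Fin 2) ℝ) : Matrix (Fin 2) (Fin 2) (MvPolynomial (Fin 2) ℝ) :=
  Matrix.of fun i j => MvPolynomial.pderiv i (MvPolynomial.pderiv j G)

/-! ### Real points and hyperbolic nodes -/

/-- The set of real points of the curve `G = 0`. -/
def realZeroSet (G : MvPolynomial (Fin 2) ℝ) : Set Plane :=
  {q | MvPolynomial.eval q G = 0}

/-- The real singular points of the curve `G = 0`. -/
def realSingularPoints (G : MvPolynomial (Fin 2) ℝ) : Set Plane :=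
  {q | MvPolynomial.eval q G = 0 ∧ ∀ i, MvPolynomial.eval q (MvPolynomial.pderiv i G) = 0}

/-- The curve `G = 0` has a hyperbolic node at `q`: it is singular at `q`, and the quadratic part of `G`
at `q` is a product of two non-proportional real linear forms (equivalently, the Hessian is indefinite
and nondegenerate); these are the tangents of two smooth real local branches crossing transversally. -/
def IsHyperbolicNode (G : MvPolynomial (Fin 2) ℝ) (q : Plane) : Prop :=
  q ∈ realSingularPoints G ∧ MvPolynomial.eval q (hessian G).det < 0

/-! ### Expressive polynomials -/

/-- A real bivariate polynomial is expressive. The connected component of `q` in the complement of the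
real zero set is `connectedComponentIn (realZeroSet G)ᶜ q`. -/
structure IsExpressive (G : MvPolynomial (Fin 2) ℝ) : Prop where
  /-- all complex critical points are real -/
  real : ∀ p ∈ criticalPoints G, ∃ q : Plane, toComplex q = p
  /-- all complex critical points are Morse -/
  morse : ∀ p ∈ criticalPoints G, MvPolynomial.aeval p (hessian G).det ≠ 0
  /-- each bounded component of the complement contains exactly one critical point -/
  bounded_component : ∀ q ∈ (realZeroSet G)ᶜ,
    Bornology.IsBounded (connectedComponentIn (realZeroSet G)ᶜ q) →
      ∃! c : Plane, c ∈ connectedComponentIn (realZeroSet G)ᶜ q ∧ toComplex c ∈ criticalPoints G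
  /-- each unbounded component of the complement contains no critical points -/
  unbounded_component : ∀ q ∈ (realZeroSet G)ᶜ,
    ¬ Bornology.IsBounded (connectedComponentIn (realZeroSet G)ᶜ q) →
      ∀ c ∈ connectedComponentIn (realZeroSet G)ᶜ q, toComplex c ∉ criticalPoints G
  /-- the real zero set is connected -/
  connected : IsConnected (realZeroSet G)
  /-- the real zero set contains at least two points -/
  nontrivial : (realZeroSet G).Nontrivial

/-! ### Divides -/

/-- The closed disk of radius `R` about the origin. -/
def disk (R : ℝ) : Set Plane := {q | q 0 ^ 2 + q 1 ^ 2 ≤ R ^ 2}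

/-- A finite family of smoothly immersed intervals and circles in the plane. Intervals are parametrized
by `[0,1]`, circles by smooth `1`-periodic maps `ℝ → ℝ²`. -/
structure ImmersedCurves where
  /-- the number of interval branches -/
  numIntervals : ℕ
  /-- the number of circle branches -/
  numCircles : ℕ
  interval : Fin numIntervals → ℝ → Plane
  circle : Fin numCircles → ℝ → Plane
  interval_smooth : ∀ j, ContDiffOn ℝ ∞ (interval j) (Icc 0 1)
  interval_immersion : ∀ j, ∀ t ∈ Icc (0 : ℝ) 1, derivWithin (interval j) (Icc 0 1) t ≠ 0
  circle_smooth : ∀ k, ContDiff ℝ ∞ (circle k)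
  circle_periodic : ∀ k, Function.Periodic (circle k) 1
  circle_immersion : ∀ k t, deriv (circle k) t ≠ 0

namespace ImmersedCurves

/-- The disjoint union of the parametrizing intervals and circles. -/
abbrev Param (C : ImmersedCurves) : Type :=
  (Fin C.numIntervals × Icc (0 : ℝ) 1) ⊕ (Fin C.numCircles × Ico (0 : ℝ) 1)

/-- The point of the plane with the given parameter. -/
def point (C : ImmersedCurves) : C.Param → Plane
  | Sum.inl (j, t) => C.interval j t
  | Sum.inr (k, t) => C.circle k t

/-- The velocity vector at the given parameter. -/
def velocity (C : ImmersedCurves) : C.Param → Plane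
  | Sum.inl (j, t) => derivWithin (C.interval j) (Icc 0 1) t
  | Sum.inr (k, t) => deriv (C.circle k) t

/-- The union of the branches. -/
def carrier (C : ImmersedCurves) : Set Plane := range C.point

end ImmersedCurves

/-- A divide in the disk of radius `R`: a generic relative immersion of finitely many intervals and
circles into the disk. -/
structure Divide (R : ℝ) extends ImmersedCurves where
  /-- the circles lie in the open disk -/
  circle_mem : ∀ k t, circle k t 0 ^ 2 + circle k t 1 ^ 2 < R ^ 2
  /-- the interior points of the intervals lie in the open disk -/
  interval_mem : ∀ j, ∀ t ∈ Ioo (0 : ℝ) 1, interval j t 0 ^ 2 + interval j t 1 ^ 2 < R ^ 2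
  /-- the endpoints of the intervals lie on the boundary circle -/
  endpoint_mem : ∀ j, ∀ t ∈ ({0, 1} : Set ℝ), interval j t 0 ^ 2 + interval j t 1 ^ 2 = R ^ 2
  /-- the endpoints of the intervals are pairwise distinct -/
  endpoint_injective : Function.Injective
    fun e : Fin numIntervals × ({0, 1} : Set ℝ) => interval e.1 e.2
  /-- the intervals meet the boundary circle transversally -/
  boundary_transversal : ∀ j, ∀ t ∈ ({0, 1} : Set ℝ),
    interval j t 0 * derivWithin (interval j) (Icc 0 1) t 0
      + interval j t 1 * derivWithin (interval j) (Icc 0 1) t 1 ≠ 0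
  /-- all intersections and self-intersections are transversal -/
  transversal : ∀ a b : toImmersedCurves.Param, a ≠ b →
    toImmersedCurves.point a = toImmersedCurves.point b →
      LinearIndependent ℝ ![toImmersedCurves.velocity a, toImmersedCurves.velocity b]
  /-- there are no points of multiplicity three or more -/
  no_triple : ∀ a b c : toImmersedCurves.Param, a ≠ b → a ≠ c → b ≠ c →
    ¬ (toImmersedCurves.point a = toImmersedCurves.point b ∧
      toImmersedCurves.point a = toImmersedCurves.point c)

/-- `D` is a presentation of the divide cut out by `G` in the disk of radius `R`. -/
def IsDivideOf (G : MvPolynomial (Fin 2) ℝ) {R : ℝ} (D : Divide R) : Prop :=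
  D.carrier = realZeroSet G ∩ disk R

/-- The divide `D_G` cut out by `G` in every sufficiently large disk exists and has exactly `n` interval
branches. There is at most one such `n`. -/
def HasNumIntervalBranches (G : MvPolynomial (Fin 2) ℝ) (n : ℕ) : Prop :=
  ∀ᶠ R : ℝ in atTop, (∃ D : Divide R, IsDivideOf G D) ∧
    ∀ D : Divide R, IsDivideOf G D → D.numIntervals = n

end PlaneCurve

end

/-!
Write `V` for the real curve `G = 0`, `b` for the number of bounded components of its complement, and
`c` for the number of connected components of `V`. The theorem combines two facts.

* Each bounded component of the complement contains a critical point, where `|G|` is largest, and the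
  `ν` nodes are critical points on `V`. A Milnor number is at least one, with equality if and only if the
  Hessian is nonzero (`exists_milnorNumber_eq`). Hence `ξ ≥ ν + b`.
* Euler's formula `b + ι = ν + c` (`BranchSystem.ncard_boundedComponents`).

Together, `ξ ≥ 2 ν - ι + c ≥ 2 ν - ι + 1`. Equality means that all critical points are real and
nondegenerate, that those off `V` lie one in each bounded component and none in an unbounded one, and
that `c = 1`; this is the definition of expressiveness, because a nonempty `V` always contains a branch
and so is not a point.

*Branches.* Near a smooth point or a hyperbolic node, the blown-up equation has simple zeros in the
tangent directions (`exists_blowup`), so the implicit function theorem gives one smooth local branch for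
each tangent line. Unit-speed parametrizations of local branches solve an ordinary differential equation
and prolong to complete curves `flowCurve`, which go straight through the nodes. Each complete curve is
either periodic or goes to infinity, and it is tangent to a circle centred at the origin at its point
nearest to the origin. As these tangencies form a bounded set (`isBounded_tangencies`), there are only
finitely many curves, up to reparametrization: this is the structure `BranchSystem`.

*The divide.* In a disk whose interior contains all tangencies with circles centred at the origin, the
distance to the origin has no local maximum along a branch outside the open disk. So the closed branches lie
inside the disk and an unbounded branch meets it in one arc (`HasTangenciesInside.exists_arc`), and `V`
cuts out a divide with one interval for each unbounded branch. The number of intervals does not depend on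
the chosen immersion: twice this number is the number of points of `V` on the boundary circle.

*Euler's formula.* All coefficients are integers modulo two. Functions locally constant off `V`, with
bounded support, form a space of dimension `b` (`card_boundedFunctions`). Taking jumps across `V`
identifies them with the one-dimensional cycles on `V` with bounded support: the jumps of a function form
a cycle (`exists_isCycle`), and every cycle in the plane is a boundary, because locally it is one and
local primitives, unique up to constants, can be glued in the plane (`exists_glued`,
`IsCycle.exists_isBoundary`). A cycle is a labelling of the smooth points of `V` that changes at a node by
the same increment on both branches. It is given by arbitrary labels on the closed branches and by
increments at the nodes with sum zero along each branch. So `b` is the number of closed branches plus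
the nullity of the incidence matrix of branches and nodes. The kernel of the transposed matrix consists of
the labellings of the branches that agree where branches meet, and its dimension is `c`. A matrix and its
transpose have the same rank, which gives `b + ι = ν + c`.
-/

noncomputable section

namespace PlaneCurve

/-! ### Milnor numbers -/

section Milnor

open MvPolynomial

variable {K : Type*} [Field K]

/-- Every polynomial in two variables is congruent to its value at `p` modulo the linear forms
vanishing at `p`. -/
lemma exists_eq_C_eval_add (p : Fin 2 → K) (f : MvPolynomial (Fin 2) K) :
    ∃ a b, f = C (eval p f) + a * (X 0 - C (p 0)) + b * (X 1 - C (p 1)) := by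
  induction f using MvPolynomial.induction_on with
  | C c => exact ⟨0, 0, by simp⟩
  | add f g hf hg =>
    obtain ⟨a, b, h⟩ := hf
    obtain ⟨a', b', h'⟩ := hg
    refine ⟨a + a', b + b', ?_⟩
    conv_lhs => rw [h, h']
    simp only [map_add]
    ring
  | mul_X f i hf =>
    obtain ⟨a, b, h⟩ := hf
    fin_cases i
    · refine ⟨a * X 0 + C (eval p f), b * X 0, ?_⟩
      conv_lhs => rw [h]
      simp only [Fin.zero_eta, map_mul, eval_X]
      ring
    · refine ⟨a * X 1, b * X 1 + C (eval p f), ?_⟩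
      conv_lhs => rw [h]
      simp only [Fin.mk_one, map_mul, eval_X]
      ring

lemma exists_linear_factors (p : Fin 2 → K) (f : MvPolynomial (Fin 2) K) (hf : eval p f = 0) :
    ∃ a b, f = a * (X 0 - C (p 0)) + b * (X 1 - C (p 1)) ∧
      eval p a = eval p (pderiv 0 f) ∧ eval p b = eval p (pderiv 1 f) := by
  obtain ⟨a, b, h⟩ := exists_eq_C_eval_add p f
  rw [hf] at h
  refine ⟨a, b, by simpa using h, ?_, ?_⟩
  · conv_rhs => rw [h]
    simp [pderiv_X]
  · conv_rhs => rw [h]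
    simp [pderiv_X]

/-- A prime ideal containing an ideal with finite zero locus is maximal. -/
lemma isMaximal_of_finite_zeroLocus {I Q : Ideal (MvPolynomial (Fin 2) ℂ)} [hQ : Q.IsPrime]
    (hIQ : I ≤ Q) (hfin : (zeroLocus ℂ I).Finite) : Q.IsMaximal := by
  have h1 : vanishingIdeal ℂ (zeroLocus ℂ Q) = Q := IsPrime.vanishingIdeal_zeroLocus Q
  have h2 : (zeroLocus ℂ Q).Finite := hfin.subset (zeroLocus_anti_mono hIQ)
  have h3 : (h2.toFinset.inf fun x => (vanishingIdeal ℂ {x} : Ideal (MvPolynomial (Fin 2) ℂ))) ≤ Q := by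
    refine le_trans ?_ h1.le
    intro f hf x hx
    have := Finset.inf_le (f := fun x => (vanishingIdeal ℂ {x} : Ideal (MvPolynomial (Fin 2) ℂ)))
      (h2.mem_toFinset.2 hx) hf
    exact (mem_vanishingIdeal_singleton_iff x f).1 this
  obtain ⟨x, hx, hxQ⟩ := (Ideal.IsPrime.inf_le' hQ).1 h3
  have hm : (vanishingIdeal ℂ {x} : Ideal (MvPolynomial (Fin 2) ℂ)).IsMaximal := inferInstance
  rw [← hm.eq_of_le hQ.ne_top hxQ]
  exact hm

/-- An ideal with finite zero locus has an Artinian quotient: the quotient has dimension zero. -/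
lemma isArtinianRing_quotient {I : Ideal (MvPolynomial (Fin 2) ℂ)}
    (hfin : (zeroLocus ℂ I).Finite) : IsArtinianRing (MvPolynomial (Fin 2) ℂ ⧸ I) := by
  rw [isArtinianRing_iff_krullDimLE_zero, Ring.krullDimLE_zero_iff]
  intro Q hQ
  have : (Q.comap (Ideal.Quotient.mk I)).IsMaximal := by
    refine isMaximal_of_finite_zeroLocus (I := I) ?_ hfin
    intro x hx
    rw [Ideal.mem_comap, Ideal.Quotient.eq_zero_iff_mem.2 hx]
    exact Q.zero_mem
  exact Ideal.isMaximal_of_isIntegral_of_isMaximal_comap' _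
    (RingHom.isIntegral_of_surjective _ Ideal.Quotient.mk_surjective) Q this

variable (f g : MvPolynomial (Fin 2) ℂ) (p : Fin 2 → ℂ)

/-- The ideal generated by `f` and `g` in the local ring at `p`. -/
abbrev localIdeal : Ideal (LocalRing p) :=
  Ideal.span {algebraMap (MvPolynomial (Fin 2) ℂ) (LocalRing p) f,
      algebraMap (MvPolynomial (Fin 2) ℂ) (LocalRing p) g}

lemma comap_maximalIdeal_localRing :
    (IsLocalRing.maximalIdeal (LocalRing p)).comap
      (algebraMap (MvPolynomial (Fin 2) ℂ) (LocalRing p)) = RingHom.ker (MvPolynomial.eval p) :=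
  Localization.AtPrime.under_maximalIdeal

lemma localIdeal_eq_map : localIdeal f g p =
    (Ideal.span {f, g}).map (algebraMap (MvPolynomial (Fin 2) ℂ) (LocalRing p)) := by
  rw [Ideal.map_span, Set.image_pair]

/-- The polynomial ring surjects onto the quotient of the local ring at `p` by `f` and `g`. -/
lemma surjective_quotient_localIdeal
    [IsArtinianRing (MvPolynomial (Fin 2) ℂ ⧸ Ideal.span {f, g})] :
    Function.Surjective ((Ideal.Quotient.mk (localIdeal f g p)).comp
      (algebraMap (MvPolynomial (Fin 2) ℂ) (LocalRing p))) := by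
  set A := MvPolynomial (Fin 2) ℂ ⧸ Ideal.span {f, g}
  set φ := (Ideal.Quotient.mk (localIdeal f g p)).comp
      (algebraMap (MvPolynomial (Fin 2) ℂ) (LocalRing p)) with hφ
  have hker : ∀ x ∈ Ideal.span {f, g}, φ x = 0 := by
    intro x hx
    rw [hφ, RingHom.comp_apply, Ideal.Quotient.eq_zero_iff_mem, localIdeal_eq_map]
    exact Ideal.mem_map_of_mem _ hx
  intro z
  obtain ⟨z, rfl⟩ := Ideal.Quotient.mk_surjective z
  obtain ⟨a, s, rfl⟩ := IsLocalization.exists_mk'_eq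
    (RingHom.ker (MvPolynomial.eval p) : Ideal (MvPolynomial (Fin 2) ℂ)).primeCompl z
  -- the powers of a denominator `s` become stationary in the Artinian ring: `s ^ n = s ^ (n + 1) * r`
  -- modulo `f` and `g`, so that `r` is an inverse of `s` in the local quotient
  obtain ⟨n, r, hr⟩ := IsArtinian.exists_pow_succ_smul_dvd
    (Ideal.Quotient.mk (Ideal.span {f, g}) (s : MvPolynomial (Fin 2) ℂ)) (1 : A)
  obtain ⟨r, rfl⟩ := Ideal.Quotient.mk_surjective r
  have hu : IsUnit (φ s) := (IsLocalization.map_units (LocalRing p) s).map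
    (Ideal.Quotient.mk (localIdeal f g p))
  have h1 : φ (s * r) = 1 := by
    have h2 : (s : MvPolynomial (Fin 2) ℂ) ^ (n + 1) * r - s ^ n ∈ Ideal.span {f, g} := by
      rw [← Ideal.Quotient.eq_zero_iff_mem, map_sub, map_mul, map_pow, map_pow, sub_eq_zero]
      simpa using hr
    have h3 := hker _ h2
    rw [map_sub, map_mul, map_pow, map_pow, sub_eq_zero, pow_succ, mul_assoc] at h3
    rw [map_mul]
    exact (hu.pow n).mul_left_cancel (by rw [h3, mul_one])
  refine ⟨a * r, ?_⟩
  have h4 : φ s * Ideal.Quotient.mk (localIdeal f g p) (IsLocalization.mk' (LocalRing p) a s)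
      = φ a := by
    rw [hφ, RingHom.comp_apply, ← map_mul, IsLocalization.mk'_spec', RingHom.comp_apply]
  apply hu.mul_left_cancel
  rw [h4, ← map_mul, mul_left_comm, map_mul, h1, mul_one]

/-- The Milnor algebra is a quotient of the global Artinian algebra, hence finite-dimensional. -/
lemma finite_quotient_localIdeal (hfin : (zeroLocus ℂ (Ideal.span {f, g})).Finite) :
    Module.Finite ℂ (LocalRing p ⧸ localIdeal f g p) := by
  have := isArtinianRing_quotient hfin
  have hA : Module.Finite ℂ (MvPolynomial (Fin 2) ℂ ⧸ Ideal.span {f, g}) :=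
    Module.finite_of_isArtinianRing ℂ _
  let φ : MvPolynomial (Fin 2) ℂ →ₐ[ℂ] (LocalRing p ⧸ localIdeal f g p) :=
    (Ideal.Quotient.mkₐ ℂ (localIdeal f g p)).comp
      (IsScalarTower.toAlgHom ℂ (MvPolynomial (Fin 2) ℂ) (LocalRing p))
  have hker : ∀ x ∈ Ideal.span {f, g}, φ x = 0 := by
    intro x hx
    change Ideal.Quotient.mk (localIdeal f g p) (algebraMap _ _ x) = 0
    rw [Ideal.Quotient.eq_zero_iff_mem, localIdeal_eq_map]
    exact Ideal.mem_map_of_mem _ hx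
  let ψ := Ideal.Quotient.liftₐ (Ideal.span {f, g}) φ hker
  refine Module.Finite.of_surjective ψ.toLinearMap ?_
  intro z
  obtain ⟨a, ha⟩ := surjective_quotient_localIdeal f g p z
  exact ⟨Ideal.Quotient.mk _ a, ha⟩

lemma localIdeal_le (hf : eval p f = 0) (hg : eval p g = 0) :
    localIdeal f g p ≤ IsLocalRing.maximalIdeal (LocalRing p) := by
  rw [localIdeal_eq_map, Ideal.map_le_iff_le_comap, comap_maximalIdeal_localRing,
    Ideal.span_le]
  rintro x (rfl | rfl) <;> simpa [RingHom.mem_ker]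

lemma intersectionNumber_eq_finrank (hfin : (zeroLocus ℂ (Ideal.span {f, g})).Finite) :
    intersectionNumber f g p =
      (Module.finrank ℂ (LocalRing p ⧸ localIdeal f g p) : ℕ∞) := by
  have := finite_quotient_localIdeal f g p hfin
  rw [intersectionNumber, ← Module.finrank_eq_rank]
  simp

lemma exists_C_sub_mem (z : LocalRing p) : ∃ c : ℂ,
    z - algebraMap ℂ (LocalRing p) c ∈ IsLocalRing.maximalIdeal (LocalRing p) := by
  obtain ⟨a, s, rfl⟩ := IsLocalization.exists_mk'_eq
    (RingHom.ker (MvPolynomial.eval p) : Ideal (MvPolynomial (Fin 2) ℂ)).primeCompl z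
  have hs : eval p (s : MvPolynomial (Fin 2) ℂ) ≠ 0 := s.2
  refine ⟨eval p a / eval p (s : MvPolynomial (Fin 2) ℂ), ?_⟩
  have hu := IsLocalization.map_units (LocalRing p) s
  rw [← Ideal.unit_mul_mem_iff_mem _ hu, mul_sub, IsLocalization.mk'_spec',
    IsScalarTower.algebraMap_apply ℂ (MvPolynomial (Fin 2) ℂ) (LocalRing p), ← map_mul, ← map_sub,
    ← Ideal.mem_comap, comap_maximalIdeal_localRing, RingHom.mem_ker]
  simp [mul_div_cancel₀ _ hs]

lemma finrank_eq_one_iff_localIdeal (hf : eval p f = 0) (hg : eval p g = 0) :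
    Module.finrank ℂ (LocalRing p ⧸ localIdeal f g p) = 1 ↔
      localIdeal f g p = IsLocalRing.maximalIdeal (LocalRing p) := by
  have hle := localIdeal_le f g p hf hg
  have hne : (Ideal.Quotient.mk (localIdeal f g p) 1) ≠ 0 := by
    rw [Ne, Ideal.Quotient.eq_zero_iff_mem]
    exact fun h => (IsLocalRing.maximalIdeal.isMaximal _).ne_top
      ((Ideal.eq_top_iff_one _).2 (hle h))
  constructor
  · intro h
    refine le_antisymm hle fun z hz => ?_
    obtain ⟨c, hc⟩ := (finrank_eq_one_iff_of_nonzero' _ hne).1 h (Ideal.Quotient.mk _ z)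
    rw [← Ideal.Quotient.mkₐ_eq_mk ℂ, ← map_smul, Ideal.Quotient.mkₐ_eq_mk, Ideal.Quotient.eq,
      Algebra.smul_def, mul_one] at hc
    have h1 : algebraMap ℂ (LocalRing p) c ∈ IsLocalRing.maximalIdeal (LocalRing p) := by
      simpa using Ideal.add_mem _ (hle hc) hz
    have h2 : c = 0 := by
      by_contra h0
      exact h1 ((IsUnit.mk0 c h0).map (algebraMap ℂ (LocalRing p)))
    rw [h2, map_zero, zero_sub] at hc
    exact (Ideal.neg_mem_iff _).1 hc
  · intro h
    refine (finrank_eq_one_iff_of_nonzero' _ hne).2 fun w => ?_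
    obtain ⟨z, rfl⟩ := Ideal.Quotient.mk_surjective w
    obtain ⟨c, hc⟩ := exists_C_sub_mem p z
    refine ⟨c, ?_⟩
    rw [← Ideal.Quotient.mkₐ_eq_mk ℂ, ← map_smul, Ideal.Quotient.mkₐ_eq_mk, Ideal.Quotient.eq, h,
      Algebra.smul_def, mul_one, ← Ideal.neg_mem_iff, neg_sub]
    exact hc

/-- Two functions vanishing at `p` generate the maximal ideal if and only if their Jacobian determinant
is nonzero there. -/
lemma localIdeal_eq_maximalIdeal_iff (hf : eval p f = 0) (hg : eval p g = 0) :
    localIdeal f g p = IsLocalRing.maximalIdeal (LocalRing p) ↔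
      eval p (pderiv 0 f) * eval p (pderiv 1 g) - eval p (pderiv 1 f) * eval p (pderiv 0 g) ≠ 0 := by
  have hX : ∀ i, algebraMap (MvPolynomial (Fin 2) ℂ) (LocalRing p) (X i - C (p i)) ∈
      IsLocalRing.maximalIdeal (LocalRing p) := by
    intro i
    rw [← Ideal.mem_comap, comap_maximalIdeal_localRing, RingHom.mem_ker]
    simp
  constructor
  · intro h
    -- clear denominators in the expressions of the coordinates by `f` and `g`, and differentiate at `p`
    have key : ∀ i, ∃ s a b : MvPolynomial (Fin 2) ℂ, eval p s ≠ 0 ∧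
        s * (X i - C (p i)) = a * f + b * g := by
      intro i
      have h1 := hX i
      rw [← h, localIdeal_eq_map, IsLocalization.algebraMap_mem_map_algebraMap_iff
        (RingHom.ker (MvPolynomial.eval p) : Ideal (MvPolynomial (Fin 2) ℂ)).primeCompl] at h1
      obtain ⟨s, hs, h2⟩ := h1
      obtain ⟨a, b, h3⟩ := Ideal.mem_span_pair.1 h2
      exact ⟨s, a, b, hs, h3.symm⟩
    obtain ⟨s, a, b, hs, e⟩ := key 0
    obtain ⟨t, c, d, ht, e'⟩ := key 1
    have e0 := congrArg (fun z => eval p (pderiv 0 z)) e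
    have e1 := congrArg (fun z => eval p (pderiv 1 z)) e
    have e0' := congrArg (fun z => eval p (pderiv 0 z)) e'
    have e1' := congrArg (fun z => eval p (pderiv 1 z)) e'
    simp [pderiv_X, hf, hg] at e0 e1 e0' e1'
    intro h0
    apply mul_ne_zero hs ht
    linear_combination (eval p t) * e0 +
      (eval p a * eval p (pderiv 0 f) + eval p b * eval p (pderiv 0 g)) * e1'
      - (eval p c * eval p (pderiv 0 f) + eval p d * eval p (pderiv 0 g)) * e1
      + (eval p a * eval p d - eval p b * eval p c) * h0
  · intro h
    refine le_antisymm (localIdeal_le f g p hf hg) ?_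
    -- `f` and `g` are linear combinations of the coordinates, with a matrix that is invertible in the
    -- local ring; Cramer's rule expresses the coordinates by `f` and `g`
    obtain ⟨a, b, e, ha, hb⟩ := exists_linear_factors p f hf
    obtain ⟨c, d, e', hc, hd⟩ := exists_linear_factors p g hg
    have hu : IsUnit (algebraMap (MvPolynomial (Fin 2) ℂ) (LocalRing p) (a * d - b * c)) := by
      have : a * d - b * c ∈
          (RingHom.ker (MvPolynomial.eval p) : Ideal (MvPolynomial (Fin 2) ℂ)).primeCompl := by
        change a * d - b * c ∉ RingHom.ker (MvPolynomial.eval p)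
        rw [RingHom.mem_ker, map_sub, map_mul, map_mul, ha, hb, hc, hd]
        exact h
      exact IsLocalization.map_units (LocalRing p) (⟨_, this⟩ :
        (RingHom.ker (MvPolynomial.eval p) : Ideal (MvPolynomial (Fin 2) ℂ)).primeCompl)
    have hmem : ∀ i, algebraMap (MvPolynomial (Fin 2) ℂ) (LocalRing p) (X i - C (p i)) ∈
        localIdeal f g p := by
      intro i
      rw [← Ideal.unit_mul_mem_iff_mem _ hu, ← map_mul, localIdeal_eq_map]
      apply Ideal.mem_map_of_mem
      rw [Ideal.mem_span_pair]
      fin_cases i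
      · exact ⟨d, -b, by simp only [Fin.zero_eta]; rw [e, e']; ring⟩
      · exact ⟨-c, a, by simp only [Fin.mk_one]; rw [e, e']; ring⟩
    rw [← Localization.AtPrime.map_eq_maximalIdeal, Ideal.map_le_iff_le_comap]
    intro x hx
    obtain ⟨u, v, e2, -, -⟩ := exists_linear_factors p x hx
    rw [Ideal.mem_comap, e2, map_add, map_mul, map_mul]
    exact Ideal.add_mem _ (Ideal.mul_mem_left _ _ (hmem 0)) (Ideal.mul_mem_left _ _ (hmem 1))

end Milnor

lemma mem_criticalPoints_iff (G : MvPolynomial (Fin 2) ℝ) (p : Fin 2 → ℂ) :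
    p ∈ criticalPoints G ↔ ∀ i, MvPolynomial.eval p
      (MvPolynomial.pderiv i (MvPolynomial.map (algebraMap ℝ ℂ) G)) = 0 := by
  simp only [criticalPoints, mem_ofPred_eq, MvPolynomial.pderiv_map, MvPolynomial.eval_map,
    MvPolynomial.aeval_def]

lemma zeroLocus_eq_criticalPoints (G : MvPolynomial (Fin 2) ℝ) :
    MvPolynomial.zeroLocus ℂ (Ideal.span
      {MvPolynomial.pderiv 0 (MvPolynomial.map (algebraMap ℝ ℂ) G),
       MvPolynomial.pderiv 1 (MvPolynomial.map (algebraMap ℝ ℂ) G)}) = criticalPoints G := by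
  ext p
  rw [MvPolynomial.zeroLocus_span, mem_criticalPoints_iff]
  simp [Fin.forall_fin_two, MvPolynomial.aeval_eq_eval]

/-- At a critical point of `G` (when there are only finitely many), the Milnor number is a positive
integer, and it equals `1` exactly if the Hessian is nondegenerate. -/
lemma exists_milnorNumber_eq {G : MvPolynomial (Fin 2) ℝ} (hfin : (criticalPoints G).Finite)
    {p : Fin 2 → ℂ} (hp : p ∈ criticalPoints G) :
    ∃ m : ℕ, milnorNumber G p = m ∧ 1 ≤ m ∧
      (m = 1 ↔ MvPolynomial.aeval p (hessian G).det ≠ 0) := by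
  set f := MvPolynomial.pderiv 0 (MvPolynomial.map (algebraMap ℝ ℂ) G) with hf
  set g := MvPolynomial.pderiv 1 (MvPolynomial.map (algebraMap ℝ ℂ) G) with hg
  have hf0 : MvPolynomial.eval p f = 0 := (mem_criticalPoints_iff G p).1 hp 0
  have hg0 : MvPolynomial.eval p g = 0 := (mem_criticalPoints_iff G p).1 hp 1
  have hfin' : (MvPolynomial.zeroLocus ℂ (Ideal.span {f, g})).Finite := by
    rw [zeroLocus_eq_criticalPoints]; exact hfin
  refine ⟨_, intersectionNumber_eq_finrank f g p hfin', ?_, ?_⟩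
  · have := finite_quotient_localIdeal f g p hfin'
    have : Nontrivial (LocalRing p ⧸ localIdeal f g p) := by
      apply Ideal.Quotient.nontrivial_iff.2
      intro h
      have := localIdeal_le f g p hf0 hg0
      rw [h, top_le_iff] at this
      exact (IsLocalRing.maximalIdeal.isMaximal _).ne_top this
    exact Module.finrank_pos
  · rw [finrank_eq_one_iff_localIdeal f g p hf0 hg0, localIdeal_eq_maximalIdeal_iff f g p hf0 hg0,
      Matrix.det_fin_two]
    simp only [hessian, Matrix.of_apply, map_sub, map_mul, hf, hg, MvPolynomial.pderiv_map,
      MvPolynomial.eval_map, MvPolynomial.aeval_def]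
    rw [mul_comm (MvPolynomial.eval₂ (algebraMap ℝ ℂ) p
      ((MvPolynomial.pderiv 1) ((MvPolynomial.pderiv 0) G)))]

end PlaneCurve

end

noncomputable section

namespace PlaneCurve

/-! ### Differential calculus of bivariate polynomials -/

/-- The differential of the polynomial function `G` at `q`, as a continuous linear form. -/
def differential (G : MvPolynomial (Fin 2) ℝ) (q : Plane) : Plane →L[ℝ] ℝ :=
  MvPolynomial.eval q (MvPolynomial.pderiv 0 G) • ContinuousLinearMap.proj 0 +
    MvPolynomial.eval q (MvPolynomial.pderiv 1 G) • ContinuousLinearMap.proj 1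

lemma differential_apply (G : MvPolynomial (Fin 2) ℝ) (q u : Plane) :
    differential G q u = MvPolynomial.eval q (MvPolynomial.pderiv 0 G) * u 0 +
      MvPolynomial.eval q (MvPolynomial.pderiv 1 G) * u 1 := by
  simp [differential]

lemma contDiff_eval (G : MvPolynomial (Fin 2) ℝ) {n : ℕ∞ω} :
    ContDiff ℝ n (fun q : Plane => MvPolynomial.eval q G) :=
  contDiff_iff_contDiffAt.2 fun q =>
    (AnalyticOnNhd.eval_mvPolynomial G q (mem_univ q)).contDiffAt

lemma continuous_eval (G : MvPolynomial (Fin 2) ℝ) :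
    Continuous (fun q : Plane => MvPolynomial.eval q G) :=
  (contDiff_eval G (n := 0)).continuous

lemma hasFDerivAt_eval (G : MvPolynomial (Fin 2) ℝ) (q : Plane) :
    HasFDerivAt (fun q : Plane => MvPolynomial.eval q G) (differential G q) q := by
  induction G using MvPolynomial.induction_on with
  | C c =>
    have : differential (MvPolynomial.C c) q = 0 := by ext; simp [differential_apply]
    rw [this]
    simpa using hasFDerivAt_const c q
  | add f g hf hg =>
    have : differential (f + g) q = differential f q + differential g q := by
      ext u; simp [differential_apply]; ring
    rw [this]
    exact (hf.add hg).congr_of_eventuallyEq (Eventually.of_forall fun x => by simp)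
  | mul_X f i hf =>
    have h := hf.mul (ContinuousLinearMap.proj (R := ℝ) (φ := fun _ : Fin 2 => ℝ) i).hasFDerivAt
    have h2 : differential (f * MvPolynomial.X i) q = MvPolynomial.eval q f •
        (ContinuousLinearMap.proj (R := ℝ) (φ := fun _ : Fin 2 => ℝ) i) +
        q i • differential f q := by
      ext u
      fin_cases i <;> simp [differential_apply, MvPolynomial.pderiv_X] <;> ring
    rw [h2]
    exact h.congr_of_eventuallyEq (Eventually.of_forall fun x => by simp)

lemma hasDerivAt_eval_comp (G : MvPolynomial (Fin 2) ℝ) {γ : ℝ → Plane} {v : Plane} {t : ℝ}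
    (h : HasDerivAt γ v t) :
    HasDerivAt (fun s => MvPolynomial.eval (γ s) G) (differential G (γ t) v) t :=
  (hasFDerivAt_eval G (γ t)).comp_hasDerivAt t h

/-- The value at `(u, u)` of the second differential of `G` at `q`. -/
def hessianForm (G : MvPolynomial (Fin 2) ℝ) (q u : Plane) : ℝ :=
  MvPolynomial.eval q (MvPolynomial.pderiv 0 (MvPolynomial.pderiv 0 G)) * u 0 ^ 2 +
    2 * MvPolynomial.eval q (MvPolynomial.pderiv 0 (MvPolynomial.pderiv 1 G)) * u 0 * u 1 +
    MvPolynomial.eval q (MvPolynomial.pderiv 1 (MvPolynomial.pderiv 1 G)) * u 1 ^ 2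

lemma pderiv_comm (G : MvPolynomial (Fin 2) ℝ) :
    MvPolynomial.pderiv 1 (MvPolynomial.pderiv 0 G) =
      MvPolynomial.pderiv 0 (MvPolynomial.pderiv 1 G) := by
  induction G using MvPolynomial.induction_on with
  | C c => simp
  | add f g hf hg => simp [hf, hg]
  | mul_X f i hf => fin_cases i <;> simp [MvPolynomial.pderiv_X, hf] <;> ring

lemma eval_det_hessian (G : MvPolynomial (Fin 2) ℝ) (q : Plane) :
    MvPolynomial.eval q (hessian G).det =
      MvPolynomial.eval q (MvPolynomial.pderiv 0 (MvPolynomial.pderiv 0 G)) *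
        MvPolynomial.eval q (MvPolynomial.pderiv 1 (MvPolynomial.pderiv 1 G)) -
      MvPolynomial.eval q (MvPolynomial.pderiv 0 (MvPolynomial.pderiv 1 G)) ^ 2 := by
  simp [Matrix.det_fin_two, hessian, pderiv_comm]
  ring

/-- Taylor expansion along rays, with a remainder depending smoothly on length and direction. -/
lemma exists_taylor (G : MvPolynomial (Fin 2) ℝ) (q : Plane) :
    ∃ P : ℝ × Plane → ℝ, ContDiff ℝ ω P ∧
      (∀ t u, MvPolynomial.eval (q + t • u) G =
        MvPolynomial.eval q G + t * differential G q u + t ^ 2 * P (t, u)) ∧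
      ∀ u, 2 * P (0, u) = hessianForm G q u := by
  induction G using MvPolynomial.induction_on with
  | C c => exact ⟨fun _ => 0, contDiff_const, by simp [differential_apply], by simp [hessianForm]⟩
  | add f g hf hg =>
    obtain ⟨P, hP, e, e'⟩ := hf
    obtain ⟨Q, hQ, d, d'⟩ := hg
    refine ⟨fun x => P x + Q x, hP.add hQ, ?_, ?_⟩
    · intro t u
      simp only [map_add, e, d, differential_apply]
      ring
    · intro u
      have := e' u
      have := d' u
      simp only [hessianForm, map_add] at *
      linarith
  | mul_X f i hf =>
    obtain ⟨P, hP, e, e'⟩ := hf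
    refine ⟨fun x => differential f q x.2 * x.2 i + P x * q i + x.1 * P x * x.2 i, ?_, ?_, ?_⟩
    · have : ContDiff ℝ ω fun x : ℝ × Plane => x.2 i :=
        (contDiff_apply ℝ ℝ i).comp contDiff_snd
      have h2 : ContDiff ℝ ω fun x : ℝ × Plane => differential f q x.2 :=
        (differential f q).contDiff.comp contDiff_snd
      exact ((h2.mul this).add (hP.mul contDiff_const)).add ((contDiff_fst.mul hP).mul this)
    · intro t u
      simp only [map_mul, e, MvPolynomial.eval_X]
      fin_cases i <;> simp [differential_apply, MvPolynomial.pderiv_X] <;> ring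
    · intro u
      have h := e' u
      fin_cases i
      · simp [differential_apply, MvPolynomial.pderiv_X, hessianForm] at h ⊢
        linear_combination q 0 * h
      · simp [differential_apply, MvPolynomial.pderiv_X, hessianForm] at h ⊢
        linear_combination q 1 * h

/-! ### Tangencies with large circles -/

/-- An irreducible polynomial and a polynomial that it does not divide have finitely many common
zeros: since the ring of polynomials has dimension two, every prime ideal containing both is
maximal. -/
lemma finite_common_zeros {p F : MvPolynomial (Fin 2) ℝ} (hp : Irreducible p) (hF : ¬ p ∣ F) :
    {q : Plane | MvPolynomial.eval q p = 0 ∧ MvPolynomial.eval q F = 0}.Finite := by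
  set I : Ideal (MvPolynomial (Fin 2) ℝ) := Ideal.span {p, F}
  have hdim : ringKrullDim (MvPolynomial (Fin 2) ℝ) = 2 := by
    rw [MvPolynomial.ringKrullDim_of_isNoetherianRing]
    simp
  have hpp : (Ideal.span {p}).IsPrime := (Ideal.span_singleton_prime hp.ne_zero).2 hp.prime
  have hmax : ∀ Q : Ideal (MvPolynomial (Fin 2) ℝ), Q.IsPrime → I ≤ Q → Q.IsMaximal := by
    intro Q hQ hIQ
    -- otherwise `0 < (p) < Q < M` is a chain of primes of length three
    by_contra hn
    obtain ⟨M, hM, hQM⟩ := Ideal.exists_le_maximal Q hQ.ne_top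
    have h01 : (⟨⊥, Ideal.isPrime_bot⟩ : PrimeSpectrum (MvPolynomial (Fin 2) ℝ)) <
        ⟨Ideal.span {p}, hpp⟩ := by
      rw [← PrimeSpectrum.asIdeal_lt_asIdeal]
      exact bot_lt_iff_ne_bot.2 (by simpa using hp.ne_zero)
    have h12 : (⟨Ideal.span {p}, hpp⟩ : PrimeSpectrum (MvPolynomial (Fin 2) ℝ)) < ⟨Q, hQ⟩ := by
      rw [← PrimeSpectrum.asIdeal_lt_asIdeal]
      refine lt_of_le_of_ne ((Ideal.span_mono (by simp)).trans hIQ) ?_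
      rintro (h : Ideal.span {p} = Q)
      apply hF
      rw [← Ideal.mem_span_singleton, h]
      exact hIQ (Ideal.subset_span (by simp))
    have h23 : (⟨Q, hQ⟩ : PrimeSpectrum (MvPolynomial (Fin 2) ℝ)) < ⟨M, hM.isPrime⟩ := by
      rw [← PrimeSpectrum.asIdeal_lt_asIdeal]
      exact lt_of_le_of_ne hQM (by rintro (rfl : Q = M); exact hn hM)
    let s : LTSeries (PrimeSpectrum (MvPolynomial (Fin 2) ℝ)) :=
      { length := 3
        toFun := ![⟨⊥, Ideal.isPrime_bot⟩, ⟨Ideal.span {p}, hpp⟩, ⟨Q, hQ⟩, ⟨M, hM.isPrime⟩]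
        step := by
          intro i
          fin_cases i
          exacts [h01, h12, h23] }
    have h3 : ((3 : ℕ) : WithBot ℕ∞) ≤ ringKrullDim (MvPolynomial (Fin 2) ℝ) :=
      Order.LTSeries.length_le_krullDim s
    rw [hdim] at h3
    exact absurd h3 (by decide)
  have hA : IsArtinianRing (MvPolynomial (Fin 2) ℝ ⧸ I) := by
    rw [isArtinianRing_iff_krullDimLE_zero, Ring.krullDimLE_zero_iff]
    intro Q hQ
    refine Ideal.isMaximal_of_isIntegral_of_isMaximal_comap' _
      (RingHom.isIntegral_of_surjective _ Ideal.Quotient.mk_surjective) Q (hmax _ inferInstance ?_)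
    intro x hx
    rw [Ideal.mem_comap, Ideal.Quotient.eq_zero_iff_mem.2 hx]
    exact Q.zero_mem
  have hz : ∀ q : {q : Plane | MvPolynomial.eval q p = 0 ∧ MvPolynomial.eval q F = 0},
      ∀ x ∈ I, MvPolynomial.eval q.1 x = 0 := by
    intro q x hx
    obtain ⟨a, b, rfl⟩ := Ideal.mem_span_pair.1 hx
    simp [q.2.1, q.2.2]
  -- an Artinian ring has finitely many primes, and distinct common zeros give distinct primes
  let φ : {q : Plane | MvPolynomial.eval q p = 0 ∧ MvPolynomial.eval q F = 0} →
      PrimeSpectrum (MvPolynomial (Fin 2) ℝ ⧸ I) := fun q =>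
    ⟨RingHom.ker (Ideal.Quotient.lift I (MvPolynomial.eval q.1) (hz q)), RingHom.ker_isPrime _⟩
  refine Set.finite_coe_iff.1 (Finite.of_injective φ fun a b hab => ?_)
  ext i
  have h1 : Ideal.Quotient.mk I (MvPolynomial.X i - MvPolynomial.C (a.1 i)) ∈ (φ a).asIdeal := by
    simp [φ, RingHom.mem_ker]
  rw [hab] at h1
  simp only [φ, RingHom.mem_ker, Ideal.Quotient.lift_mk, map_sub, MvPolynomial.eval_X,
    MvPolynomial.eval_C, sub_eq_zero] at h1
  exact h1.symm

/-- The derivative in the direction of the rotation field. -/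
def angular (G : MvPolynomial (Fin 2) ℝ) : MvPolynomial (Fin 2) ℝ :=
  MvPolynomial.X 0 * MvPolynomial.pderiv 1 G - MvPolynomial.X 1 * MvPolynomial.pderiv 0 G

lemma totalDegree_X_mul_pderiv_le (G : MvPolynomial (Fin 2) ℝ) (i j : Fin 2) :
    (MvPolynomial.X (R := ℝ) j * MvPolynomial.pderiv i G).totalDegree ≤ G.totalDegree := by
  conv_lhs => rw [G.as_sum, map_sum, Finset.mul_sum]
  refine MvPolynomial.totalDegree_finsetSum_le fun s hs => ?_
  rw [MvPolynomial.pderiv_monomial]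
  by_cases h : s i = 0
  · simp [h]
  · refine le_trans (MvPolynomial.totalDegree_mul _ _) ?_
    rw [MvPolynomial.totalDegree_X]
    refine le_trans (Nat.add_le_add_left (MvPolynomial.totalDegree_monomial_le _ _) 1) ?_
    refine le_trans ?_ (MvPolynomial.le_totalDegree hs)
    have h1 : s = (s - Finsupp.single i 1) + Finsupp.single i 1 := by
      ext k
      by_cases hk : i = k
      · subst hk; simp; omega
      · simp [hk]
    conv_rhs => rw [h1, Finsupp.sum_add_index' (by simp) (by simp)]
    rw [add_comm]
    simp [Function.id_def]

lemma totalDegree_angular_le (G : MvPolynomial (Fin 2) ℝ) :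
    (angular G).totalDegree ≤ G.totalDegree :=
  (MvPolynomial.totalDegree_sub _ _).trans
    (max_le (totalDegree_X_mul_pderiv_le G 1 0) (totalDegree_X_mul_pderiv_le G 0 1))

lemma angular_mul (f g : MvPolynomial (Fin 2) ℝ) :
    angular (f * g) = f * angular g + g * angular f := by
  simp only [angular, Derivation.leibniz, smul_eq_mul]
  ring

/-- The rotation field does not raise degrees, so a polynomial dividing its angular derivative does so
with a constant quotient. -/
lemma exists_angular_eq_C_mul {p : MvPolynomial (Fin 2) ℝ} (h : p ∣ angular p) :
    ∃ c : ℝ, angular p = MvPolynomial.C c * p := by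
  by_cases h0 : angular p = 0
  · exact ⟨0, by simp [h0]⟩
  obtain ⟨e, he⟩ := h
  have hp : p ≠ 0 := by rintro rfl; simp [angular] at h0
  have he0 : e ≠ 0 := by rintro rfl; simp [he] at h0
  have h1 := totalDegree_angular_le p
  rw [he, MvPolynomial.totalDegree_mul_of_isDomain hp he0] at h1
  have h2 : e.totalDegree = 0 := by omega
  rw [MvPolynomial.totalDegree_eq_zero_iff_eq_C] at h2
  exact ⟨_, by rw [he, mul_comm, ← h2]⟩

/-- If the rotation field multiplies `p` by a constant, the zero set of `p` is a union of circles. -/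
lemma eval_circle_eq_zero {p : MvPolynomial (Fin 2) ℝ} {c : ℝ}
    (h : angular p = MvPolynomial.C c * p) {q : Plane} (hq : MvPolynomial.eval q p = 0)
    (θ : ℝ) : MvPolynomial.eval
      ![Real.cos θ * q 0 - Real.sin θ * q 1, Real.sin θ * q 0 + Real.cos θ * q 1] p = 0 := by
  set γ : ℝ → Plane := fun θ =>
    ![Real.cos θ * q 0 - Real.sin θ * q 1, Real.sin θ * q 0 + Real.cos θ * q 1] with hγ
  have hd : ∀ s, HasDerivAt γ ![- (γ s 1), γ s 0] s := by
    intro s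
    rw [hasDerivAt_pi, Fin.forall_fin_two]
    constructor
    · have := ((Real.hasDerivAt_cos s).mul_const (q 0)).sub ((Real.hasDerivAt_sin s).mul_const (q 1))
      convert! this using 1
      simp [hγ]; ring
    · have := ((Real.hasDerivAt_sin s).mul_const (q 0)).add ((Real.hasDerivAt_cos s).mul_const (q 1))
      convert! this using 1
      simp [hγ]; ring
  -- along the circle, the value of `p` satisfies the linear equation `y' = c y`
  have hd2 : ∀ s, HasDerivAt (fun s => MvPolynomial.eval (γ s) p)
      (c * MvPolynomial.eval (γ s) p) s := by
    intro s
    convert! hasDerivAt_eval_comp p (hd s) using 1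
    have := congrArg (MvPolynomial.eval (γ s)) h
    simp only [angular, map_sub, map_mul, MvPolynomial.eval_X, MvPolynomial.eval_C] at this
    rw [← this, differential_apply]
    simp; ring
  have hd3 : ∀ s, HasDerivAt (fun s => MvPolynomial.eval (γ s) p * Real.exp (-(c * s))) 0 s := by
    intro s
    have := (hd2 s).mul (((hasDerivAt_id s).const_mul c).neg.exp)
    convert! this using 1
    simp; ring
  have hconst := is_const_of_deriv_eq_zero (fun s => (hd3 s).differentiableAt)
    (fun s => (hd3 s).deriv) θ 0
  have h0 : γ 0 = q := by ext i; fin_cases i <;> simp [hγ]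
  simp only [h0, hq, zero_mul, mul_eq_zero, Real.exp_ne_zero, or_false] at hconst
  exact hconst

lemma eq_zero_of_eval_ray {p : MvPolynomial (Fin 2) ℝ}
    (h : ∀ u : Plane, u ≠ 0 → {t : ℝ | MvPolynomial.eval (t • u) p = 0}.Infinite) : p = 0 := by
  have key : ∀ u : Plane, u ≠ 0 → ∀ t : ℝ, MvPolynomial.eval (t • u) p = 0 := by
    intro u hu t
    have hev : ∀ (r : MvPolynomial (Fin 2) ℝ) (t : ℝ),
        (MvPolynomial.aeval (fun i => Polynomial.C (u i) * Polynomial.X) r : Polynomial ℝ).eval t =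
          MvPolynomial.eval (t • u) r := by
      intro r t
      induction r using MvPolynomial.induction_on with
      | C c => simp
      | add f g hf hg => simp [hf, hg]
      | mul_X f i hf => simp [hf, mul_comm t]
    have hP0 := Polynomial.eq_zero_of_infinite_isRoot
      (MvPolynomial.aeval (fun i => Polynomial.C (u i) * Polynomial.X) p : Polynomial ℝ)
      ((h u hu).mono fun t ht => by
        rw [mem_ofPred_eq, Polynomial.IsRoot, hev]; exact ht)
    rw [← hev, hP0, Polynomial.eval_zero]
  refine MvPolynomial.funext fun u => ?_
  rw [map_zero]
  by_cases hu : u = 0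
  · have := key ![1, 0] (fun h => one_ne_zero (congrFun h 0)) 0
    rwa [zero_smul, ← hu] at this
  · simpa using key u hu 1

lemma exists_polar (q : Plane) : ∃ r α : ℝ, 0 ≤ r ∧ (q ≠ 0 → 0 < r) ∧ q 0 = r * Real.cos α ∧
    q 1 = r * Real.sin α := by
  refine ⟨‖(⟨q 0, q 1⟩ : ℂ)‖, Complex.arg ⟨q 0, q 1⟩, norm_nonneg _, ?_, ?_, ?_⟩
  · intro h
    rw [norm_pos_iff]
    intro h0
    apply h
    ext i
    fin_cases i
    · exact congrArg Complex.re h0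
    · exact congrArg Complex.im h0
  · rw [Complex.norm_mul_cos_arg]
  · rw [Complex.norm_mul_sin_arg]

/-- A union of circles that is unbounded meets each ray in infinitely many points, so no nonzero
polynomial vanishes on it. -/
lemma isBounded_of_angular_eq {p : MvPolynomial (Fin 2) ℝ} {c : ℝ} (hp : p ≠ 0)
    (h : angular p = MvPolynomial.C c * p) :
    Bornology.IsBounded {q : Plane | MvPolynomial.eval q p = 0} := by
  by_contra hb
  refine hp (eq_zero_of_eval_ray fun u hu hfin => hb ?_)
  obtain ⟨s, β, -, hs, hu0, hu1⟩ := exists_polar u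
  have hs := hs hu
  obtain ⟨C, hC⟩ := isBounded_iff_forall_norm_le.1 (Set.Finite.isBounded hfin)
  refine isBounded_iff_forall_norm_le.2 ⟨C * s, fun q hq => ?_⟩
  obtain ⟨r, α, hr, -, hq0, hq1⟩ := exists_polar q
  have h1 := eval_circle_eq_zero h hq (β - α)
  have h2 : ![Real.cos (β - α) * q 0 - Real.sin (β - α) * q 1,
      Real.sin (β - α) * q 0 + Real.cos (β - α) * q 1] = (r / s) • u := by
    have hrs : ∀ x, r / s * (s * x) = r * x := fun x => by field_simp
    have e0 : Real.cos β = Real.cos (β - α) * Real.cos α - Real.sin (β - α) * Real.sin α := by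
      rw [← Real.cos_add, sub_add_cancel]
    have e1 : Real.sin β = Real.sin (β - α) * Real.cos α + Real.cos (β - α) * Real.sin α := by
      rw [← Real.sin_add, sub_add_cancel]
    ext i
    fin_cases i
    · simp [hq0, hq1, hu0, hrs, e0]; ring
    · simp [hq0, hq1, hu1, hrs, e1]; ring
  rw [h2] at h1
  have h3 := hC _ h1
  rw [Real.norm_of_nonneg (by positivity), div_le_iff₀ hs] at h3
  refine (pi_norm_le_iff_of_nonneg (hr.trans h3)).2 fun i => le_trans ?_ h3
  fin_cases i
  · simp only [Fin.zero_eta, hq0, norm_mul, Real.norm_eq_abs, abs_of_nonneg hr]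
    exact mul_le_of_le_one_right hr (Real.abs_cos_le_one _)
  · simp only [Fin.mk_one, hq1, norm_mul, Real.norm_eq_abs, abs_of_nonneg hr]
    exact mul_le_of_le_one_right hr (Real.abs_sin_le_one _)

lemma aeval_toComplex (F : MvPolynomial (Fin 2) ℝ) (q : Plane) :
    MvPolynomial.aeval (toComplex q) F = ((MvPolynomial.eval q F : ℝ) : ℂ) := by
  induction F using MvPolynomial.induction_on with
  | C c => simp
  | add f g hf hg => simp [hf, hg]
  | mul_X f i hf => simp [hf, toComplex]

lemma toComplex_injective : Function.Injective toComplex := by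
  intro a b h
  ext i
  exact Complex.ofReal_injective (congrFun h i)

lemma toComplex_mem_criticalPoints {G : MvPolynomial (Fin 2) ℝ} {q : Plane} :
    toComplex q ∈ criticalPoints G ↔
      ∀ i, MvPolynomial.eval q (MvPolynomial.pderiv i G) = 0 := by
  simp only [criticalPoints, mem_ofPred_eq, aeval_toComplex, Complex.ofReal_eq_zero]

lemma ne_zero_of_finite_criticalPoints {G : MvPolynomial (Fin 2) ℝ}
    (hfin : (criticalPoints G).Finite) : G ≠ 0 := by
  rintro rfl
  have : criticalPoints 0 = univ := by ext; simp [criticalPoints]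
  rw [this] at hfin
  exact Set.infinite_univ hfin

/-- The points where the curve `G = 0` is tangent to a circle centred at the origin, or singular,
form a bounded set. Otherwise an irreducible factor `p` of `G` with unbounded zero set divides
`angular G`; as `p` is a simple factor, it divides `angular p`, so that its zero set is a union of
circles. -/
lemma isBounded_tangencies {G : MvPolynomial (Fin 2) ℝ} (hfin : (criticalPoints G).Finite) :
    Bornology.IsBounded {q : Plane | MvPolynomial.eval q G = 0 ∧
      MvPolynomial.eval q (angular G) = 0} := by
  classical
  have hG := ne_zero_of_finite_criticalPoints hfin
  set F := UniqueFactorizationMonoid.factors G with hF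
  have hprod : Associated F.prod G := UniqueFactorizationMonoid.factors_prod hG
  have hsub : {q : Plane | MvPolynomial.eval q G = 0 ∧ MvPolynomial.eval q (angular G) = 0} ⊆
      ⋃ p ∈ F.toFinset, {q : Plane | MvPolynomial.eval q p = 0 ∧
        MvPolynomial.eval q (angular G) = 0} := by
    rintro q ⟨hq, hq'⟩
    obtain ⟨u, hu⟩ := hprod
    rw [← hu, map_mul, mul_eq_zero, or_iff_left
      ((u.isUnit.map (MvPolynomial.eval q)).ne_zero), map_multiset_prod,
      Multiset.prod_eq_zero_iff, Multiset.mem_map] at hq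
    obtain ⟨p, hp, hpq⟩ := hq
    simp only [mem_iUnion, Multiset.mem_toFinset]
    exact ⟨p, hp, hpq, hq'⟩
  refine Bornology.IsBounded.subset ?_ hsub
  refine (Bornology.isBounded_biUnion_finset _).2 fun p hp => ?_
  rw [Multiset.mem_toFinset] at hp
  have hirr : Irreducible p := UniqueFactorizationMonoid.irreducible_of_factor p hp
  by_cases hd : p ∣ angular G
  swap
  · exact (finite_common_zeros hirr hd).isBounded
  obtain ⟨a, rfl⟩ := UniqueFactorizationMonoid.dvd_of_mem_factors hp
  rw [angular_mul] at hd
  have hd2 : p ∣ a * angular p := by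
    exact (dvd_add_right (dvd_mul_right p (angular a))).1 hd
  rcases hirr.prime.dvd_or_dvd hd2 with h | h
  -- a multiple factor of `G` has critical points of `G` as zeros
  · refine Bornology.IsBounded.subset ?_
      (t := {q : Plane | toComplex q ∈ criticalPoints (p * a)}) ?_
    · exact (hfin.preimage toComplex_injective.injOn).isBounded
    · rintro q ⟨hq, -⟩
      obtain ⟨b, rfl⟩ := h
      rw [mem_ofPred_eq, toComplex_mem_criticalPoints]
      intro i
      simp [Derivation.leibniz, hq]
  · obtain ⟨c, hc⟩ := exists_angular_eq_C_mul h
    exact (isBounded_of_angular_eq hirr.ne_zero hc).subset fun q hq => hq.1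

end PlaneCurve

end

noncomputable section

namespace PlaneCurve

/-! ### Tangent directions -/

/-- The square of the Euclidean norm. -/
def normSq (v : Plane) : ℝ := v 0 ^ 2 + v 1 ^ 2

/-- Rotation by a right angle. -/
def rot (v : Plane) : Plane := ![-v 1, v 0]

/-- The Euclidean scalar product. -/
def dot (u v : Plane) : ℝ := u 0 * v 0 + u 1 * v 1

@[simp] lemma rot_zero (v : Plane) : rot v 0 = -v 1 := rfl
@[simp] lemma rot_one (v : Plane) : rot v 1 = v 0 := rfl

lemma normSq_nonneg (v : Plane) : 0 ≤ normSq v := by unfold normSq; positivity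

lemma normSq_eq_zero {v : Plane} : normSq v = 0 ↔ v = 0 := by
  constructor
  · intro h
    unfold normSq at h
    have h0 : v 0 = 0 := by nlinarith [sq_nonneg (v 0), sq_nonneg (v 1)]
    have h1 : v 1 = 0 := by nlinarith [sq_nonneg (v 0), sq_nonneg (v 1)]
    ext i; fin_cases i <;> simp [h0, h1]
  · rintro rfl; simp [normSq]

lemma normSq_pos {v : Plane} (h : v ≠ 0) : 0 < normSq v :=
  lt_of_le_of_ne (normSq_nonneg v) fun h0 => h (normSq_eq_zero.1 h0.symm)

@[fun_prop] lemma continuous_normSq : Continuous normSq := by unfold normSq; fun_prop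

lemma continuous_dot (v : Plane) : Continuous fun u => dot u v := by unfold dot; fun_prop

lemma normSq_smul (s : ℝ) (v : Plane) : normSq (s • v) = s ^ 2 * normSq v := by
  simp [normSq]; ring

lemma normSq_neg (v : Plane) : normSq (-v) = normSq v := by
  simp [normSq]

lemma ne_zero_of_normSq_eq_one {v : Plane} (h : normSq v = 1) : v ≠ 0 := by
  rintro rfl; simp [normSq] at h

lemma norm_le_one_of_normSq_eq_one {v : Plane} (h : normSq v = 1) : ‖v‖ ≤ 1 := by
  unfold normSq at h
  refine (pi_norm_le_iff_of_nonneg zero_le_one).2 fun i => ?_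
  rw [Real.norm_eq_abs, abs_le_one_iff_mul_self_le_one]
  fin_cases i
  · simp; nlinarith [sq_nonneg (v 1)]
  · simp; nlinarith [sq_nonneg (v 0)]

/-- Expansion of `u` in the orthonormal basis `v, rot v`. -/
lemma eq_dot_smul_add {v : Plane} (hv : normSq v = 1) (u : Plane) :
    u = dot u v • v + dot u (rot v) • rot v := by
  unfold normSq at hv
  ext i
  fin_cases i
  · simp [dot]; linear_combination (-u 0) * hv
  · simp [dot]; linear_combination (-u 1) * hv

lemma exists_normalize {w : Plane} (hw : w ≠ 0) : ∃ r : ℝ, 0 < r ∧ normSq (r • w) = 1 := by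
  have h := normSq_pos hw
  refine ⟨(Real.sqrt (normSq w))⁻¹, by positivity, ?_⟩
  rw [normSq_smul, inv_pow, Real.sq_sqrt h.le, inv_mul_cancel₀ h.ne']

lemma eq_or_eq_neg_of_dot_rot_eq_zero {u v : Plane} (hu : normSq u = 1) (hv : normSq v = 1)
    (h : dot u (rot v) = 0) : u = v ∨ u = -v := by
  have e := eq_dot_smul_add hv u
  rw [h, zero_smul, add_zero] at e
  have h1 : dot u v ^ 2 = 1 := by
    rw [e, normSq_smul, hv, mul_one] at hu
    exact hu
  rcases sq_eq_one_iff.1 h1 with h2 | h2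
  · left; rw [e, h2, one_smul]
  · right; rw [e, h2, neg_smul, one_smul]

/-- The unit vector `v` is tangent at `q` to a local branch of the curve `G = 0`. At an ordinary
double point this means that the Hessian form vanishes at `v`. -/
structure IsTangent (G : MvPolynomial (Fin 2) ℝ) (q v : Plane) : Prop where
  mem : MvPolynomial.eval q G = 0
  unit : normSq v = 1
  differential : differential G q v = 0
  hessian : PlaneCurve.differential G q = 0 → hessianForm G q v = 0

lemma IsTangent.neg {G : MvPolynomial (Fin 2) ℝ} {q v : Plane} (h : IsTangent G q v) :
    IsTangent G q (-v) :=
  ⟨h.mem, by rw [normSq_neg, h.unit], by rw [map_neg, h.differential, neg_zero], fun h0 => by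
    have := h.hessian h0
    simp only [hessianForm, Pi.neg_apply] at this ⊢
    linarith⟩

lemma differential_eq_zero_iff {G : MvPolynomial (Fin 2) ℝ} {q : Plane} :
    differential G q = 0 ↔ ∀ i, MvPolynomial.eval q (MvPolynomial.pderiv i G) = 0 := by
  constructor
  · intro h i
    have h0 := DFunLike.congr_fun h (Pi.single i 1)
    fin_cases i <;> simpa [differential_apply] using h0
  · intro h
    ext u
    simp [differential_apply, h]

lemma differential_eq_zero_of_basis {G : MvPolynomial (Fin 2) ℝ} {q v : Plane}
    (hv : normSq v = 1) (h0 : differential G q v = 0) (h1 : differential G q (rot v) = 0) :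
    differential G q = 0 := by
  ext u
  rw [eq_dot_smul_add hv u]
  simp [h0, h1]

/-- The tangent directions at a smooth point of the curve. -/
lemma exists_isTangent_of_smooth {G : MvPolynomial (Fin 2) ℝ} {q : Plane}
    (hq : MvPolynomial.eval q G = 0) (hd : differential G q ≠ 0) :
    ∃ v, normSq v = 1 ∧ ∀ u, IsTangent G q u ↔ u = v ∨ u = -v := by
  set w : Plane := ![-MvPolynomial.eval q (MvPolynomial.pderiv 1 G),
    MvPolynomial.eval q (MvPolynomial.pderiv 0 G)] with hw
  have hw0 : w ≠ 0 := by
    intro h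
    apply hd
    rw [differential_eq_zero_iff, Fin.forall_fin_two]
    exact ⟨congrFun h 1, by simpa [hw] using congrFun h 0⟩
  obtain ⟨r, hr, hr1⟩ := exists_normalize hw0
  have hv : IsTangent G q (r • w) := ⟨hq, hr1, by simp [differential_apply, hw]; ring,
    fun h => absurd h hd⟩
  refine ⟨r • w, hr1, fun u => ⟨fun hu => ?_, ?_⟩⟩
  · apply eq_or_eq_neg_of_dot_rot_eq_zero hu.unit hr1
    have := hu.differential
    rw [differential_apply] at this
    simp [dot, hw]
    linear_combination (-r) * this
  · rintro (rfl | rfl)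
    exacts [hv, hv.neg]

/-- An indefinite quadratic form is a product of two independent linear forms. -/
lemma exists_factor_quadratic {a b c : ℝ} (h : a * c - b ^ 2 < 0) :
    ∃ (w z : Plane) (k : ℝ), k ≠ 0 ∧ dot w (rot z) ≠ 0 ∧
      ∀ u : Plane, a * u 0 ^ 2 + 2 * b * u 0 * u 1 + c * u 1 ^ 2 =
        k * dot u (rot w) * dot u (rot z) := by
  by_cases ha : a = 0
  · have hb : b ≠ 0 := by rintro rfl; simp [ha] at h
    refine ⟨![1, 0], ![-c, 2 * b], -1, by norm_num, by simp [dot, hb], fun u => ?_⟩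
    simp [dot, ha]; ring
  · set s := Real.sqrt (b ^ 2 - a * c) with hs
    have hs2 : s ^ 2 = b ^ 2 - a * c := Real.sq_sqrt (by linarith)
    have hs0 : 0 < s := Real.sqrt_pos.2 (by linarith)
    refine ⟨![-b + s, a], ![-b - s, a], a⁻¹, inv_ne_zero ha, ?_, fun u => ?_⟩
    · have : dot ![-b + s, a] (rot ![-b - s, a]) = -2 * a * s := by simp [dot]; ring
      rw [this]
      exact mul_ne_zero (mul_ne_zero (by norm_num) ha) hs0.ne'
    · rw [mul_assoc a⁻¹, eq_inv_mul_iff_mul_eq₀ ha]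
      simp [dot]
      linear_combination (u 1 ^ 2) * hs2

/-- The tangent directions at a hyperbolic node. -/
lemma exists_isTangent_of_node {G : MvPolynomial (Fin 2) ℝ} {q : Plane}
    (hq : IsHyperbolicNode G q) :
    ∃ v w, normSq v = 1 ∧ normSq w = 1 ∧ dot w (rot v) ≠ 0 ∧
      ∀ u, IsTangent G q u ↔ (u = v ∨ u = -v) ∨ (u = w ∨ u = -w) := by
  obtain ⟨⟨hq0, hq1⟩, hdet⟩ := hq
  have hd : differential G q = 0 := differential_eq_zero_iff.2 hq1
  rw [eval_det_hessian] at hdet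
  obtain ⟨w, z, k, hk, hwz, hf⟩ := exists_factor_quadratic hdet
  have hw0 : w ≠ 0 := by rintro rfl; simp [dot] at hwz
  have hz0 : z ≠ 0 := by rintro rfl; simp [dot] at hwz
  obtain ⟨r, hr, hr1⟩ := exists_normalize hw0
  obtain ⟨s, hs, hs1⟩ := exists_normalize hz0
  have hrot : ∀ (u y : Plane) (x : ℝ), dot u (rot (x • y)) = x * dot u (rot y) := by
    intro u y x; simp [dot]; ring
  have hself : ∀ (y : Plane) (x : ℝ), dot (x • y) (rot y) = 0 := by
    intro u x; simp [dot]; ring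
  have hform : ∀ u, hessianForm G q u = k * dot u (rot w) * dot u (rot z) := hf
  have hT : ∀ u, normSq u = 1 → dot u (rot w) * dot u (rot z) = 0 → IsTangent G q u :=
    fun u hu h0 => ⟨hq0, hu, by simp [hd], fun _ => by rw [hform, mul_assoc, h0, mul_zero]⟩
  have hTw := hT (r • w) hr1 (by rw [hself, zero_mul])
  have hTz := hT (s • z) hs1 (by rw [hself, mul_zero])
  refine ⟨s • z, r • w, hs1, hr1, ?_, fun u => ⟨fun hu => ?_, ?_⟩⟩
  · rw [hrot]
    have : dot (r • w) (rot z) = r * dot w (rot z) := by simp [dot]; ring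
    rw [this]
    exact mul_ne_zero hs.ne' (mul_ne_zero hr.ne' hwz)
  · have h0 := hu.hessian hd
    rw [hform, mul_assoc, mul_eq_zero, or_iff_right hk, mul_eq_zero] at h0
    rcases h0 with h0 | h0
    · right
      exact eq_or_eq_neg_of_dot_rot_eq_zero hu.unit hr1 (by rw [hrot, h0, mul_zero])
    · left
      exact eq_or_eq_neg_of_dot_rot_eq_zero hu.unit hs1 (by rw [hrot, h0, mul_zero])
  · rintro ((rfl | rfl) | (rfl | rfl))
    exacts [hTz, hTz.neg, hTw, hTw.neg]

/-! ### Blowing up a point of the curve -/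

/-- The only singular points of the real curve `G = 0` are hyperbolic nodes. -/
abbrev IsNodal (G : MvPolynomial (Fin 2) ℝ) : Prop :=
  ∀ q ∈ realSingularPoints G, IsHyperbolicNode G q

variable {G : MvPolynomial (Fin 2) ℝ}

/-- Blowing up a point `q` of the curve: along the ray of direction `u`, the polynomial `G` is a
power of the length times a factor `P`, whose zeros over length `0` are the tangent directions; and
these zeros are simple. -/
lemma exists_blowup (hn : IsNodal G) {q : Plane} (hq : MvPolynomial.eval q G = 0) :
    ∃ (k : ℕ) (P : ℝ × Plane → ℝ), ContDiff ℝ ω P ∧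
      (∀ t u, MvPolynomial.eval (q + t • u) G = t ^ k * P (t, u)) ∧
      (∀ u, normSq u = 1 → (P (0, u) = 0 ↔ IsTangent G q u)) ∧
      (∀ u, IsTangent G q u →
        ∃ d, d ≠ 0 ∧ HasDerivAt (fun m : ℝ => P (0, u + m • rot u)) d 0) := by
  obtain ⟨P, hP, e, e'⟩ := exists_taylor G q
  by_cases hd : differential G q = 0
  · refine ⟨2, P, hP, fun t u => by rw [e, hq, hd]; simp, fun u hu => ?_, fun u hu => ?_⟩
    · constructor
      · intro h
        exact ⟨hq, hu, by simp [hd], fun _ => by rw [← e', h, mul_zero]⟩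
      · intro h
        have := e' u
        rw [h.hessian hd] at this
        linarith
    · have hdet := (hn q ⟨hq, differential_eq_zero_iff.1 hd⟩).2
      rw [eval_det_hessian] at hdet
      have h0 := hu.hessian hd
      have h1 := hu.unit
      unfold hessianForm at h0
      unfold normSq at h1
      set a := MvPolynomial.eval q (MvPolynomial.pderiv 0 (MvPolynomial.pderiv 0 G))
      set b := MvPolynomial.eval q (MvPolynomial.pderiv 0 (MvPolynomial.pderiv 1 G))
      set c := MvPolynomial.eval q (MvPolynomial.pderiv 1 (MvPolynomial.pderiv 1 G))
      refine ⟨-a * u 0 * u 1 + b * (u 0 ^ 2 - u 1 ^ 2) + c * u 0 * u 1, ?_, ?_⟩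
      · intro hB
        -- the determinant of the form in the orthonormal basis `u, rot u`
        have : a * c - b ^ 2 = (u 0 ^ 2 + u 1 ^ 2) ^ 2 * (a * c - b ^ 2) := by rw [h1]; ring
        have h2 : (u 0 ^ 2 + u 1 ^ 2) ^ 2 * (a * c - b ^ 2) =
          (a * u 0 ^ 2 + 2 * b * u 0 * u 1 + c * u 1 ^ 2) *
            (a * u 1 ^ 2 - 2 * b * u 0 * u 1 + c * u 0 ^ 2) -
          (-a * u 0 * u 1 + b * (u 0 ^ 2 - u 1 ^ 2) + c * u 0 * u 1) ^ 2 := by ring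
        rw [this, h2, h0, hB] at hdet
        simp at hdet
      · have h2 : (fun m : ℝ => P (0, u + m • rot u)) = fun m =>
            (a * (u 0 - m * u 1) ^ 2 + 2 * b * (u 0 - m * u 1) * (u 1 + m * u 0) +
              c * (u 1 + m * u 0) ^ 2) / 2 := by
          funext m
          have := e' (u + m • rot u)
          simp only [hessianForm, Pi.add_apply, Pi.smul_apply, rot_zero, rot_one, smul_eq_mul]
            at this
          rw [eq_div_iff two_ne_zero, mul_comm, this]
          ring
        rw [h2]
        have hx : HasDerivAt (fun m : ℝ => u 0 - m * u 1) (-u 1) 0 := by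
          simpa using ((hasDerivAt_id (0 : ℝ)).mul_const (u 1)).const_sub (u 0)
        have hy : HasDerivAt (fun m : ℝ => u 1 + m * u 0) (u 0) 0 := by
          simpa using ((hasDerivAt_id (0 : ℝ)).mul_const (u 0)).const_add (u 1)
        have := ((((hx.pow 2).const_mul a).add ((hx.const_mul (2 * b)).mul hy)).add
          ((hy.pow 2).const_mul c)).div_const 2
        convert! this using 1
        simp; ring
  · refine ⟨1, fun x => differential G q x.2 + x.1 * P x, ?_, fun t u => ?_, fun u hu => ?_,
      fun u hu => ?_⟩
    · exact ((differential G q).contDiff.comp contDiff_snd).add (contDiff_fst.mul hP)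
    · rw [e, hq]; ring
    · simp only [zero_mul, add_zero]
      exact ⟨fun h => ⟨hq, hu, h, fun h0 => absurd h0 hd⟩, fun h => h.differential⟩
    · refine ⟨differential G q (rot u), fun h =>
        hd (differential_eq_zero_of_basis hu.unit hu.differential h), ?_⟩
      simp only [zero_mul, add_zero, map_add, map_smul, hu.differential, zero_add]
      simpa using (hasDerivAt_id (0 : ℝ)).smul_const (differential G q (rot u))

end PlaneCurve

end

noncomputable section

namespace PlaneCurve

variable {G : MvPolynomial (Fin 2) ℝ}

/-! ### Local branches -/

/-- The local branch of the curve at `q` in the tangent direction `v`, as a graph over the tangent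
line in blown-up coordinates. -/
lemma exists_graph (hn : IsNodal G) {q v : Plane} (hv : IsTangent G q v) :
    ∃ ψ : ℝ → ℝ, ψ 0 = 0 ∧ (∀ᶠ t in 𝓝 0, ContDiffAt ℝ ∞ ψ t) ∧
      ∀ᶠ x : ℝ × ℝ in 𝓝 0, x.1 ≠ 0 →
        (MvPolynomial.eval (q + x.1 • (v + x.2 • rot v)) G = 0 ↔ ψ x.1 = x.2) := by
  obtain ⟨k, P, hP, e, hP0, hP1⟩ := exists_blowup hn hv.mem
  obtain ⟨d, hd, hder⟩ := hP1 v hv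
  -- solve `P (t, v + m • rot v) = 0` for `m` by the implicit function theorem; it applies at `m = 0`
  -- because the zeros of the blown-up equation are simple
  set Φ : ℝ × ℝ → ℝ := fun x => P (x.1, v + x.2 • rot v) with hΦ
  have hΦs : ContDiffAt ℝ ω Φ (0 : ℝ × ℝ) := by
    apply ContDiff.contDiffAt
    exact hP.comp (contDiff_fst.prodMk (contDiff_const.add (contDiff_snd.smul contDiff_const)))
  have hΦ0 : Φ 0 = 0 := by
    have := (hP0 v hv.unit).2 hv
    simpa [hΦ] using this
  have hinr : fderiv ℝ Φ (0 : ℝ × ℝ) ∘L .inr ℝ ℝ ℝ = d • ContinuousLinearMap.id ℝ ℝ := by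
    ext
    have h1 : HasFDerivAt Φ (fderiv ℝ Φ 0) (0 : ℝ × ℝ) :=
      (hΦs.differentiableAt (by simp)).hasFDerivAt
    have h2 : HasDerivAt (fun m : ℝ => ((0 : ℝ), m)) ((0 : ℝ), (1 : ℝ)) 0 :=
      (hasDerivAt_const (0 : ℝ) (0 : ℝ)).prodMk (hasDerivAt_id (0 : ℝ))
    have h3 := HasFDerivAt.comp_hasDerivAt (0 : ℝ) (f := fun m : ℝ => ((0 : ℝ), m)) h1 h2
    simpa using h3.unique hder
  have hinv : (fderiv ℝ Φ (0 : ℝ × ℝ) ∘L .inr ℝ ℝ ℝ).IsInvertible := by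
    rw [hinr]
    exact ⟨ContinuousLinearEquiv.smulLeft (Units.mk0 d hd), by ext; simp⟩
  have hω : (ω : ℕ∞ω) ≠ 0 := by simp
  refine ⟨hΦs.implicitFunction hω hinv, hΦs.implicitFunction_apply_self hω hinv, ?_, ?_⟩
  · filter_upwards [(hΦs.contDiffAt_implicitFunction hω hinv).eventually (by simp)] with t ht
    exact ht.of_le le_top
  · filter_upwards [hΦs.eventually_apply_eq_iff_implicitFunction hω hinv] with x hx h0
    rw [e, ← hx, hΦ0, mul_eq_zero, or_iff_right (pow_ne_zero _ h0)]

/-- A property that holds in a thin sector around each direction at `q` holds near `q`. -/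
lemma eventually_of_directions {q : Plane} {Q : Plane → Prop}
    (h : ∀ u, normSq u = 1 → ∀ᶠ x : ℝ × Plane in 𝓝 (0, u), x.1 ≠ 0 → Q (q + x.1 • x.2)) :
    ∀ᶠ q' in 𝓝[≠] q, Q q' := by
  have hcomp : IsCompact {u : Plane | normSq u = 1} := by
    refine Metric.isCompact_of_isClosed_isBounded
      (isClosed_eq continuous_normSq continuous_const) ?_
    refine isBounded_iff_forall_norm_le.2 ⟨1, fun u hu => norm_le_one_of_normSq_eq_one hu⟩
  -- the circle of directions is compact, so finitely many sectors suffice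
  have key : ∀ᶠ s : ℝ in 𝓝 0, ∀ u ∈ {u : Plane | normSq u = 1}, s ≠ 0 → Q (q + s • u) :=
    hcomp.eventually_forall_of_forall_eventually h
  have hlim : Tendsto (fun q' : Plane => Real.sqrt (normSq (q' - q))) (𝓝[≠] q) (𝓝 0) := by
    have : Continuous fun q' : Plane => Real.sqrt (normSq (q' - q)) := by fun_prop
    have h := this.tendsto q
    simp only [sub_self] at h
    rw [normSq_eq_zero.2 rfl, Real.sqrt_zero] at h
    exact h.mono_left nhdsWithin_le_nhds
  filter_upwards [hlim.eventually key, self_mem_nhdsWithin] with q' h1 h2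
  have hpos := normSq_pos (sub_ne_zero.2 h2)
  set s := Real.sqrt (normSq (q' - q)) with hs
  have hs0 : 0 < s := Real.sqrt_pos.2 hpos
  have h4 : q' = q + s • (s⁻¹ • (q' - q)) := by
    rw [smul_inv_smul₀ hs0.ne', add_sub_cancel]
  have h5 : normSq (s⁻¹ • (q' - q)) = 1 := by
    rw [normSq_smul, inv_pow, hs, Real.sq_sqrt hpos.le, inv_mul_cancel₀ hpos.ne']
  rw [h4]
  exact h1 _ h5 hs0.ne'

/-- The curve near a point `q` of it, away from `q`, lies in arbitrarily thin sectors around the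
tangent directions. -/
lemma eventually_of_sectors (hn : IsNodal G) {q : Plane} (hq : MvPolynomial.eval q G = 0)
    {Q : Plane → Prop}
    (hQ : ∀ v, IsTangent G q v → ∀ᶠ x : ℝ × ℝ in 𝓝 0, x.1 ≠ 0 →
      MvPolynomial.eval (q + x.1 • (v + x.2 • rot v)) G = 0 → Q (q + x.1 • (v + x.2 • rot v))) :
    ∀ᶠ q' in 𝓝[≠] q, MvPolynomial.eval q' G = 0 → Q q' := by
  obtain ⟨k, P, hP, e, hP0, -⟩ := exists_blowup hn hq
  refine eventually_of_directions fun u hu => ?_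
  by_cases hu0 : P (0, u) = 0
  · have hv := (hP0 u hu).1 hu0
    have huu : dot u u = 1 := by rw [← hu]; simp [dot, normSq]; ring
    have hur : dot u (rot u) = 0 := by simp [dot]; ring
    -- the coordinates `(t, m)`, in the chart `q + t • (u + m • rot u)`, of `q + s • w` with `w` near `u`
    have h1 : ContinuousAt (fun z : ℝ × Plane =>
        ((z.1 * dot z.2 u, dot z.2 (rot u) / dot z.2 u) : ℝ × ℝ)) (0, u) := by
      have c1 : ContinuousAt (fun z : ℝ × Plane => dot z.2 u) (0, u) :=
        ((continuous_dot u).comp continuous_snd).continuousAt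
      have c2 : ContinuousAt (fun z : ℝ × Plane => dot z.2 (rot u)) (0, u) :=
        ((continuous_dot (rot u)).comp continuous_snd).continuousAt
      exact (continuousAt_fst.mul c1).prodMk (c2.div c1 (by rw [huu]; exact one_ne_zero))
    have h2 : Tendsto (fun z : ℝ × Plane =>
        ((z.1 * dot z.2 u, dot z.2 (rot u) / dot z.2 u) : ℝ × ℝ)) (𝓝 (0, u)) (𝓝 0) := by
      have := h1.tendsto
      simpa [hur, huu, ← Prod.mk_zero_zero] using this
    have h3 : ∀ᶠ z : ℝ × Plane in 𝓝 (0, u), dot z.2 u ≠ 0 := by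
      refine ContinuousAt.eventually_ne
        ((continuous_dot u).comp continuous_snd).continuousAt ?_
      simp [huu]
    filter_upwards [h2.eventually (hQ u hv), h3] with z hz hz0 hs
    have h4 : z.1 • z.2 = (z.1 * dot z.2 u) • (u + (dot z.2 (rot u) / dot z.2 u) • rot u) := by
      conv_lhs => rw [eq_dot_smul_add hu z.2]
      rw [smul_add, smul_add, smul_smul, smul_smul, smul_smul]
      congr 2
      field_simp
    rw [h4]
    exact hz (mul_ne_zero hs hz0)
  · have : ∀ᶠ z : ℝ × Plane in 𝓝 (0, u), P z ≠ 0 :=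
      hP.continuous.continuousAt.eventually_ne hu0
    filter_upwards [this] with z hz hs h0
    rw [e] at h0
    exact absurd h0 (mul_ne_zero (pow_ne_zero _ hs) hz)

/-- `γ` is, near the parameter `t`, a smooth curve inside `G = 0`, with unit speed at `t`. -/
structure IsUnitAt (G : MvPolynomial (Fin 2) ℝ) (γ : ℝ → Plane) (t : ℝ) : Prop where
  smooth : ContDiffAt ℝ ∞ γ t
  mem : MvPolynomial.eval (γ t) G = 0
  unit : normSq (deriv γ t) = 1

lemma IsUnitAt.hasDerivAt {γ : ℝ → Plane} {t : ℝ} (h : IsUnitAt G γ t) :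
    HasDerivAt γ (deriv γ t) t :=
  (h.smooth.differentiableAt (by simp)).hasDerivAt

lemma contDiffAt_deriv {γ : ℝ → Plane} {t : ℝ} (h : ContDiffAt ℝ ∞ γ t) :
    ContDiffAt ℝ ∞ (deriv γ) t := by
  have h1 : ContDiffAt ℝ ∞ (fderiv ℝ γ) t := h.fderiv_right (by simp)
  exact h1.clm_apply contDiffAt_const

/-- The velocity of a unit-speed curve inside `G = 0` is tangent to a local branch. -/
lemma isTangent_of_hasDerivAt (hn : IsNodal G) {γ : ℝ → Plane} {v : Plane} {t : ℝ}
    (hd : HasDerivAt γ v t) (hv : normSq v = 1) (hγ : ∀ᶠ s in 𝓝 t, MvPolynomial.eval (γ s) G = 0) :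
    IsTangent G (γ t) v := by
  have hq := hγ.self_of_nhds
  obtain ⟨k, P, hP, e, hP0, -⟩ := exists_blowup hn hq
  rw [← hP0 v hv]
  -- the blown-up equation vanishes at length `s - t` and the direction of the secant; pass to the limit
  have h1 : Tendsto (fun s => ((s - t, slope γ t s) : ℝ × Plane)) (𝓝[≠] t) (𝓝 (0, v)) := by
    refine Tendsto.prodMk_nhds ?_ (hasDerivAt_iff_tendsto_slope.1 hd)
    have : Tendsto (fun s => s - t) (𝓝 t) (𝓝 (t - t)) := (continuous_sub_right t).tendsto t
    rw [sub_self] at this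
    exact this.mono_left nhdsWithin_le_nhds
  have h2 := (hP.continuous.tendsto (0, v)).comp h1
  refine tendsto_nhds_unique h2 (tendsto_const_nhds.congr' ?_)
  filter_upwards [hγ.filter_mono nhdsWithin_le_nhds, self_mem_nhdsWithin] with s hs hst
  have hst' : s - t ≠ 0 := sub_ne_zero.2 hst
  have h3 : γ t + (s - t) • slope γ t s = γ s := by
    rw [slope_def_module, smul_inv_smul₀ hst', add_sub_cancel]
  have h4 := e (s - t) (slope γ t s)
  rw [h3, hs] at h4
  exact ((mul_eq_zero.1 h4.symm).resolve_left (pow_ne_zero _ hst')).symm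

lemma IsUnitAt.isTangent (hn : IsNodal G) {γ : ℝ → Plane} {t : ℝ}
    (h : ∀ᶠ s in 𝓝 t, IsUnitAt G γ s) : IsTangent G (γ t) (deriv γ t) :=
  isTangent_of_hasDerivAt hn h.self_of_nhds.hasDerivAt h.self_of_nhds.unit (h.mono fun _ => (·.mem))

/-- A regular parametrization `c` of the local branch in direction `v`, and the reciprocal `g` of its
speed: the curve `c ∘ x` has unit speed if `x` solves the differential equation `x' = g x`. The last
clause says that `c` covers the curve in a sector around `v`. -/
lemma exists_branch (hn : IsNodal G) {q v : Plane} (hv : IsTangent G q v) :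
    ∃ (c : ℝ → Plane) (g : ℝ → ℝ), c 0 = q ∧ deriv c 0 = v ∧
      (∀ᶠ t in 𝓝 0, ContDiffAt ℝ ∞ c t ∧ MvPolynomial.eval (c t) G = 0 ∧
        ContDiffAt ℝ ∞ g t ∧ 0 < g t ∧ g t ^ 2 * normSq (deriv c t) = 1) ∧
      ∀ᶠ x : ℝ × ℝ in 𝓝 0, x.1 ≠ 0 →
        MvPolynomial.eval (q + x.1 • (v + x.2 • rot v)) G = 0 →
          q + x.1 • (v + x.2 • rot v) = c x.1 := by
  obtain ⟨ψ, hψ0, hψ, hψe⟩ := exists_graph hn hv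
  -- the graph of the function that describes the branch, over the tangent line
  set c : ℝ → Plane := fun t => q + t • (v + ψ t • rot v) with hc
  have hcs : ∀ᶠ t in 𝓝 0, ContDiffAt ℝ ∞ c t := by
    filter_upwards [hψ] with t ht
    exact contDiffAt_const.add (contDiffAt_id.smul (contDiffAt_const.add
      (ht.smul contDiffAt_const)))
  have hc0 : c 0 = q := by simp [hc]
  have hcd : deriv c 0 = v := by
    have h1 : HasDerivAt ψ (deriv ψ 0) 0 :=
      (hψ.self_of_nhds.differentiableAt (by simp)).hasDerivAt
    have h2 := (((hasDerivAt_id (0 : ℝ)).smul ((h1.smul_const (rot v)).const_add v)).const_add q)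
    have : HasDerivAt c v 0 := by
      convert! h2 using 1
      simp [hψ0]
    exact this.deriv
  have hpos : ∀ᶠ t in 𝓝 0, 0 < normSq (deriv c t) := by
    have h1 : ContinuousAt (fun t => normSq (deriv c t)) 0 :=
      continuous_normSq.continuousAt.comp (contDiffAt_deriv hcs.self_of_nhds).continuousAt
    refine h1.eventually (lt_mem_nhds ?_)
    simp only [hcd, hv.unit]
    exact one_pos
  refine ⟨c, fun t => (Real.sqrt (normSq (deriv c t)))⁻¹, hc0, hcd, ?_, ?_⟩
  · have hmem : ∀ᶠ t in 𝓝 0, MvPolynomial.eval (c t) G = 0 := by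
      have h1 : Tendsto (fun t => (t, ψ t)) (𝓝 0) (𝓝 (0 : ℝ × ℝ)) := by
        have := (continuousAt_id.prodMk hψ.self_of_nhds.continuousAt).tendsto
        simpa [hψ0, ← Prod.mk_zero_zero] using this
      filter_upwards [h1.eventually hψe] with t ht
      by_cases h0 : t = 0
      · rw [h0, hc0]; exact hv.mem
      · exact (ht h0).2 rfl
    filter_upwards [hcs, hmem, hpos] with t h1 h2 h3
    refine ⟨h1, h2, ?_, by positivity, ?_⟩
    · have hd := contDiffAt_deriv h1
      have h4 : ContDiffAt ℝ ∞ (fun t => normSq (deriv c t)) t :=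
        ((contDiffAt_pi.1 hd 0).pow 2).add ((contDiffAt_pi.1 hd 1).pow 2)
      exact (h4.sqrt h3.ne').inv (Real.sqrt_pos.2 h3).ne'
    · rw [inv_pow, Real.sq_sqrt h3.le, inv_mul_cancel₀ h3.ne']
  · filter_upwards [hψe] with x hx h0 hx0
    rw [hc]
    simp only
    rw [(hx h0).1 hx0]

/-- Solutions of an autonomous differential equation with smooth right-hand side are smooth. -/
lemma contDiffOn_of_hasDerivAt_comp {x g : ℝ → ℝ} {s : Set ℝ} (hs : IsOpen s)
    (hx : ∀ t ∈ s, HasDerivAt x (g (x t)) t) (hg : ∀ t ∈ s, ContDiffAt ℝ ∞ g (x t)) :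
    ContDiffOn ℝ ∞ x s := by
  have key : ∀ n : ℕ, ContDiffOn ℝ n x s := by
    intro n
    induction n with
    | zero =>
      exact contDiffOn_zero.2 fun t ht => (hx t ht).continuousAt.continuousWithinAt
    | succ n ih =>
      rw [Nat.cast_succ, contDiffOn_succ_iff_deriv_of_isOpen hs]
      refine ⟨fun t ht => (hx t ht).differentiableAt.differentiableWithinAt, by simp, ?_⟩
      refine ContDiffOn.congr (f := fun t => g (x t)) ?_ fun t ht => (hx t ht).deriv
      intro t ht
      exact ((hg t ht).of_le (by exact_mod_cast le_top)).comp_contDiffWithinAt t (ih t ht)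
  exact contDiffOn_infty.2 key

/-- Existence of a unit-speed curve in every tangent direction. -/
lemma exists_unit_germ (hn : IsNodal G) {q v : Plane} (hv : IsTangent G q v) :
    ∃ γ : ℝ → Plane, γ 0 = q ∧ deriv γ 0 = v ∧ ∀ᶠ t in 𝓝 0, IsUnitAt G γ t := by
  obtain ⟨c, g, hc0, hcd, hc, -⟩ := exists_branch hn hv
  have hg1 : ContDiffAt ℝ 1 g 0 := hc.self_of_nhds.2.2.1.of_le (by simp)
  obtain ⟨x, hx0, ε, hε, hx⟩ :=
    hg1.exists_forall_mem_closedBall_exists_eq_forall_mem_Ioo_hasDerivAt₀ 0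
  have hxc : ContinuousAt x 0 := (hx 0 (by simp [hε])).continuousAt
  have h1 : ∀ᶠ t in 𝓝 0, HasDerivAt x (g (x t)) t ∧ (ContDiffAt ℝ ∞ c (x t) ∧
      MvPolynomial.eval (c (x t)) G = 0 ∧
        ContDiffAt ℝ ∞ g (x t) ∧ 0 < g (x t) ∧ g (x t) ^ 2 * normSq (deriv c (x t)) = 1) := by
    refine (Filter.eventually_of_mem (Ioo_mem_nhds (by simpa) (by simpa)) hx).and ?_
    exact hxc.eventually (by rw [hx0]; exact hc)
  obtain ⟨s, hs, hso, h0s⟩ := eventually_nhds_iff.1 h1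
  have hxs : ContDiffOn ℝ ∞ x s :=
    contDiffOn_of_hasDerivAt_comp hso (fun t ht => (hs t ht).1) (fun t ht => (hs t ht).2.2.2.1)
  have hder : ∀ t ∈ s, HasDerivAt (fun t => c (x t)) (g (x t) • deriv c (x t)) t := fun t ht =>
    HasDerivAt.scomp t ((hs t ht).2.1.differentiableAt (by simp)).hasDerivAt (hs t ht).1
  refine ⟨fun t => c (x t), by simp [hx0, hc0], ?_, ?_⟩
  · rw [(hder 0 h0s).deriv, hx0, hcd]
    have h3 := hc.self_of_nhds.2.2.2
    rw [hcd, hv.unit, mul_one] at h3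
    rw [(pow_eq_one_iff_of_nonneg h3.1.le two_ne_zero).1 h3.2, one_smul]
  · filter_upwards [hso.mem_nhds h0s] with t ht
    refine ⟨(hs t ht).2.1.comp t ((hxs t ht).contDiffAt (hso.mem_nhds ht)), (hs t ht).2.2.1, ?_⟩
    rw [(hder t ht).deriv, normSq_smul]
    exact (hs t ht).2.2.2.2.2

/-- A unit-speed curve with initial velocity `v` runs along the local branch in direction `v`, and its
parameter `x` on the branch solves the equation of unit-speed reparametrizations. -/
lemma eventually_eq_branch {q v : Plane} {c : ℝ → Plane} {g : ℝ → ℝ}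
    (hv : IsTangent G q v) (hc0 : c 0 = q)
    (hc : ∀ᶠ t in 𝓝 0, ContDiffAt ℝ ∞ c t ∧ MvPolynomial.eval (c t) G = 0 ∧
        ContDiffAt ℝ ∞ g t ∧ 0 < g t ∧ g t ^ 2 * normSq (deriv c t) = 1)
    (hce : ∀ᶠ x : ℝ × ℝ in 𝓝 0, x.1 ≠ 0 →
        MvPolynomial.eval (q + x.1 • (v + x.2 • rot v)) G = 0 →
          q + x.1 • (v + x.2 • rot v) = c x.1)
    {γ : ℝ → Plane} (h0 : γ 0 = q) (h1 : deriv γ 0 = v) (hγ : ∀ᶠ t in 𝓝 0, IsUnitAt G γ t) :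
    ∃ x : ℝ → ℝ, x 0 = 0 ∧ HasStrictDerivAt x 1 0 ∧
      (∀ᶠ t in 𝓝 0, γ t = c (x t) ∧ HasDerivAt x (g (x t)) t) := by
  -- `x` and `dot (γ t - q) (rot v)` are the coordinates along and across the tangent line
  set x : ℝ → ℝ := fun t => dot (γ t - q) v with hx
  have hsm := hγ.self_of_nhds.smooth
  have hvv : dot v v = 1 := by rw [← hv.unit]; simp [dot, normSq]; ring
  have hvr : dot v (rot v) = 0 := by simp [dot]; ring
  have hxd : ∀ t, IsUnitAt G γ t → HasDerivAt x (dot (deriv γ t) v) t := by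
    intro t ht
    have hd := hasDerivAt_pi.1 ht.hasDerivAt
    exact (((hd 0).sub_const _).mul_const _).add (((hd 1).sub_const _).mul_const _)
  have hyd : HasDerivAt (fun t => dot (γ t - q) (rot v)) (dot (deriv γ 0) (rot v)) 0 := by
    have hd := hasDerivAt_pi.1 hγ.self_of_nhds.hasDerivAt
    exact (((hd 0).sub_const _).mul_const _).add (((hd 1).sub_const _).mul_const _)
  have hx0 : x 0 = 0 := by simp [hx, h0, dot]
  have hxd0 : HasDerivAt x 1 0 := by
    have := hxd 0 hγ.self_of_nhds
    rwa [h1, hvv] at this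
  have hxs : ContDiffAt ℝ ∞ x 0 := by
    have hd := contDiffAt_pi.1 hsm
    exact (((hd 0).sub contDiffAt_const).mul contDiffAt_const).add
      (((hd 1).sub contDiffAt_const).mul contDiffAt_const)
  have hxc : Tendsto x (𝓝 0) (𝓝 0) := by
    have := hxd0.continuousAt.tendsto
    rwa [hx0] at this
  have hne : ∀ᶠ t in 𝓝[≠] 0, x t ≠ 0 := by
    have := hxd0.eventually_ne (c := 0) one_ne_zero
    exact this
  -- the curve stays in thin sectors around `v`, where it is covered by the branch
  have hquot : Tendsto (fun t => dot (γ t - q) (rot v) / x t) (𝓝[≠] 0) (𝓝 0) := by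
    have a1 := hasDerivAt_iff_tendsto_slope.1 hxd0
    have a2 := hasDerivAt_iff_tendsto_slope.1 hyd
    rw [h1, hvr] at a2
    have a3 := a2.div a1 one_ne_zero
    rw [zero_div] at a3
    refine a3.congr' ?_
    filter_upwards [self_mem_nhdsWithin] with t ht
    simp only [Pi.div_apply, slope_def_field, sub_zero, hx0, h0, sub_self]
    have h2 : dot 0 (rot v) = 0 := by simp [dot]
    rw [h2, sub_zero, div_div_div_cancel_right₀ ht]
  have heq : ∀ᶠ t in 𝓝 0, γ t = c (x t) := by
    have h2 : Tendsto (fun t => (x t, dot (γ t - q) (rot v) / x t)) (𝓝[≠] 0) (𝓝 (0 : ℝ × ℝ)) :=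
      (hxc.mono_left nhdsWithin_le_nhds).prodMk_nhds hquot
    have h3 : ∀ᶠ t in 𝓝[≠] 0, γ t = c (x t) := by
      filter_upwards [h2.eventually hce, hne, hγ.filter_mono nhdsWithin_le_nhds] with t h3 h4 h5
      have h6 : γ t = q + x t • (v + (dot (γ t - q) (rot v) / x t) • rot v) := by
        rw [smul_add, smul_smul, mul_div_cancel₀ _ h4, hx]
        simp only
        rw [← eq_dot_smul_add hv.unit, add_sub_cancel]
      have h7 := h3 h4
      rw [← h6] at h7
      exact h7 h5.mem
    rw [eventually_nhdsWithin_iff] at h3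
    filter_upwards [h3] with t ht
    by_cases h : t = 0
    · rw [h, hx0, h0, hc0]
    · exact ht h
  refine ⟨x, hx0, hxs.hasStrictDerivAt' hxd0 (by simp), heq.and ?_⟩
  -- `x'` and `g x` are both positive, with the same square
  have hpos : ∀ᶠ t in 𝓝 0, 0 < dot (deriv γ t) v := by
    have : ContinuousAt (fun t => dot (deriv γ t) v) 0 :=
      (continuous_dot v).continuousAt.comp (contDiffAt_deriv hsm).continuousAt
    refine this.eventually (lt_mem_nhds ?_)
    simp only [h1, hvv]
    exact one_pos
  filter_upwards [heq.eventually_nhds, hpos, hγ, hxc.eventually hc] with t a1 a2 a3 a4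
  have b1 : deriv γ t = dot (deriv γ t) v • deriv c (x t) := by
    have : HasDerivAt (fun t => c (x t)) (dot (deriv γ t) v • deriv c (x t)) t :=
      HasDerivAt.scomp t (a4.1.differentiableAt (by simp)).hasDerivAt (hxd t a3)
    exact (this.congr_of_eventuallyEq a1).deriv
  have b2 : dot (deriv γ t) v ^ 2 * normSq (deriv c (x t)) = 1 := by
    rw [← normSq_smul, ← b1, a3.unit]
  have b3 : dot (deriv γ t) v = g (x t) := by
    have b4 : normSq (deriv c (x t)) ≠ 0 := by
      intro h; rw [h, mul_zero] at b2; exact zero_ne_one b2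
    have b5 := mul_right_cancel₀ b4 (b2.trans a4.2.2.2.2.symm)
    exact (pow_left_inj₀ a2.le a4.2.2.2.1.le two_ne_zero).1 b5
  rw [← b3]
  exact hxd t a3

lemma IsUnitAt.comp_add {γ : ℝ → Plane} {t a : ℝ} (h : IsUnitAt G γ (t + a)) :
    IsUnitAt G (fun s => γ (s + a)) t := by
  refine ⟨?_, h.mem, ?_⟩
  · exact ContDiffAt.comp t (f := fun s => s + a) h.smooth (contDiffAt_id.add contDiffAt_const)
  · rw [deriv_comp_add_const]; exact h.unit

lemma IsUnitAt.comp_neg {γ : ℝ → Plane} {t : ℝ} (h : IsUnitAt G γ (-t)) :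
    IsUnitAt G (fun s => γ (-s)) t := by
  refine ⟨?_, h.mem, ?_⟩
  · exact ContDiffAt.comp t (f := fun s => -s) h.smooth contDiffAt_id.neg
  · rw [deriv_comp_neg, normSq_neg]; exact h.unit

/-- Two such curves have the same parameter on the local branch, by uniqueness of solutions of the
differential equation of unit-speed reparametrizations. -/
lemma unit_germ_unique_zero (hn : IsNodal G) {γ₁ γ₂ : ℝ → Plane}
    (h₁ : ∀ᶠ s in 𝓝 0, IsUnitAt G γ₁ s) (h₂ : ∀ᶠ s in 𝓝 0, IsUnitAt G γ₂ s)
    (h : γ₁ 0 = γ₂ 0) (h' : deriv γ₁ 0 = deriv γ₂ 0) : γ₁ =ᶠ[𝓝 0] γ₂ := by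
  have hv := IsUnitAt.isTangent hn h₁
  obtain ⟨c, g, hc0, hcd, hc, hce⟩ := exists_branch hn hv
  obtain ⟨x, hx0, hxs, hx⟩ := eventually_eq_branch hv hc0 hc hce rfl rfl h₁
  obtain ⟨y, hy0, hys, hy⟩ := eventually_eq_branch hv hc0 hc hce h.symm h'.symm h₂
  have hg1 : ContDiffAt ℝ 1 g 0 := hc.self_of_nhds.2.2.1.of_le (by simp)
  obtain ⟨K, s, hs, hK⟩ := hg1.exists_lipschitzOnWith
  have hxy : x =ᶠ[𝓝 0] y := by
    refine ODE_solution_unique_of_eventually (v := fun _ => g) (s := fun _ => s) (K := K)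
      (Eventually.of_forall fun _ => hK) ?_ ?_ (hx0.trans hy0.symm)
    · filter_upwards [hx, hxs.hasDerivAt.continuousAt.eventually (by rw [hx0]; exact hs)] with t a b
      exact ⟨a.2, b⟩
    · filter_upwards [hy, hys.hasDerivAt.continuousAt.eventually (by rw [hy0]; exact hs)] with t a b
      exact ⟨a.2, b⟩
  filter_upwards [hx, hy, hxy] with t a b e
  rw [a.1, b.1, e]

lemma tendsto_add_const_nhds_zero (t : ℝ) : Tendsto (fun s => s + t) (𝓝 0) (𝓝 t) := by
  simpa using (continuous_add_const t).tendsto 0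

lemma tendsto_sub_const_nhds (t : ℝ) : Tendsto (fun s => s - t) (𝓝 t) (𝓝 0) := by
  simpa using (continuous_sub_right t).tendsto t

/-- Local uniqueness of unit-speed curves with given initial position and velocity. -/
lemma unit_germ_unique (hn : IsNodal G) {γ₁ γ₂ : ℝ → Plane} {t : ℝ}
    (h₁ : ∀ᶠ s in 𝓝 t, IsUnitAt G γ₁ s) (h₂ : ∀ᶠ s in 𝓝 t, IsUnitAt G γ₂ s)
    (h : γ₁ t = γ₂ t) (h' : deriv γ₁ t = deriv γ₂ t) : γ₁ =ᶠ[𝓝 t] γ₂ := by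
  have ht := tendsto_add_const_nhds_zero t
  have key : (fun s => γ₁ (s + t)) =ᶠ[𝓝 0] (fun s => γ₂ (s + t)) := by
    refine unit_germ_unique_zero hn ?_ ?_ (by simpa using h) (by simpa [deriv_comp_add_const])
    · exact (ht.eventually h₁).mono fun s hs => hs.comp_add
    · exact (ht.eventually h₂).mono fun s hs => hs.comp_add
  filter_upwards [(tendsto_sub_const_nhds t).eventually key] with s hs
  simpa using hs

lemma exists_isTangent (hn : IsNodal G) {q : Plane} (hq : MvPolynomial.eval q G = 0) :
    ∃ v, IsTangent G q v := by
  by_cases hd : differential G q = 0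
  · obtain ⟨v, w, -, -, -, h⟩ := exists_isTangent_of_node
      (hn q ⟨hq, differential_eq_zero_iff.1 hd⟩)
    exact ⟨v, (h v).2 (Or.inl (Or.inl rfl))⟩
  · obtain ⟨v, -, h⟩ := exists_isTangent_of_smooth hq hd
    exact ⟨v, (h v).2 (Or.inl rfl)⟩

/-- Near a point `q` of the curve, every point of the curve lies on one of the given unit-speed
curves through `q`. -/
lemma eventually_mem_unit_germ (hn : IsNodal G) {q : Plane} (hq : MvPolynomial.eval q G = 0)
    {Γ : Plane → ℝ → Plane} (hΓ : ∀ v, IsTangent G q v → Γ v 0 = q ∧ deriv (Γ v) 0 = v ∧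
      ∀ᶠ t in 𝓝 0, IsUnitAt G (Γ v) t) {η : ℝ} (hη : 0 < η) :
    ∀ᶠ q' in 𝓝 q, MvPolynomial.eval q' G = 0 →
      ∃ v, IsTangent G q v ∧ ∃ t, |t| < η ∧ q' = Γ v t := by
  have key := eventually_of_sectors (Q := fun q' => ∃ v, IsTangent G q v ∧
    ∃ t, |t| < η ∧ q' = Γ v t) hn hq ?_
  · rw [eventually_nhdsWithin_iff] at key
    filter_upwards [key] with q' hq' h0
    by_cases h : q' = q
    · obtain ⟨v, hv⟩ := exists_isTangent hn hq
      exact ⟨v, hv, 0, by simpa using hη, h.trans (hΓ v hv).1.symm⟩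
    · exact hq' h h0
  · intro v hv
    obtain ⟨h0, h1, h2⟩ := hΓ v hv
    obtain ⟨c, g, hc0, hcd, hc, hce⟩ := exists_branch hn hv
    obtain ⟨x, hx0, hxs, hx⟩ := eventually_eq_branch hv hc0 hc hce h0 h1 h2
    -- the parameter on the branch is a local diffeomorphism, so the unit-speed curve covers the branch
    have hmap := hxs.map_nhds_eq one_ne_zero
    rw [hx0] at hmap
    have hev : ∀ᶠ t in 𝓝 (0 : ℝ), |t| < η ∧ Γ v t = c (x t) := by
      refine Eventually.and ?_ (hx.mono fun t ht => ht.1)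
      exact continuous_abs.continuousAt.eventually_lt continuousAt_const (by simpa using hη)
    have hex : ∀ᶠ s in 𝓝 (0 : ℝ), ∃ t, |t| < η ∧ Γ v t = c s := by
      rw [← hmap, eventually_map]
      exact hev.mono fun t ht => ⟨t, ht⟩
    have hfst : Tendsto Prod.fst (𝓝 (0 : ℝ × ℝ)) (𝓝 (0 : ℝ)) := continuous_fst.tendsto 0
    filter_upwards [hce, hfst.eventually hex] with z hz ⟨t, ht, hct⟩ hz0 hzG
    exact ⟨v, hv, t, ht, (hz hz0 hzG).trans hct.symm⟩

end PlaneCurve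

end

noncomputable section

namespace PlaneCurve

variable {G : MvPolynomial (Fin 2) ℝ}

/-! ### Complete unit-speed curves -/

lemma IsUnitAt.congr {γ₁ γ₂ : ℝ → Plane} {t : ℝ} (h : IsUnitAt G γ₁ t) (he : γ₂ =ᶠ[𝓝 t] γ₁) :
    IsUnitAt G γ₂ t :=
  ⟨h.smooth.congr_of_eventuallyEq he, by rw [he.eq_of_nhds]; exact h.mem, by
    rw [he.deriv_eq]; exact h.unit⟩

/-- Unit-speed curves with the same position and velocity at one parameter coincide: the agreement set
is open by local uniqueness and closed by continuity. -/
lemma unit_curve_eqOn (hn : IsNodal G) {γ₁ γ₂ : ℝ → Plane} {s : Set ℝ} (hs : IsOpen s)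
    (hsc : IsPreconnected s) (h₁ : ∀ t ∈ s, IsUnitAt G γ₁ t) (h₂ : ∀ t ∈ s, IsUnitAt G γ₂ t)
    {t₀ : ℝ} (ht₀ : t₀ ∈ s) (h : γ₁ t₀ = γ₂ t₀) (h' : deriv γ₁ t₀ = deriv γ₂ t₀) :
    EqOn γ₁ γ₂ s := by
  have key : s ⊆ {t | γ₁ =ᶠ[𝓝 t] γ₂} := by
    refine hsc.subset_of_closure_inter_subset isOpen_setOfPred_eventually_nhds ⟨t₀, ht₀, ?_⟩ ?_
    · exact unit_germ_unique hn (eventually_of_mem (hs.mem_nhds ht₀) h₁)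
        (eventually_of_mem (hs.mem_nhds ht₀) h₂) h h'
    · rintro t ⟨htc, hts⟩
      refine unit_germ_unique hn (eventually_of_mem (hs.mem_nhds hts) h₁)
        (eventually_of_mem (hs.mem_nhds hts) h₂) ?_ ?_
      · refine tendsto_nhds_unique_of_frequently_eq (h₁ t hts).smooth.continuousAt
          (h₂ t hts).smooth.continuousAt ?_
        exact (mem_closure_iff_frequently.1 htc).mono fun x hx => hx.eq_of_nhds
      · refine tendsto_nhds_unique_of_frequently_eq
          (contDiffAt_deriv (h₁ t hts).smooth).continuousAt
          (contDiffAt_deriv (h₂ t hts).smooth).continuousAt ?_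
        exact (mem_closure_iff_frequently.1 htc).mono fun x hx => hx.deriv_eq
  exact fun t ht => (key ht).eq_of_nhds

lemma finite_isTangent (hn : IsNodal G) (q : Plane) : {v | IsTangent G q v}.Finite := by
  by_cases hq : MvPolynomial.eval q G = 0
  · by_cases hd : differential G q = 0
    · obtain ⟨v, w, -, -, -, h⟩ := exists_isTangent_of_node
        (hn q ⟨hq, differential_eq_zero_iff.1 hd⟩)
      refine Set.Finite.subset (s := {v, -v, w, -w}) (by simp) fun u hu => ?_
      have := (h u).1 hu
      simp only [mem_insert_iff, mem_singleton_iff]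
      tauto
    · obtain ⟨v, -, h⟩ := exists_isTangent_of_smooth hq hd
      refine Set.Finite.subset (s := {v, -v}) (by simp) fun u hu => ?_
      simpa using (h u).1 hu
  · exact Set.finite_empty.subset fun v hv => hq hv.mem

lemma eq_or_eq_neg_of_smooth {q u v : Plane} (hd : differential G q ≠ 0)
    (hu : IsTangent G q u) (hv : IsTangent G q v) : u = v ∨ u = -v := by
  obtain ⟨w, -, h⟩ := exists_isTangent_of_smooth hu.mem hd
  rcases (h u).1 hu with rfl | rfl <;> rcases (h v).1 hv with rfl | rfl <;> simp

lemma eventually_smooth (hs : (realSingularPoints G).Finite) (q : Plane) :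
    ∀ᶠ q' in 𝓝[≠] q, MvPolynomial.eval q' G = 0 → differential G q' ≠ 0 := by
  have h : ((realSingularPoints G) \ {q})ᶜ ∈ 𝓝 q :=
    (hs.subset sdiff_subset).isClosed.isOpen_compl.mem_nhds (by simp)
  filter_upwards [mem_nhdsWithin_of_mem_nhds h, self_mem_nhdsWithin] with q' h1 h2 h3 h4
  exact h1 ⟨⟨h3, differential_eq_zero_iff.1 h4⟩, h2⟩

/-- There is a unit-speed curve inside `G = 0`, defined on `(-a, b)`, with initial position `q` and
initial velocity `v`. -/
def HasUnitCurve (G : MvPolynomial (Fin 2) ℝ) (q v : Plane) (a b : ℝ) : Prop :=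
  ∃ γ : ℝ → Plane, γ 0 = q ∧ deriv γ 0 = v ∧ ∀ t ∈ Ioo (-a) b, IsUnitAt G γ t

lemma HasUnitCurve.neg {q v : Plane} {a b : ℝ} (h : HasUnitCurve G q v a b) :
    HasUnitCurve G q (-v) b a := by
  obtain ⟨γ, h0, h1, h2⟩ := h
  refine ⟨fun t => γ (-t), by simpa, by simp [deriv_comp_neg, h1], fun t ht => ?_⟩
  exact (h2 (-t) ⟨by linarith [ht.2], by linarith [ht.1]⟩).comp_neg

lemma HasUnitCurve.mono {q v : Plane} {a b a' b' : ℝ} (h : HasUnitCurve G q v a b) (ha : a' ≤ a)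
    (hb : b' ≤ b) : HasUnitCurve G q v a' b' := by
  obtain ⟨γ, h0, h1, h2⟩ := h
  exact ⟨γ, h0, h1, fun t ht => h2 t ⟨by linarith [ht.1], by linarith [ht.2]⟩⟩

/-- Near a point of the curve, unit-speed curves exist for a uniform time: all of them are
translates or reversals of the curves through that point. -/
lemma eventually_hasUnitCurve (hn : IsNodal G) (hs : (realSingularPoints G).Finite) {q : Plane}
    (hq : MvPolynomial.eval q G = 0) :
    ∃ ε > 0, ∀ᶠ q' in 𝓝 q, ∀ v, IsTangent G q' v → HasUnitCurve G q' v ε ε := by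
  classical
  choose! Γ h0 h1 h2 using fun v (hv : IsTangent G q v) => exists_unit_germ hn hv
  have h3 : ∀ᶠ ε in 𝓝[>] (0 : ℝ), ∀ v ∈ {v | IsTangent G q v}, ∀ t ∈ Ioo (-(2 * ε)) (2 * ε),
      IsUnitAt G (Γ v) t := by
    rw [eventually_all_finite (finite_isTangent hn q)]
    intro v hv
    obtain ⟨δ, hδ, hball⟩ := Metric.eventually_nhds_iff_ball.1 (h2 v hv)
    filter_upwards [Ioo_mem_nhdsGT (half_pos hδ)] with ε hε t ht
    apply hball
    rw [Real.ball_eq_Ioo]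
    exact ⟨by linarith [ht.1, hε.2], by linarith [ht.2, hε.2]⟩
  obtain ⟨ε, hε, hε0⟩ := (h3.and self_mem_nhdsWithin).exists
  have hε0 : 0 < ε := hε0
  refine ⟨ε, hε0, ?_⟩
  filter_upwards [eventually_mem_unit_germ hn hq (fun v hv => ⟨h0 v hv, h1 v hv, h2 v hv⟩) hε0,
    eventually_nhdsWithin_iff.1 (eventually_smooth hs q)] with q' hq' hsm v hv
  by_cases hqq : q' = q
  · subst hqq
    refine ⟨Γ v, h0 v hv, h1 v hv, fun t ht => hε v hv t ⟨?_, ?_⟩⟩ <;> linarith [ht.1, ht.2]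
  · obtain ⟨w, hw, t, ht, rfl⟩ := hq' hv.mem
    rw [abs_lt] at ht
    have hunit : ∀ s ∈ Ioo (-ε) ε, IsUnitAt G (fun s => Γ w (s + t)) s := fun s hs' =>
      (hε w hw (s + t) ⟨by linarith [hs'.1, ht.1], by linarith [hs'.2, ht.2]⟩).comp_add
    have hw' : IsTangent G (Γ w t) (deriv (Γ w) t) := by
      refine IsUnitAt.isTangent hn (eventually_of_mem (Ioo_mem_nhds ?_ ?_) (hε w hw)) <;> linarith
    have hE : HasUnitCurve G (Γ w t) (deriv (Γ w) t) ε ε :=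
      ⟨fun s => Γ w (s + t), by simp, by simp [deriv_comp_add_const], hunit⟩
    rcases eq_or_eq_neg_of_smooth (hsm hqq hv.mem) hv hw' with rfl | rfl
    · exact hE
    · exact hE.neg

lemma isCompact_zeroSet_inter (G : MvPolynomial (Fin 2) ℝ) (R : ℝ) :
    IsCompact {q : Plane | MvPolynomial.eval q G = 0 ∧ ‖q‖ ≤ R} := by
  refine Metric.isCompact_of_isClosed_isBounded
    ((isClosed_eq (continuous_eval G) continuous_const).inter
      (isClosed_le continuous_norm continuous_const)) ?_
  exact isBounded_iff_forall_norm_le.2 ⟨R, fun q hq => hq.2⟩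

lemma exists_uniform_hasUnitCurve (hn : IsNodal G) (hs : (realSingularPoints G).Finite) (R : ℝ) :
    ∃ ε > 0, ∀ q, ‖q‖ ≤ R → ∀ v, IsTangent G q v → HasUnitCurve G q v ε ε := by
  obtain ⟨ε, hε, h⟩ := (isCompact_zeroSet_inter G R).induction_on
    (p := fun s => ∃ ε > 0, ∀ q ∈ s, ∀ v, IsTangent G q v → HasUnitCurve G q v ε ε)
    ⟨1, one_pos, by simp⟩
    (fun s t hst ⟨ε, hε, h⟩ => ⟨ε, hε, fun q hq => h q (hst hq)⟩)
    (fun s t ⟨ε, hε, h⟩ ⟨δ, hδ, h'⟩ => ⟨min ε δ, lt_min hε hδ, by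
      rintro q (hq | hq) v hv
      · exact (h q hq v hv).mono (min_le_left _ _) (min_le_left _ _)
      · exact (h' q hq v hv).mono (min_le_right _ _) (min_le_right _ _)⟩)
    (fun q hq => by
      obtain ⟨ε, hε, h⟩ := eventually_hasUnitCurve hn hs hq.1
      exact ⟨_, mem_nhdsWithin_of_mem_nhds h, ε, hε, fun q' hq' => hq'⟩)
  exact ⟨ε, hε, fun q hq v hv => h q ⟨hv.mem, hq⟩ v hv⟩

/-- Prolongation of a unit-speed curve to the right, by uniform local existence. -/
lemma HasUnitCurve.extend (hn : IsNodal G) {q v : Plane} {a b N ε : ℝ} (ha : 0 < a) (hb : 0 < b)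
    (hbN : b ≤ N) (hε : 0 < ε)
    (hloc : ∀ q', ‖q'‖ ≤ ‖q‖ + N → ∀ v, IsTangent G q' v → HasUnitCurve G q' v ε ε)
    (h : HasUnitCurve G q v a b) : HasUnitCurve G q v a (b + ε / 2) := by
  obtain ⟨γ, h0, h1, h2⟩ := h
  -- restart at a parameter `τ` at most `ε / 2` before the end
  set τ := max 0 (b - ε / 2) with hτ
  have hτ0 : 0 ≤ τ := le_max_left _ _
  have hτb : τ < b := max_lt hb (by linarith)
  have hτb' : b - ε / 2 ≤ τ := le_max_right _ _
  have hτm : τ ∈ Ioo (-a) b := ⟨by linarith, hτb⟩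
  -- unit speed bounds the distance travelled, so uniform local existence applies at `γ τ`
  have hnorm : ‖γ τ‖ ≤ ‖q‖ + N := by
    have h3 : ‖γ τ - γ 0‖ ≤ 1 * ‖τ - 0‖ := by
      refine (convex_Ioo (-a) b).norm_image_sub_le_of_norm_deriv_le (𝕜 := ℝ)
        (fun t ht => (h2 t ht).hasDerivAt.differentiableAt)
        (fun t ht => norm_le_one_of_normSq_eq_one (h2 t ht).unit) ⟨by linarith, hb⟩ hτm
    rw [h0, one_mul, sub_zero, Real.norm_of_nonneg hτ0] at h3
    have h4 := norm_sub_norm_le (γ τ) q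
    linarith
  have htan : IsTangent G (γ τ) (deriv γ τ) :=
    IsUnitAt.isTangent hn (eventually_of_mem (Ioo_mem_nhds hτm.1 hτm.2) h2)
  obtain ⟨δ, d0, d1, d2⟩ := hloc _ hnorm _ htan
  have d2' : ∀ t ∈ Ioo (τ - ε) (τ + ε), IsUnitAt G (fun s => δ (s + -τ)) t := fun t ht =>
    (d2 (t + -τ) ⟨by linarith [ht.1], by linarith [ht.2]⟩).comp_add
  have hagree : EqOn γ (fun s => δ (s + -τ)) (Ioo (max (-a) (τ - ε)) b) := by
    refine unit_curve_eqOn hn isOpen_Ioo isPreconnected_Ioo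
      (fun t ht => h2 t ⟨(le_max_left _ _).trans_lt ht.1, ht.2⟩)
      (fun t ht => d2' t ⟨(le_max_right _ _).trans_lt ht.1, by linarith [ht.2]⟩)
      (t₀ := τ) ⟨max_lt hτm.1 (by linarith), hτb⟩ (by simp [d0]) (by simp [deriv_comp_add_const, d1])
  set γ' : ℝ → Plane := fun t => if t < b then γ t else δ (t + -τ) with hγ'
  have e1 : ∀ t < b, γ' =ᶠ[𝓝 t] γ := fun t ht => by
    filter_upwards [gt_mem_nhds ht] with s hs'
    simp only [hγ', if_pos hs']
  have e2 : ∀ t, b ≤ t → γ' =ᶠ[𝓝 t] fun s => δ (s + -τ) := fun t ht => by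
    have hm : max (-a) (τ - ε) < t := max_lt (by linarith) (by linarith)
    filter_upwards [lt_mem_nhds hm] with s hs'
    by_cases hsb : s < b
    · simp only [hγ', if_pos hsb]
      exact hagree ⟨hs', hsb⟩
    · simp only [hγ', if_neg hsb]
  refine ⟨γ', by simp [hγ', hb, h0], by rw [(e1 0 hb).deriv_eq, h1], fun t ht => ?_⟩
  by_cases htb : t < b
  · exact (h2 t ⟨ht.1, htb⟩).congr (e1 t htb)
  · rw [not_lt] at htb
    exact (d2' t ⟨by linarith, by linarith [ht.2]⟩).congr (e2 t htb)

lemma HasUnitCurve.extend_to (hn : IsNodal G) (hs : (realSingularPoints G).Finite) {q v : Plane}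
    {a b N : ℝ} (ha : 0 < a) (hb : 0 < b) (hN : 0 < N)
    (h : HasUnitCurve G q v a b) : HasUnitCurve G q v a N := by
  obtain ⟨ε, hε, hloc⟩ := exists_uniform_hasUnitCurve hn hs (‖q‖ + N)
  have key : ∀ k : ℕ, HasUnitCurve G q v a (min (b + k * (ε / 2)) N) := by
    intro k
    induction k with
    | zero => exact h.mono le_rfl (by simp)
    | succ k ih =>
      have := ih.extend hn ha (lt_min (by positivity) hN) (min_le_right _ _) hε hloc
      refine this.mono le_rfl ?_
      rw [← min_add_add_right]
      refine min_le_min (by push_cast; linarith) (by linarith)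
  obtain ⟨k, hk⟩ := exists_nat_gt (N / (ε / 2))
  rw [div_lt_iff₀ (by positivity)] at hk
  have := key k
  rwa [min_eq_right (by linarith)] at this

/-- A complete unit-speed curve inside `G = 0`. -/
def IsUnitCurve (G : MvPolynomial (Fin 2) ℝ) (γ : ℝ → Plane) : Prop := ∀ t, IsUnitAt G γ t

/-- Unit-speed curves inside `G = 0` can be prolonged forever, also through the nodes. -/
lemma exists_isUnitCurve (hn : IsNodal G) (hs : (realSingularPoints G).Finite) {q v : Plane}
    (hv : IsTangent G q v) : ∃ γ, IsUnitCurve G γ ∧ γ 0 = q ∧ deriv γ 0 = v := by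
  obtain ⟨ε, hε, hloc⟩ := exists_uniform_hasUnitCurve hn hs ‖q‖
  have hN : ∀ N : ℕ, HasUnitCurve G q v (N + 1) (N + 1) := by
    intro N
    have h1 := (hloc q le_rfl v hv).extend_to hn hs hε hε (N.cast_add_one_pos (α := ℝ))
    have h2 := h1.neg.extend_to hn hs N.cast_add_one_pos hε (N.cast_add_one_pos (α := ℝ))
    simpa using h2.neg
  choose γ h0 h1 h2 using hN
  have hcomp : ∀ M N : ℕ, M ≤ N → ∀ t ∈ Ioo (-(M + 1) : ℝ) (M + 1), γ M t = γ N t := by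
    intro M N hMN
    have hMN' : (M : ℝ) ≤ N := by exact_mod_cast hMN
    have hpos : (0 : ℝ) < M + 1 := by positivity
    refine unit_curve_eqOn hn isOpen_Ioo isPreconnected_Ioo (h2 M) (fun t ht => h2 N t ?_)
      (t₀ := 0) ⟨by linarith, hpos⟩ (by rw [h0, h0]) (by rw [h1, h1])
    exact ⟨by linarith [ht.1], by linarith [ht.2]⟩
  -- the solutions on growing intervals are compatible; take their union
  set δ : ℝ → Plane := fun t => γ ⌈|t|⌉₊ t with hδ
  have hδe : ∀ (M : ℕ) (t : ℝ), |t| < M + 1 → δ t = γ M t := by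
    intro M t ht
    have ht' := abs_lt.1 ht
    have h3 : |t| < (⌈|t|⌉₊ : ℝ) + 1 := (Nat.le_ceil _).trans_lt (lt_add_one _)
    rcases le_total M ⌈|t|⌉₊ with h | h
    · exact (hcomp _ _ h t ⟨by linarith, ht'.2⟩).symm
    · have h3' := abs_lt.1 h3
      exact hcomp _ _ h t ⟨by linarith, h3'.2⟩
  have hev : ∀ (M : ℕ) (t : ℝ), |t| < M + 1 → δ =ᶠ[𝓝 t] γ M := by
    intro M t ht
    filter_upwards [continuous_abs.continuousAt.eventually_lt continuousAt_const ht] with s hs'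
    exact hδe M s hs'
  refine ⟨δ, fun t => ?_, ?_, ?_⟩
  · have h3 : |t| < (⌈|t|⌉₊ : ℝ) + 1 := (Nat.le_ceil _).trans_lt (lt_add_one _)
    have h4 := abs_lt.1 h3
    exact (h2 ⌈|t|⌉₊ t ⟨by linarith, h4.2⟩).congr (hev _ t h3)
  · rw [hδe 0 0 (by simp), h0]
  · rw [(hev 0 0 (by simp)).deriv_eq, h1]

lemma IsUnitCurve.isTangent (hn : IsNodal G) {γ : ℝ → Plane} (h : IsUnitCurve G γ) (t : ℝ) :
    IsTangent G (γ t) (deriv γ t) :=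
  IsUnitAt.isTangent hn (Eventually.of_forall h)

lemma IsUnitCurve.comp_add {γ : ℝ → Plane} (h : IsUnitCurve G γ) (a : ℝ) :
    IsUnitCurve G fun s => γ (s + a) := fun t => (h (t + a)).comp_add

lemma IsUnitCurve.comp_neg {γ : ℝ → Plane} (h : IsUnitCurve G γ) :
    IsUnitCurve G fun s => γ (-s) := fun t => (h (-t)).comp_neg

lemma IsUnitCurve.eq_of_eq (hn : IsNodal G) {γ₁ γ₂ : ℝ → Plane} (h₁ : IsUnitCurve G γ₁)
    (h₂ : IsUnitCurve G γ₂) {s t : ℝ} (h : γ₁ s = γ₂ t) (h' : deriv γ₁ s = deriv γ₂ t) (x : ℝ) :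
    γ₁ (x + s) = γ₂ (x + t) :=
  unit_curve_eqOn hn isOpen_univ isPreconnected_univ (fun x _ => h₁.comp_add s x)
    (fun x _ => h₂.comp_add t x) (mem_univ 0) (by simpa using h)
    (by simpa [deriv_comp_add_const] using h') (mem_univ x)

lemma IsUnitCurve.eq_of_eq_neg (hn : IsNodal G) {γ₁ γ₂ : ℝ → Plane} (h₁ : IsUnitCurve G γ₁)
    (h₂ : IsUnitCurve G γ₂) {s t : ℝ} (h : γ₁ s = γ₂ t) (h' : deriv γ₁ s = -deriv γ₂ t) (x : ℝ) :
    γ₁ (x + s) = γ₂ (-x + t) := by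
  have := h₁.eq_of_eq hn h₂.comp_neg (s := s) (t := -t) (by simpa using h)
    (by simpa [deriv_comp_neg] using h') x
  simpa [add_comm t] using this

/-- The complete unit-speed curve with initial position `q` and initial velocity `v`. -/
def flowCurve (G : MvPolynomial (Fin 2) ℝ) (q v : Plane) : ℝ → Plane :=
  open Classical in
  if h : ∃ γ, IsUnitCurve G γ ∧ γ 0 = q ∧ deriv γ 0 = v then h.choose else 0

lemma flowCurve_spec (hn : IsNodal G) (hs : (realSingularPoints G).Finite) {q v : Plane}
    (hv : IsTangent G q v) : IsUnitCurve G (flowCurve G q v) ∧ flowCurve G q v 0 = q ∧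
      deriv (flowCurve G q v) 0 = v := by
  have h := exists_isUnitCurve hn hs hv
  rw [flowCurve, dif_pos h]
  exact h.choose_spec

/-- Near a point `q` of the curve, all tangent directions are velocities, at small times, of the
unit-speed curves starting at `q`. -/
lemma eventually_eq_flowCurve (hn : IsNodal G) (hs : (realSingularPoints G).Finite) {q : Plane}
    (hq : MvPolynomial.eval q G = 0) {η : ℝ} (hη : 0 < η) :
    ∀ᶠ q' in 𝓝 q, ∀ v', IsTangent G q' v' → ∃ v, IsTangent G q v ∧ ∃ t, |t| < η ∧
      q' = flowCurve G q v t ∧ v' = deriv (flowCurve G q v) t := by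
  filter_upwards [eventually_mem_unit_germ (Γ := flowCurve G q) hn hq (fun v hv => by
      obtain ⟨h1, h2, h3⟩ := flowCurve_spec hn hs hv
      exact ⟨h2, h3, Eventually.of_forall h1⟩) hη,
    eventually_nhdsWithin_iff.1 (eventually_smooth hs q)] with q' hq' hsm v' hv'
  by_cases hqq : q' = q
  · subst hqq
    obtain ⟨-, h2, h3⟩ := flowCurve_spec hn hs hv'
    exact ⟨v', hv', 0, by simpa, h2.symm, h3.symm⟩
  · obtain ⟨v, hv, t, ht, rfl⟩ := hq' hv'.mem
    obtain ⟨h1, h2, h3⟩ := flowCurve_spec hn hs hv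
    rcases eq_or_eq_neg_of_smooth (hsm hqq hv'.mem) hv' (h1.isTangent hn t) with rfl | rfl
    · exact ⟨v, hv, t, ht, rfl, rfl⟩
    · obtain ⟨k1, k2, k3⟩ := flowCurve_spec hn hs hv.neg
      have h4 : (fun s => flowCurve G q (-v) (-s)) = flowCurve G q v := by
        funext s
        have := h1.eq_of_eq_neg hn k1 (h2.trans k2.symm) (by rw [h3, k3, neg_neg]) s
        simpa using this.symm
      refine ⟨-v, hv.neg, -t, by rwa [abs_neg], (congrFun h4 t).symm, ?_⟩
      have h5 := congrArg (fun f => deriv f t) h4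
      simp only [deriv_comp_neg] at h5
      rw [← h5, neg_neg]

/-- The part of the curve inside a disk is covered by finitely many arcs. -/
lemma exists_finite_cover (hn : IsNodal G) (hs : (realSingularPoints G).Finite) (R : ℝ) :
    ∃ A : Set (Plane × Plane), A.Finite ∧ (∀ a ∈ A, IsTangent G a.1 a.2) ∧
      ∀ q v, ‖q‖ ≤ R → IsTangent G q v → ∃ a ∈ A, ∃ t, |t| < 1 ∧
        q = flowCurve G a.1 a.2 t ∧ v = deriv (flowCurve G a.1 a.2) t := by
  obtain ⟨A, hA, hA', h⟩ := (isCompact_zeroSet_inter G R).induction_on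
    (p := fun s => ∃ A : Set (Plane × Plane), A.Finite ∧ (∀ a ∈ A, IsTangent G a.1 a.2) ∧
      ∀ q ∈ s, ∀ v, IsTangent G q v → ∃ a ∈ A, ∃ t, |t| < 1 ∧
        q = flowCurve G a.1 a.2 t ∧ v = deriv (flowCurve G a.1 a.2) t)
    ⟨∅, by simp⟩
    (fun s t hst ⟨A, hA, hA', h⟩ => ⟨A, hA, hA', fun q hq => h q (hst hq)⟩)
    (fun s t ⟨A, hA, hA', h⟩ ⟨B, hB, hB', h'⟩ => ⟨A ∪ B, hA.union hB, by
      rintro a (ha | ha)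
      exacts [hA' a ha, hB' a ha], by
      rintro q (hq | hq) v hv
      · obtain ⟨a, ha, h2⟩ := h q hq v hv
        exact ⟨a, Or.inl ha, h2⟩
      · obtain ⟨a, ha, h2⟩ := h' q hq v hv
        exact ⟨a, Or.inr ha, h2⟩⟩)
    (fun q hq => by
      refine ⟨_, mem_nhdsWithin_of_mem_nhds (eventually_eq_flowCurve hn hs hq.1 one_pos),
        (fun v => (q, v)) '' {v | IsTangent G q v}, (finite_isTangent hn q).image _, ?_, ?_⟩
      · rintro _ ⟨v, hv, rfl⟩
        exact hv
      · intro q' hq' v' hv'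
        obtain ⟨v, hv, t, ht, h1, h2⟩ := hq' v' hv'
        exact ⟨(q, v), ⟨v, hv, rfl⟩, t, ht, h1, h2⟩)
  exact ⟨A, hA, hA', fun q v hq hv => h q ⟨hv.mem, hq⟩ v hv⟩

end PlaneCurve

end

noncomputable section

namespace PlaneCurve

variable {G : MvPolynomial (Fin 2) ℝ}

/-! ### The global branches of the curve -/

lemma IsUnitCurve.continuous {γ : ℝ → Plane} (h : IsUnitCurve G γ) : Continuous γ :=
  continuous_iff_continuousAt.2 fun t => (h t).smooth.continuousAt

lemma IsUnitCurve.not_const {γ : ℝ → Plane} (h : IsUnitCurve G γ) (q : Plane) :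
    ¬ ∀ t, γ t = q := by
  intro hc
  have h1 : γ = fun _ => q := funext hc
  have h2 := (h 0).unit
  rw [h1] at h2
  simp [normSq] at h2

/-- The group of periods of a curve. -/
def periods (γ : ℝ → Plane) : AddSubgroup ℝ where
  carrier := {a | ∀ t, γ (t + a) = γ t}
  zero_mem' := by simp
  add_mem' := by
    intro a b ha hb t
    rw [← add_assoc, hb, ha]
  neg_mem' := by
    intro a ha t
    rw [← ha (t + -a), neg_add_cancel_right]

lemma mem_periods {γ : ℝ → Plane} {a : ℝ} : a ∈ periods γ ↔ ∀ t, γ (t + a) = γ t := Iff.rfl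

/-- The periods are the multiples of a least one, which is `0` if the curve is not periodic; a dense
group of periods would force the curve to be constant. -/
lemma IsUnitCurve.exists_period {γ : ℝ → Plane} (h : IsUnitCurve G γ) :
    ∃ T : ℝ, 0 ≤ T ∧ ∀ a, a ∈ periods γ ↔ ∃ n : ℤ, a = n * T := by
  rcases (periods γ).dense_or_cyclic with hd | ⟨a, ha⟩
  · exfalso
    refine h.not_const (γ 0) fun t => ?_
    have := Continuous.ext_on hd h.continuous (continuous_const (y := γ 0)) (fun x hx => by
      simpa using mem_periods.1 hx 0)
    exact congrFun this t
  · refine ⟨|a|, abs_nonneg a, fun x => ?_⟩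
    rw [ha, AddSubgroup.mem_closure_singleton]
    rcases abs_choice a with h1 | h1
    · rw [h1]
      simp only [zsmul_eq_mul, eq_comm]
    · rw [h1]
      constructor
      · rintro ⟨n, rfl⟩
        exact ⟨-n, by simp⟩
      · rintro ⟨n, rfl⟩
        exact ⟨-n, by simp⟩

/-- A unit-speed curve without periods leaves every bounded set: each of the finitely many arcs
covering the part of `G = 0` in a disk is visited at most once. -/
lemma IsUnitCurve.isBounded_preimage (hn : IsNodal G) (hs : (realSingularPoints G).Finite)
    {γ : ℝ → Plane} (h : IsUnitCurve G γ) (hp : ∀ a ∈ periods γ, a = 0) (R : ℝ) :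
    Bornology.IsBounded {t | ‖γ t‖ ≤ R} := by
  obtain ⟨A, hA, hA', hcov⟩ := exists_finite_cover hn hs R
  have hsub : {t | ‖γ t‖ ≤ R} ⊆ ⋃ a ∈ A, {t | ∃ s, |s| < 1 ∧
      γ t = flowCurve G a.1 a.2 s ∧ deriv γ t = deriv (flowCurve G a.1 a.2) s} := by
    intro t ht
    obtain ⟨a, ha, s, hs1, h1, h2⟩ := hcov (γ t) (deriv γ t) ht (h.isTangent hn t)
    simp only [mem_iUnion]
    exact ⟨a, ha, s, hs1, h1, h2⟩
  refine Bornology.IsBounded.subset ((Bornology.isBounded_biUnion hA).2 fun a ha => ?_) hsub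
  have hf := (flowCurve_spec hn hs (hA' a ha)).1
  refine Metric.isBounded_iff.2 ⟨2, ?_⟩
  rintro t₁ ⟨s₁, hs₁, h1, h1'⟩ t₂ ⟨s₂, hs₂, h2, h2'⟩
  have e1 := h.eq_of_eq hn hf h1 h1'
  have e2 := h.eq_of_eq hn hf h2 h2'
  -- two visits of an arc are a period apart, up to the difference of the positions on the arc
  have hper : t₁ - s₁ - t₂ + s₂ ∈ periods γ := by
    intro x
    have a1 := e1 (x - t₂ + s₂ - s₁)
    have a2 := e2 (x - t₂)
    rw [show x - t₂ + s₂ - s₁ + t₁ = x + (t₁ - s₁ - t₂ + s₂) by ring] at a1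
    rw [show x - t₂ + t₂ = x by ring] at a2
    rw [a1, a2]
    congr 1
    ring
  have := hp _ hper
  rw [abs_lt] at hs₁ hs₂
  rw [Real.dist_eq, abs_le]
  constructor <;> linarith

lemma IsUnitCurve.hasDerivAt_normSq {γ : ℝ → Plane} (h : IsUnitCurve G γ) (t : ℝ) :
    HasDerivAt (fun s => normSq (γ s)) (2 * dot (γ t) (deriv γ t)) t := by
  have hd := hasDerivAt_pi.1 (h t).hasDerivAt
  have := ((hd 0).pow 2).add ((hd 1).pow 2)
  convert! this using 1
  simp [dot]; ring

/-- Where the distance to the origin is stationary along a unit-speed curve, the curve is tangent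
to a circle centred at the origin. -/
lemma IsUnitCurve.angular_eq_zero (hn : IsNodal G) {γ : ℝ → Plane} (h : IsUnitCurve G γ) {t : ℝ}
    (h0 : dot (γ t) (deriv γ t) = 0) : MvPolynomial.eval (γ t) (angular G) = 0 := by
  have ht := (h.isTangent hn t)
  have hd := ht.differential
  have hu := ht.unit
  set v := deriv γ t
  set q := γ t
  rw [differential_apply] at hd
  unfold normSq at hu
  unfold dot at h0
  simp only [angular, map_sub, map_mul, MvPolynomial.eval_X]
  set a := MvPolynomial.eval q (MvPolynomial.pderiv 0 G)
  set b := MvPolynomial.eval q (MvPolynomial.pderiv 1 G)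
  linear_combination (-(q 0 * b) + q 1 * a) * hu + (q 0 * v 1 - q 1 * v 0) * hd +
    (b * v 0 - a * v 1) * h0

/-- The curve has finitely many global branches: lines and closed curves, parametrized by arc
length. The family `curve` contains every complete unit-speed curve inside `G = 0` exactly once, up
to translation and reversal of the parameter. -/
structure BranchSystem (G : MvPolynomial (Fin 2) ℝ) where
  /-- the index set of the branches -/
  Branch : Type
  finite : Finite Branch
  /-- the parametrization of a branch -/
  curve : Branch → ℝ → Plane
  /-- the least period of a branch, or `0` if the branch is not periodic -/
  period : Branch → ℝ
  isUnitCurve : ∀ b, IsUnitCurve G (curve b)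
  period_nonneg : ∀ b, 0 ≤ period b
  mem_periods : ∀ b a, a ∈ periods (curve b) ↔ ∃ n : ℤ, a = n * period b
  base_smooth : ∀ b, differential G (curve b 0) ≠ 0
  exists_param : ∀ q v, IsTangent G q v →
    ∃ b t, curve b t = q ∧ (deriv (curve b) t = v ∨ deriv (curve b) t = -v)
  branch_eq : ∀ b b' t t', curve b t = curve b' t' →
    (deriv (curve b) t = deriv (curve b') t' ∨ deriv (curve b) t = -deriv (curve b') t') → b = b'

/-- Complete unit-speed curves up to translation and reversal of the parameter. -/
def curveSetoid (G : MvPolynomial (Fin 2) ℝ) : Setoid {γ // IsUnitCurve G γ} where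
  r γ δ := ∃ a, (∀ x, γ.1 x = δ.1 (x + a)) ∨ (∀ x, γ.1 x = δ.1 (-x + a))
  iseqv := by
    refine ⟨fun γ => ⟨0, Or.inl fun x => by simp⟩, ?_, ?_⟩
    · rintro γ δ ⟨a, h | h⟩
      · exact ⟨-a, Or.inl fun x => by rw [h]; simp⟩
      · exact ⟨a, Or.inr fun x => by rw [h]; simp⟩
    · rintro γ δ ε ⟨a, h | h⟩ ⟨b, h' | h'⟩
      · exact ⟨a + b, Or.inl fun x => by rw [h, h', add_assoc]⟩
      · exact ⟨-a + b, Or.inr fun x => by rw [h, h']; ring_nf⟩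
      · exact ⟨a + b, Or.inr fun x => by rw [h, h', add_assoc]⟩
      · exact ⟨-a + b, Or.inl fun x => by rw [h, h']; ring_nf⟩

lemma curveSetoid_of_eq (hn : IsNodal G) {γ δ : {γ // IsUnitCurve G γ}} {s t : ℝ}
    (h : γ.1 s = δ.1 t) (h' : deriv γ.1 s = deriv δ.1 t ∨ deriv γ.1 s = -deriv δ.1 t) :
    (curveSetoid G).r γ δ := by
  rcases h' with h' | h'
  · refine ⟨t - s, Or.inl fun x => ?_⟩
    have := γ.2.eq_of_eq hn δ.2 h h' (x - s)
    rw [sub_add_cancel] at this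
    rw [this]; ring_nf
  · refine ⟨s + t, Or.inr fun x => ?_⟩
    have := γ.2.eq_of_eq_neg hn δ.2 h h' (x - s)
    rw [sub_add_cancel] at this
    rw [this]; ring_nf

lemma IsUnitCurve.exists_smooth (hs : (realSingularPoints G).Finite) {γ : ℝ → Plane}
    (h : IsUnitCurve G γ) : ∃ t, differential G (γ t) ≠ 0 := by
  by_contra! hc
  have h1 : (range γ).Finite := hs.subset (by
    rintro _ ⟨t, rfl⟩
    exact ⟨(h t).mem, differential_eq_zero_iff.1 (hc t)⟩)
  have h2 : (range γ).Subsingleton :=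
    h1.countable.isTotallyDisconnected _ subset_rfl (isPreconnected_range h.continuous)
  exact h.not_const (γ 0) fun t => h2 ⟨t, rfl⟩ ⟨0, rfl⟩

lemma norm_sq_le_normSq (q : Plane) : ‖q‖ ^ 2 ≤ normSq q := by
  have : ‖q‖ ≤ Real.sqrt (normSq q) := by
    refine (pi_norm_le_iff_of_nonneg (Real.sqrt_nonneg _)).2 fun i => ?_
    rw [Real.norm_eq_abs]
    apply Real.abs_le_sqrt
    unfold normSq
    fin_cases i
    · simp; positivity
    · simp; positivity
  calc ‖q‖ ^ 2 ≤ Real.sqrt (normSq q) ^ 2 := by gcongr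
    _ = normSq q := Real.sq_sqrt (normSq_nonneg _)

/-- Every complete unit-speed curve is tangent to a circle centred at the origin, at its point
nearest to the origin. -/
lemma IsUnitCurve.exists_angular_eq_zero (hn : IsNodal G) (hs : (realSingularPoints G).Finite)
    {γ : ℝ → Plane} (h : IsUnitCurve G γ) : ∃ t, MvPolynomial.eval (γ t) (angular G) = 0 := by
  have hcont : Continuous fun t => normSq (γ t) := continuous_normSq.comp h.continuous
  suffices ∃ t, ∀ s, normSq (γ t) ≤ normSq (γ s) by
    obtain ⟨t, ht⟩ := this
    have hmin : IsLocalMin (fun s => normSq (γ s)) t := Eventually.of_forall ht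
    have := hmin.hasDerivAt_eq_zero (h.hasDerivAt_normSq t)
    exact ⟨t, h.angular_eq_zero hn (by linarith)⟩
  obtain ⟨T, hT0, hT⟩ := h.exists_period
  rcases hT0.eq_or_lt with rfl | hT0
  · have hb := h.isBounded_preimage hn hs (fun a ha => by
      obtain ⟨n, rfl⟩ := (hT a).1 ha
      simp)
    refine hcont.exists_forall_le ?_
    rw [tendsto_atTop]
    intro b
    have := (Metric.isBounded_iff_subset_closedBall 0).1 (hb (max b 1))
    obtain ⟨M, hM⟩ := this
    filter_upwards [(isCompact_closedBall (0 : ℝ) M).compl_mem_cocompact] with t ht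
    have h1 : ¬ ‖γ t‖ ≤ max b 1 := fun h0 => ht (hM h0)
    rw [not_le] at h1
    have h2 : b ≤ ‖γ t‖ := (le_max_left _ _).trans h1.le
    have h3 : 1 ≤ ‖γ t‖ := (le_max_right _ _).trans h1.le
    have h4 := norm_sq_le_normSq (γ t)
    nlinarith
  · obtain ⟨t, -, ht⟩ := (isCompact_Icc (a := (0 : ℝ)) (b := T)).exists_isMinOn
      ⟨0, by simp [hT0.le]⟩ hcont.continuousOn
    refine ⟨t, fun s => ?_⟩
    have hper : Function.Periodic γ T := mem_periods.1 ((hT T).2 ⟨1, by simp⟩)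
    obtain ⟨y, hy, hys⟩ := hper.exists_mem_Ico₀ hT0 s
    rw [hys]
    exact ht ⟨hy.1, hy.2.le⟩

/-- There are finitely many branches, since each of them is tangent to a circle centred at the origin,
and the tangencies lie in a disk, which is covered by finitely many arcs. -/
lemma nonempty_branchSystem (hfin : (criticalPoints G).Finite) (hn : IsNodal G)
    (hs : (realSingularPoints G).Finite) : Nonempty (BranchSystem G) := by
  obtain ⟨R, hR⟩ := isBounded_iff_forall_norm_le.1 (isBounded_tangencies hfin)
  obtain ⟨A, hA, hA', hcov⟩ := exists_finite_cover hn hs R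
  have hfinite : Finite (Quotient (curveSetoid G)) := by
    have := hA.to_subtype
    refine Finite.of_surjective (fun a : A => (Quotient.mk (curveSetoid G)
      ⟨flowCurve G a.1.1 a.1.2, (flowCurve_spec hn hs (hA' a.1 a.2)).1⟩)) ?_
    intro c
    obtain ⟨⟨γ, hγ⟩, rfl⟩ := Quotient.exists_rep c
    obtain ⟨t, ht⟩ := hγ.exists_angular_eq_zero hn hs
    obtain ⟨a, ha, s, -, h1, h2⟩ := hcov _ _ (hR _ ⟨(hγ t).mem, ht⟩) (hγ.isTangent hn t)
    exact ⟨⟨a, ha⟩, Quotient.sound (curveSetoid_of_eq hn h1.symm (Or.inl h2.symm))⟩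
  -- representatives whose base point is smooth
  have hrep : ∀ c : Quotient (curveSetoid G), ∃ γ : {γ // IsUnitCurve G γ},
      Quotient.mk _ γ = c ∧ differential G (γ.1 0) ≠ 0 := by
    intro c
    obtain ⟨⟨γ, hγ⟩, rfl⟩ := Quotient.exists_rep c
    obtain ⟨t, ht⟩ := hγ.exists_smooth hs
    exact ⟨⟨_, hγ.comp_add t⟩, Quotient.sound ⟨t, Or.inl fun x => rfl⟩, by simpa using ht⟩
  choose γ hγ hγ0 using hrep
  choose T hT0 hT using fun c => (γ c).2.exists_period
  refine ⟨⟨Quotient (curveSetoid G), hfinite, fun c => (γ c).1, T, fun c => (γ c).2, hT0, hT, hγ0,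
    ?_, ?_⟩⟩
  · intro q v hv
    obtain ⟨h1, h2, h3⟩ := flowCurve_spec hn hs hv
    set c := Quotient.mk (curveSetoid G) ⟨flowCurve G q v, h1⟩ with hc
    obtain ⟨a, h | h⟩ := Quotient.exact ((hγ c).trans hc).symm
    · replace h : ∀ x, flowCurve G q v x = (γ c).1 (x + a) := h
      refine ⟨c, a, ?_, Or.inl ?_⟩
      · rw [← h2, h, zero_add]
      · have h' : flowCurve G q v = fun x => (γ c).1 (x + a) := funext h
        rw [← h3, h', deriv_comp_add_const, zero_add]
    · replace h : ∀ x, flowCurve G q v x = (γ c).1 (-x + a) := h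
      refine ⟨c, a, ?_, Or.inr ?_⟩
      · rw [← h2, h, neg_zero, zero_add]
      · have h' : flowCurve G q v = fun x => (fun y => (γ c).1 (y + a)) (-x) := funext h
        rw [← h3, h', deriv_comp_neg (f := fun y => (γ c).1 (y + a)), deriv_comp_add_const, neg_zero, zero_add, neg_neg]
  · intro b b' t t' h h'
    rw [← hγ b, ← hγ b']
    exact Quotient.sound (curveSetoid_of_eq hn h h')

namespace BranchSystem

variable (B : BranchSystem G)

/-- Two parameters on a branch with the same position and the same tangent line differ by a
multiple of the period. -/
lemma param_eq (hn : IsNodal G) {b : B.Branch} {t t' : ℝ} (h : B.curve b t = B.curve b t')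
    (h' : deriv (B.curve b) t = deriv (B.curve b) t' ∨
      deriv (B.curve b) t = -deriv (B.curve b) t') : ∃ n : ℤ, t' = t + n * B.period b := by
  have hu := B.isUnitCurve b
  rcases h' with h' | h'
  · have h1 := hu.eq_of_eq hn hu h h'
    have : t' - t ∈ periods (B.curve b) := by
      intro x
      have := h1 (x - t)
      rw [sub_add_cancel] at this
      rw [this]; ring_nf
    obtain ⟨n, hn'⟩ := (B.mem_periods b _).1 this
    exact ⟨n, by rw [← hn']; ring⟩
  · exfalso
    -- a curve equal to its own reversal would have velocity zero at the fixed parameter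
    have h1 := funext (hu.eq_of_eq_neg hn hu h h')
    have h2 := congrArg (fun f => deriv f ((t' - t) / 2)) h1
    simp only [deriv_comp_add_const] at h2
    have h3 : deriv (fun x => B.curve b (-x + t')) ((t' - t) / 2) =
        -deriv (B.curve b) (-((t' - t) / 2) + t') := by
      rw [deriv_comp_neg (f := fun y => B.curve b (y + t')), deriv_comp_add_const]
    rw [h3, show (t' - t) / 2 + t = (t + t') / 2 by ring,
      show -((t' - t) / 2) + t' = (t + t') / 2 by ring, self_eq_neg] at h2
    exact ne_zero_of_normSq_eq_one (hu _).unit h2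

lemma add_period (b : B.Branch) (n : ℤ) (t : ℝ) :
    B.curve b (t + n * B.period b) = B.curve b t :=
  PlaneCurve.mem_periods.1 ((B.mem_periods b _).2 ⟨n, rfl⟩) t

end BranchSystem

end PlaneCurve

end

noncomputable section

namespace PlaneCurve

/-! ### Gluing functions off a nowhere dense set -/

/-- A function on a dense set that is constant near each point of a preconnected open set, including
the points off the dense set, is constant. -/
lemma eq_of_eventually_const {X A : Type*} [TopologicalSpace X] {D U : Set X} (hD : Dense D)
    (hU : IsOpen U) (hUc : IsPreconnected U) {g : X → A}
    (h : ∀ x ∈ U, ∃ c, ∀ᶠ y in 𝓝[D] x, g y = c) {x y : X} (hx : x ∈ U ∩ D) (hy : y ∈ U ∩ D) :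
    g x = g y := by
  have : Nonempty A := ⟨g x⟩
  choose! c hc using h
  have hcont : ∀ x ∈ U, ∀ᶠ y in 𝓝 x, c y = c x := by
    intro x hx
    have h1 := eventually_eventually_nhdsWithin.2 (hc x hx)
    rw [eventually_nhdsWithin_iff] at h1
    have h2 := eventually_eventually_nhds.2 (eventually_nhdsWithin_iff.1 (hc x hx))
    filter_upwards [h2, hU.mem_nhds hx] with y hy hyU
    have := mem_closure_iff_nhdsWithin_neBot.1 (hD y)
    obtain ⟨z, hz1, hz2⟩ := ((hc y hyU).and (eventually_nhdsWithin_iff.2 hy)).exists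
    rw [← hz1, hz2]
  have hself : ∀ x ∈ U ∩ D, g x = c x := fun x hx => (hc x hx.1).self_of_nhdsWithin hx.2
  rw [hself x hx, hself y hy]
  let : TopologicalSpace A := ⊥
  have : DiscreteTopology A := ⟨rfl⟩
  refine hUc.constant (f := c) ?_ hx.1 hy.1
  intro z hz
  exact ((continuousAt_const (y := c z)).congr
    ((hcont z hz).mono fun w hw => hw.symm)).continuousWithinAt

/-- A relation on pairs `a ≤ b` that holds locally and is preserved by concatenation of adjacent
intervals holds everywhere. -/
lemma interval_induction {Q : ℝ → ℝ → Prop}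
    (hloc : ∀ x, ∃ ε > 0, ∀ a b, x - ε < a → a ≤ b → b < x + ε → Q a b)
    (hcat : ∀ a b c, a ≤ b → b ≤ c → Q a b → Q b c → Q a c) {a b : ℝ} (hab : a ≤ b) : Q a b := by
  choose ε hε h using hloc
  obtain ⟨t, ht0, hmono, ⟨n, hn⟩, hsub⟩ := exists_monotone_Icc_subset_open_cover_Icc hab
    (c := fun x : ℝ => {y : Icc a b | (y : ℝ) ∈ Ioo (x - ε x) (x + ε x)})
    (fun x => isOpen_Ioo.preimage continuous_subtype_val)
    (fun y _ => mem_iUnion.2 ⟨(y : ℝ), by constructor <;> linarith [hε (y : ℝ)]⟩)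
  have key : ∀ k, Q (t 0) (t k) := by
    intro k
    induction k with
    | zero =>
      obtain ⟨x, hx⟩ := hsub 0
      have := hx ⟨le_rfl, hmono (Nat.zero_le 1)⟩
      exact h x _ _ this.1 le_rfl this.2
    | succ k ih =>
      obtain ⟨x, hx⟩ := hsub k
      have h1 := hx ⟨le_rfl, hmono (Nat.le_succ k)⟩
      have h2 := hx ⟨hmono (Nat.le_succ k), le_rfl⟩
      exact hcat _ _ _ (hmono (Nat.zero_le k)) (hmono (Nat.le_succ k)) ih
        (h x _ _ h1.1 (hmono (Nat.le_succ k)) h2.2)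
  have := key n
  rwa [ht0, hn n le_rfl] at this

section Gluing

variable {A : Type*} [AddCommGroup A] {D : Set Plane} {g : Plane → Plane → A}

/-- `f` solves on `U` the gluing problem for the local functions `g q`: near every point `q` of `U`
it agrees with `g q` up to a constant. -/
def IsGlued (D : Set Plane) (g : Plane → Plane → A) (U : Set Plane) (f : Plane → A) : Prop :=
  ∀ q ∈ U, ∃ c, ∀ᶠ y in 𝓝[D] q, f y - g q y = c

lemma IsGlued.mono {U U' : Set Plane} {f : Plane → A} (h : IsGlued D g U f) (hU : U' ⊆ U) :
    IsGlued D g U' f := fun q hq => h q (hU hq)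

lemma IsGlued.congr {U : Set Plane} (hU : IsOpen U) {f f' : Plane → A} (h : IsGlued D g U f)
    {c : A} (hf : ∀ y ∈ U ∩ D, f' y = f y + c) : IsGlued D g U f' := by
  intro q hq
  obtain ⟨b, hb⟩ := h q hq
  refine ⟨b + c, ?_⟩
  filter_upwards [hb, mem_nhdsWithin_of_mem_nhds (hU.mem_nhds hq), self_mem_nhdsWithin]
    with y h1 h2 h3
  rw [hf y ⟨h2, h3⟩, ← h1]
  abel

lemma IsGlued.sub_eq (hD : Dense D) {U : Set Plane} (hU : IsOpen U) (hUc : IsPreconnected U)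
    {f f' : Plane → A} (h : IsGlued D g U f) (h' : IsGlued D g U f') {x y : Plane}
    (hx : x ∈ U ∩ D) (hy : y ∈ U ∩ D) : f' x - f x = f' y - f y := by
  refine eq_of_eventually_const (g := fun y => f' y - f y) hD hU hUc (fun q hq => ?_) hx hy
  obtain ⟨b, hb⟩ := h q hq
  obtain ⟨b', hb'⟩ := h' q hq
  refine ⟨b' - b, ?_⟩
  filter_upwards [hb, hb'] with y h1 h2
  rw [← h1, ← h2]
  abel

/-- Two solutions whose domains have a preconnected intersection can be merged. -/
lemma IsGlued.exists_union (hD : Dense D) {U U' : Set Plane} (hU : IsOpen U) (hU' : IsOpen U')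
    (hc : IsPreconnected (U ∩ U')) {f f' : Plane → A} (h : IsGlued D g U f)
    (h' : IsGlued D g U' f') : ∃ F, IsGlued D g (U ∪ U') F := by
  classical
  have hcst : ∃ c, ∀ y ∈ (U ∩ U') ∩ D, f y = f' y + c := by
    rcases ((U ∩ U') ∩ D).eq_empty_or_nonempty with he | ⟨x, hx⟩
    · exact ⟨0, fun y hy => by rw [he] at hy; exact hy.elim⟩
    · refine ⟨f x - f' x, fun y hy => ?_⟩
      have := IsGlued.sub_eq hD (hU.inter hU') hc (h'.mono inter_subset_right)
        (h.mono inter_subset_left) hx hy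
      rw [this]
      abel
  obtain ⟨c, hc'⟩ := hcst
  refine ⟨fun y => if y ∈ U then f y else f' y + c, ?_⟩
  rintro q (hq | hq)
  · refine IsGlued.congr (c := 0) hU h (fun y hy => ?_) q hq
    simp [hy.1]
  · refine IsGlued.congr (c := c) hU' h' (fun y hy => ?_) q hq
    by_cases hyU : y ∈ U
    · simp [hyU, hc' y ⟨⟨hyU, hy.1⟩, hy.2⟩]
    · simp [hyU]

/-- An open coordinate rectangle. -/
def box (a b c d : ℝ) : Set Plane := {q | q 0 ∈ Ioo a b ∧ q 1 ∈ Ioo c d}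

lemma isOpen_box (a b c d : ℝ) : IsOpen (box a b c d) :=
  (isOpen_Ioo.preimage (continuous_apply 0)).inter (isOpen_Ioo.preimage (continuous_apply 1))

lemma isPreconnected_box (a b c d : ℝ) : IsPreconnected (box a b c d) := by
  have h0 : Convex ℝ (Ioo a b) := convex_Ioo a b
  have h1 : Convex ℝ (Ioo c d) := convex_Ioo c d
  refine Convex.isPreconnected ?_
  exact (h0.linear_preimage (LinearMap.proj (φ := fun _ : Fin 2 => ℝ) 0)).inter
    (h1.linear_preimage (LinearMap.proj (φ := fun _ : Fin 2 => ℝ) 1))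

lemma box_mono {a b c d a' b' c' d' : ℝ} (h1 : a' ≤ a) (h2 : b ≤ b') (h3 : c' ≤ c) (h4 : d ≤ d') :
    box a b c d ⊆ box a' b' c' d' := fun _ hq =>
  ⟨Ioo_subset_Ioo h1 h2 hq.1, Ioo_subset_Ioo h3 h4 hq.2⟩

lemma exists_box_subset {q : Plane} {U : Set Plane} (hU : U ∈ 𝓝 q) :
    ∃ ε > 0, box (q 0 - ε) (q 0 + ε) (q 1 - ε) (q 1 + ε) ⊆ U := by
  obtain ⟨ε, hε, h⟩ := Metric.mem_nhds_iff.1 hU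
  refine ⟨ε, hε, fun y hy => h ?_⟩
  rw [Metric.mem_ball, dist_pi_lt_iff hε]
  intro i
  rw [Real.dist_eq, abs_lt]
  fin_cases i
  · have := hy.1
    simp only [mem_Ioo] at this
    constructor <;> simp <;> linarith
  · have := hy.2
    simp only [mem_Ioo] at this
    constructor <;> simp <;> linarith

/-- Local functions in the plane that are compatible up to constants can be glued: the plane has no
first cohomology. Only the overlaps of `g q` with `g q'` for `q'` near `q` enter. -/
theorem exists_glued (hD : Dense D)
    (h : ∀ q, ∀ᶠ q' in 𝓝 q, ∃ c, ∀ᶠ y in 𝓝[D] q', g q y - g q' y = c) :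
    ∃ f, IsGlued D g univ f := by
  -- gluing over thin neighbourhoods of vertical segments
  have hvert : ∀ x c d : ℝ, c ≤ d → ∃ ε > 0, ∃ f, IsGlued D g (box (x - ε) (x + ε) (c - ε) (d + ε)) f := by
    intro x c d hcd
    refine interval_induction
      (Q := fun c d => ∃ ε > 0, ∃ f, IsGlued D g (box (x - ε) (x + ε) (c - ε) (d + ε)) f) ?_ ?_ hcd
    · intro y
      obtain ⟨ε, hε, hbox⟩ := exists_box_subset (h ![x, y])
      simp only [Matrix.cons_val_zero, Matrix.cons_val_one] at hbox
      refine ⟨ε / 2, by linarith, fun a b ha hab hb => ⟨ε / 2, by linarith, g ![x, y], ?_⟩⟩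
      exact fun q hq => hbox (box_mono (by linarith) (by linarith) (by linarith) (by linarith) hq)
    · rintro a b c hab hbc ⟨ε, hε, f, hf⟩ ⟨ε', hε', f', hf'⟩
      set η := min ε ε' with hη
      have hη0 : 0 < η := lt_min hε hε'
      have h1 : η ≤ ε := min_le_left _ _
      have h2 : η ≤ ε' := min_le_right _ _
      have g1 := hf.mono (box_mono (a := x - η) (b := x + η) (c := a - η) (d := b + η)
        (by linarith) (by linarith) (by linarith) (by linarith))
      have g2 := hf'.mono (box_mono (a := x - η) (b := x + η) (c := b - η) (d := c + η)
        (by linarith) (by linarith) (by linarith) (by linarith))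
      obtain ⟨F, hF⟩ := IsGlued.exists_union hD (isOpen_box _ _ _ _) (isOpen_box _ _ _ _) (by
        have : box (x - η) (x + η) (a - η) (b + η) ∩ box (x - η) (x + η) (b - η) (c + η) =
            box (x - η) (x + η) (b - η) (b + η) := by
          ext q
          simp only [box, mem_inter_iff, mem_ofPred_eq, mem_Ioo]
          constructor
          · rintro ⟨⟨h1, h2⟩, -, h3⟩
            exact ⟨h1, h3.1, h2.2⟩
          · rintro ⟨h1, h2⟩
            exact ⟨⟨h1, by linarith [h2.1], h2.2⟩, h1, h2.1, by linarith [h2.2]⟩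
        rw [this]
        exact isPreconnected_box _ _ _ _) g1 g2
      refine ⟨η, hη0, F, hF.mono fun q hq => ?_⟩
      rcases lt_or_ge (q 1) (b + η) with hb | hb
      · exact Or.inl ⟨hq.1, hq.2.1, hb⟩
      · exact Or.inr ⟨hq.1, by linarith, hq.2.2⟩
  -- gluing over rectangles, from thin vertical strips
  have hrect : ∀ a b c d : ℝ, a ≤ b → c ≤ d → ∃ f, IsGlued D g (box a b c d) f := by
    intro a b c d hab hcd
    suffices ∃ ε > 0, ∃ f, IsGlued D g (box (a - ε) (b + ε) c d) f by
      obtain ⟨ε, hε, f, hf⟩ := this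
      exact ⟨f, hf.mono (box_mono (by linarith) (by linarith) le_rfl le_rfl)⟩
    refine interval_induction
      (Q := fun a b => ∃ ε > 0, ∃ f, IsGlued D g (box (a - ε) (b + ε) c d) f) ?_ ?_ hab
    · intro x
      obtain ⟨ε, hε, f, hf⟩ := hvert x c d hcd
      refine ⟨ε / 2, by linarith, fun a b ha hab hb => ⟨ε / 2, by linarith, f, hf.mono ?_⟩⟩
      exact box_mono (by linarith) (by linarith) (by linarith) (by linarith)
    · rintro a b e hab hbc ⟨ε, hε, f, hf⟩ ⟨ε', hε', f', hf'⟩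
      set η := min ε ε' with hη
      have hη0 : 0 < η := lt_min hε hε'
      have h1 : η ≤ ε := min_le_left _ _
      have h2 : η ≤ ε' := min_le_right _ _
      have g1 := hf.mono (box_mono (a := a - η) (b := b + η) (c := c) (d := d)
        (by linarith) (by linarith) (by linarith) (by linarith))
      have g2 := hf'.mono (box_mono (a := b - η) (b := e + η) (c := c) (d := d)
        (by linarith) (by linarith) (by linarith) (by linarith))
      obtain ⟨F, hF⟩ := IsGlued.exists_union hD (isOpen_box _ _ _ _) (isOpen_box _ _ _ _) (by
        have : box (a - η) (b + η) c d ∩ box (b - η) (e + η) c d = box (b - η) (b + η) c d := by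
          ext q
          simp only [box, mem_inter_iff, mem_ofPred_eq, mem_Ioo]
          constructor
          · rintro ⟨⟨h1, h2⟩, h3, -⟩
            exact ⟨⟨h3.1, h1.2⟩, h2⟩
          · rintro ⟨h1, h2⟩
            exact ⟨⟨⟨by linarith [h1.1], h1.2⟩, h2⟩, ⟨h1.1, by linarith [h1.2]⟩, h2⟩
        rw [this]
        exact isPreconnected_box _ _ _ _) g1 g2
      refine ⟨η, hη0, F, hF.mono fun q hq => ?_⟩
      rcases lt_or_ge (q 0) (b + η) with hb | hb
      · exact Or.inl ⟨⟨hq.1.1, hb⟩, hq.2⟩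
      · exact Or.inr ⟨⟨by linarith, hq.1.2⟩, hq.2⟩
  -- exhaust the plane by squares, with the solutions normalized at a common base point
  set U : ℕ → Set Plane := fun n => box (-(n + 1)) (n + 1) (-(n + 1)) (n + 1) with hUdef
  have hU : ∀ n, IsOpen (U n) := fun n => isOpen_box _ _ _ _
  have hmono : ∀ m n, m ≤ n → U m ⊆ U n := by
    intro m n hmn
    have : (m : ℝ) ≤ n := by exact_mod_cast hmn
    exact box_mono (by linarith) (by linarith) (by linarith) (by linarith)
  obtain ⟨x₀, hx₀D, hx₀⟩ := hD.exists_mem_open (hU 0) ⟨0, by simp [hUdef, box]⟩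
  have hex : ∀ n, ∃ f, IsGlued D g (U n) f ∧ f x₀ = 0 := by
    intro n
    have hn : (0 : ℝ) ≤ n := n.cast_nonneg
    obtain ⟨f, hf⟩ := hrect (-(n + 1)) (n + 1) (-(n + 1)) (n + 1) (by linarith) (by linarith)
    exact ⟨fun y => f y + -f x₀, hf.congr (hU n) (c := -f x₀) (fun y _ => rfl), by simp⟩
  choose f hf hf0 using hex
  have hcompat : ∀ m n, ∀ y ∈ U m ∩ D, y ∈ U n → f m y = f n y := by
    have key : ∀ m n, m ≤ n → ∀ y ∈ U m ∩ D, f m y = f n y := by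
      intro m n hmn y hy
      have := IsGlued.sub_eq hD (hU m) (isPreconnected_box _ _ _ _) (hf m)
        ((hf n).mono (hmono m n hmn)) hy ⟨hmono 0 m (Nat.zero_le m) hx₀, hx₀D⟩
      rw [hf0, hf0, sub_zero, sub_eq_zero] at this
      exact this.symm
    intro m n y hy hyn
    rcases le_total m n with hmn | hmn
    · exact key m n hmn y hy
    · exact (key n m hmn y ⟨hyn, hy.2⟩).symm
  have hcover : ∀ y, ∃ n, y ∈ U n := by
    intro y
    obtain ⟨n, hn⟩ := exists_nat_ge (max |y 0| |y 1|)
    have h0 := (abs_le.1 ((le_max_left _ _).trans hn))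
    have h1 := (abs_le.1 ((le_max_right _ _).trans hn))
    exact ⟨n, ⟨by linarith [h0.1], by linarith [h0.2]⟩, by linarith [h1.1], by linarith [h1.2]⟩
  choose N hN using hcover
  refine ⟨fun y => f (N y) y, fun q _ => ?_⟩
  refine IsGlued.congr (hU (N q)) (hf (N q)) (c := 0) (fun y hy => ?_) q (hN q)
  rw [add_zero]
  exact (hcompat _ _ y hy (hN y)).symm

end Gluing

end PlaneCurve

end

noncomputable section

namespace PlaneCurve

/-! ### The sides of the curve near its points -/

/-- The derivative of a polynomial in the direction `e`. -/
def dirDeriv (F : MvPolynomial (Fin 2) ℝ) (e : Plane) : MvPolynomial (Fin 2) ℝ :=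
  MvPolynomial.C (e 0) * MvPolynomial.pderiv 0 F + MvPolynomial.C (e 1) * MvPolynomial.pderiv 1 F

lemma eval_dirDeriv (F : MvPolynomial (Fin 2) ℝ) (e q : Plane) :
    MvPolynomial.eval q (dirDeriv F e) = differential F q e := by
  simp [dirDeriv, differential_apply]; ring

lemma continuous_differential (F : MvPolynomial (Fin 2) ℝ) (e : Plane) :
    Continuous fun q => differential F q e := by
  simpa only [eval_dirDeriv] using continuous_eval (dirDeriv F e)

/-- The second differential at `q` as a bilinear form. -/
def hessianBilin (F : MvPolynomial (Fin 2) ℝ) (q u e : Plane) : ℝ :=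
  differential (dirDeriv F e) q u

lemma hessianBilin_eq (F : MvPolynomial (Fin 2) ℝ) (q u e : Plane) :
    hessianBilin F q u e =
      MvPolynomial.eval q (MvPolynomial.pderiv 0 (MvPolynomial.pderiv 0 F)) * (u 0 * e 0) +
      MvPolynomial.eval q (MvPolynomial.pderiv 0 (MvPolynomial.pderiv 1 F)) *
        (u 0 * e 1 + u 1 * e 0) +
      MvPolynomial.eval q (MvPolynomial.pderiv 1 (MvPolynomial.pderiv 1 F)) * (u 1 * e 1) := by
  rw [hessianBilin, differential_apply]
  simp [dirDeriv, pderiv_comm]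
  ring

lemma hessianBilin_self (F : MvPolynomial (Fin 2) ℝ) (q u : Plane) :
    hessianBilin F q u u = hessianForm F q u := by
  rw [hessianBilin_eq, hessianForm]; ring

/-- The Gram determinant of the second differential. -/
lemma hessianForm_mul_hessianForm (F : MvPolynomial (Fin 2) ℝ) (q u e : Plane) :
    hessianForm F q u * hessianForm F q e = hessianBilin F q u e ^ 2 +
      MvPolynomial.eval q (hessian F).det * dot u (rot e) ^ 2 := by
  rw [hessianBilin_eq, hessianForm, hessianForm, eval_det_hessian]
  simp only [dot, rot_zero, rot_one]
  ring

lemma hasDerivAt_line (F : MvPolynomial (Fin 2) ℝ) (y e : Plane) (s : ℝ) :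
    HasDerivAt (fun s : ℝ => MvPolynomial.eval (y + s • e) F) (differential F (y + s • e) e) s := by
  refine hasDerivAt_eval_comp F (γ := fun s : ℝ => y + s • e) ?_
  simpa using ((hasDerivAt_id s).smul_const e).const_add y

/-- In a ball where the derivative of `F` in the direction `e` is positive, `F` increases in that
direction. -/
lemma eval_lt_eval_line {F : MvPolynomial (Fin 2) ℝ} {e q y : Plane} {r s : ℝ}
    (h : ∀ z ∈ Metric.ball q r, 0 < differential F z e) (hy : y ∈ Metric.ball q r) (hs : 0 < s)
    (hys : y + s • e ∈ Metric.ball q r) :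
    MvPolynomial.eval y F < MvPolynomial.eval (y + s • e) F := by
  have hmono : StrictMonoOn (fun s : ℝ => MvPolynomial.eval (y + s • e) F) (Icc 0 s) := by
    refine strictMonoOn_of_deriv_pos (convex_Icc 0 s)
      (fun x _ => (hasDerivAt_line F y e x).continuousAt.continuousWithinAt) fun x hx => ?_
    rw [(hasDerivAt_line F y e x).deriv]
    rw [interior_Icc] at hx
    refine h _ ?_
    have hx1 : x / s ∈ Icc (0 : ℝ) 1 :=
      ⟨div_nonneg hx.1.le hs.le, (div_le_one hs).2 hx.2.le⟩
    have := (convex_ball q r).add_smul_mem hy hys hx1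
    rwa [smul_smul, div_mul_cancel₀ _ hs.ne'] at this
  have := hmono (left_mem_Icc.2 hs.le) (right_mem_Icc.2 hs.le) hs
  simpa using this

/-- A function that is locally constant on a set `S` near `q` is constant on `S` near `q`, if `S`
is, near `q`, preserved by translation in a direction `e` that points from `q` into `S`. -/
lemma exists_const_of_ray {A : Type*} {q e : Plane} {S : Set Plane} {f : Plane → A}
    (h1 : ∀ᶠ y in 𝓝 q, y ∈ S → ∀ᶠ y' in 𝓝 y, f y' = f y)
    (h2 : ∃ r > 0, ∀ y ∈ Metric.ball q r, y ∈ S → ∀ s : ℝ, 0 < s → y + s • e ∈ Metric.ball q r →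
      y + s • e ∈ S)
    (h3 : ∀ᶠ s : ℝ in 𝓝[>] 0, q + s • e ∈ S) : ∃ a, ∀ᶠ y in 𝓝 q, y ∈ S → f y = a := by
  obtain ⟨r₁, hr₁, h1⟩ := Metric.eventually_nhds_iff_ball.1 h1
  obtain ⟨r₂, hr₂, h2⟩ := h2
  -- translate all points near `q` by a small multiple of `e`, to points near one point of `S`
  set r := min r₁ r₂ with hr
  have hr0 : 0 < r := lt_min hr₁ hr₂
  have hcont : Continuous fun s : ℝ => s * ‖e‖ := by fun_prop
  have h4 : ∀ᶠ s : ℝ in 𝓝[>] 0, s * ‖e‖ < r / 2 := by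
    have : Tendsto (fun s : ℝ => s * ‖e‖) (𝓝[>] 0) (𝓝 0) := by
      simpa using (hcont.tendsto 0).mono_left nhdsWithin_le_nhds
    exact this.eventually_lt_const (by linarith)
  obtain ⟨s₀, ⟨hs₁, hs₂⟩, hs₀⟩ := ((h3.and h4).and self_mem_nhdsWithin).exists
  have hball : ∀ y ∈ Metric.ball q (r / 2), ∀ s ∈ Icc 0 s₀, y + s • e ∈ Metric.ball q r := by
    intro y hy s hs
    rw [Metric.mem_ball, dist_eq_norm] at hy ⊢
    calc ‖y + s • e - q‖ = ‖(y - q) + s • e‖ := by congr 1; abel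
      _ ≤ ‖y - q‖ + ‖s • e‖ := norm_add_le _ _
      _ = ‖y - q‖ + s * ‖e‖ := by rw [norm_smul, Real.norm_eq_abs, abs_of_nonneg hs.1]
      _ ≤ ‖y - q‖ + s₀ * ‖e‖ := by gcongr; exact hs.2
      _ < r := by linarith
  have hbase := h1 (q + s₀ • e)
    (Metric.ball_subset_ball (min_le_left _ _) (hball q (Metric.mem_ball_self (by linarith)) s₀
      ⟨hs₀.le, le_rfl⟩)) hs₁
  have htend : Tendsto (fun y : Plane => y + s₀ • e) (𝓝 q) (𝓝 (q + s₀ • e)) :=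
    (continuous_add_const _).tendsto q
  refine ⟨f (q + s₀ • e), ?_⟩
  filter_upwards [htend.eventually hbase, Metric.ball_mem_nhds q (half_pos hr0)] with y hy hyq hyS
  rw [← hy]
  let _ : TopologicalSpace A := ⊥
  have : DiscreteTopology A := ⟨rfl⟩
  have hS : ∀ s ∈ Icc 0 s₀, y + s • e ∈ S := by
    intro s hs
    rcases hs.1.eq_or_lt with rfl | hs'
    · simpa using hyS
    · exact h2 y (Metric.ball_subset_ball (by linarith [min_le_right r₁ r₂]) hyq) hyS s hs'
        (Metric.ball_subset_ball (min_le_right _ _) (hball y hyq s hs))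
  have := (isPreconnected_Icc (a := (0 : ℝ)) (b := s₀)).constant
    (f := fun s : ℝ => f (y + s • e)) ?_ (left_mem_Icc.2 hs₀.le) (right_mem_Icc.2 hs₀.le)
  · simpa using this
  · intro s hs
    have h5 := h1 (y + s • e) (Metric.ball_subset_ball (min_le_left _ _) (hball y hyq s hs))
      (hS s hs)
    have h6 : Tendsto (fun s : ℝ => y + s • e) (𝓝 s) (𝓝 (y + s • e)) :=
      Continuous.tendsto (by fun_prop) s
    exact ((continuousAt_const (y := f (y + s • e))).congr
      ((h6.eventually h5).mono fun w hw => hw.symm)).continuousWithinAt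

/-- On the positive side of a smooth point, a locally constant function is constant. -/
lemma exists_const_of_differential_pos {A : Type*} {F : MvPolynomial (Fin 2) ℝ} {q e : Plane}
    {f : Plane → A} (hq : MvPolynomial.eval q F = 0) (he : 0 < differential F q e)
    (hf : ∀ᶠ y in 𝓝 q, MvPolynomial.eval y F ≠ 0 → ∀ᶠ y' in 𝓝 y, f y' = f y) :
    ∃ a, ∀ᶠ y in 𝓝 q, 0 < MvPolynomial.eval y F → f y = a := by
  obtain ⟨r, hr, h⟩ := Metric.eventually_nhds_iff_ball.1
    ((continuous_differential F e).continuousAt.eventually_const_lt he)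
  refine exists_const_of_ray (S := {y | 0 < MvPolynomial.eval y F}) (e := e)
    (hf.mono fun y hy hyS => hy (ne_of_gt hyS)) ⟨r, hr, fun y hy hyS s hs hys => ?_⟩ ?_
  · exact lt_trans hyS (eval_lt_eval_line h hy hs hys)
  · have : ∀ᶠ s : ℝ in 𝓝 0, q + s • e ∈ Metric.ball q r := by
      have h6 : Tendsto (fun s : ℝ => q + s • e) (𝓝 0) (𝓝 q) := by
        have : Continuous fun s : ℝ => q + s • e := by fun_prop
        simpa using this.tendsto 0
      exact h6.eventually (Metric.ball_mem_nhds q hr)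
    filter_upwards [nhdsWithin_le_nhds this, self_mem_nhdsWithin] with s hs hs0
    have := eval_lt_eval_line h (Metric.mem_ball_self hr) hs0 hs
    rwa [hq] at this

/-- In the sector of a node that is cut out by `F > 0` and by the sign of the derivative in a
direction `e`, a locally constant function is constant. -/
lemma exists_const_of_hessianForm_pos {A : Type*} {F : MvPolynomial (Fin 2) ℝ} {q e : Plane}
    {f : Plane → A} (hq : MvPolynomial.eval q F = 0) (hd : differential F q = 0)
    (he : 0 < hessianForm F q e)
    (hf : ∀ᶠ y in 𝓝 q, MvPolynomial.eval y F ≠ 0 → ∀ᶠ y' in 𝓝 y, f y' = f y) :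
    ∃ a, ∀ᶠ y in 𝓝 q, 0 < MvPolynomial.eval y F → 0 < differential F y e → f y = a := by
  rw [← hessianBilin_self] at he
  obtain ⟨r, hr, h⟩ := Metric.eventually_nhds_iff_ball.1
    ((continuous_differential (dirDeriv F e) e).continuousAt.eventually_const_lt he)
  have key : ∀ y ∈ Metric.ball q r, 0 ≤ MvPolynomial.eval y F → 0 ≤ differential F y e →
      ∀ s : ℝ, 0 < s → y + s • e ∈ Metric.ball q r →
      0 < MvPolynomial.eval (y + s • e) F ∧ 0 < differential F (y + s • e) e := by
    intro y hy h0 h1 s hs hys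
    have hseg : ∀ x ∈ Ioc 0 s, 0 < differential F (y + x • e) e := by
      intro x hx
      have hx1 : x / s ∈ Icc (0 : ℝ) 1 := ⟨div_nonneg hx.1.le hs.le, (div_le_one hs).2 hx.2⟩
      have hm := (convex_ball q r).add_smul_mem hy hys hx1
      rw [smul_smul, div_mul_cancel₀ _ hs.ne'] at hm
      have := eval_lt_eval_line h hy hx.1 hm
      rw [eval_dirDeriv, eval_dirDeriv] at this
      exact h1.trans_lt this
    refine ⟨?_, hseg s ⟨hs, le_rfl⟩⟩
    have hmono : StrictMonoOn (fun s : ℝ => MvPolynomial.eval (y + s • e) F) (Icc 0 s) := by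
      refine strictMonoOn_of_deriv_pos (convex_Icc 0 s)
        (fun x _ => (hasDerivAt_line F y e x).continuousAt.continuousWithinAt) fun x hx => ?_
      rw [(hasDerivAt_line F y e x).deriv]
      rw [interior_Icc] at hx
      exact hseg x ⟨hx.1, hx.2.le⟩
    have := hmono (left_mem_Icc.2 hs.le) (right_mem_Icc.2 hs.le) hs
    simp only [zero_smul, add_zero] at this
    linarith
  have := exists_const_of_ray (f := f)
    (S := {y | 0 < MvPolynomial.eval y F ∧ 0 < differential F y e}) (e := e) (q := q)
    (hf.mono fun y hy hyS => hy (ne_of_gt hyS.1)) ⟨r, hr, fun y hy hyS s hs hys =>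
      key y hy hyS.1.le hyS.2.le s hs hys⟩ ?_
  · obtain ⟨a, ha⟩ := this
    exact ⟨a, ha.mono fun y hy h1 h2 => hy ⟨h1, h2⟩⟩
  · have : ∀ᶠ s : ℝ in 𝓝 0, q + s • e ∈ Metric.ball q r := by
      have h6 : Tendsto (fun s : ℝ => q + s • e) (𝓝 0) (𝓝 q) := by
        have : Continuous fun s : ℝ => q + s • e := by fun_prop
        simpa using this.tendsto 0
      exact h6.eventually (Metric.ball_mem_nhds q hr)
    filter_upwards [nhdsWithin_le_nhds this, self_mem_nhdsWithin] with s hs hs0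
    exact key q (Metric.mem_ball_self hr) hq.ge (by rw [hd]; simp) s hs0 hs

/-- Near a node, the derivative in a direction `e` where the second differential is positive does not
vanish on `F ≥ 0`: it vanishes along a curve on which `F` has a strict maximum at the node. -/
lemma eventually_differential_ne_zero {F : MvPolynomial (Fin 2) ℝ} {q e : Plane}
    (hq : MvPolynomial.eval q F = 0) (hd : differential F q = 0)
    (hdet : MvPolynomial.eval q (hessian F).det < 0) (he : 0 < hessianForm F q e) :
    ∀ᶠ y in 𝓝[≠] q, 0 ≤ MvPolynomial.eval y F → differential F y e ≠ 0 := by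
  obtain ⟨P, hP, h1, h2⟩ := exists_taylor F q
  obtain ⟨K, hK, k1, -⟩ := exists_taylor (dirDeriv F e) q
  -- in the directions conjugate to `e` the second differential is negative, so `F < 0` there; in all
  -- other directions the derivative of `F` along `e` has a nonvanishing linear part
  refine eventually_of_directions fun u hu => ?_
  have hu0 := ne_zero_of_normSq_eq_one hu
  by_cases hB : hessianBilin F q u e = 0
  · have hneg : P (0, u) < 0 := by
      have h3 := hessianForm_mul_hessianForm F q u e
      rw [hB] at h3
      have h4 : dot u (rot e) ≠ 0 := by
        intro h0
        -- otherwise `u` is parallel to `e`, where the form does not vanish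
        have h5 : dot e (rot u) = 0 := by
          simp only [dot, rot_zero, rot_one] at h0 ⊢
          linarith
        have h6 := eq_dot_smul_add hu e
        rw [h5, zero_smul, add_zero] at h6
        have h7 : hessianForm F q e = dot e u * hessianBilin F q u e := by
          have e0 : e 0 = dot e u * u 0 := congrFun h6 0
          have e1 : e 1 = dot e u * u 1 := congrFun h6 1
          generalize dot e u = c at e0 e1
          rw [hessianBilin_eq, hessianForm, e0, e1]
          ring
        rw [hB, mul_zero] at h7
        exact he.ne' h7
      have h5 : 0 < dot u (rot e) ^ 2 := by positivity
      have h6 := h2 u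
      have h7 : hessianForm F q u * hessianForm F q e < 0 := by
        rw [h3]; nlinarith
      nlinarith
    have : ∀ᶠ z : ℝ × Plane in 𝓝 (0, u), P z < 0 :=
      hP.continuous.continuousAt.eventually_lt_const hneg
    filter_upwards [this] with z hz hz0 h3
    rw [h1, hq, hd] at h3
    have : 0 < z.1 ^ 2 := by positivity
    simp only [zero_add, zero_apply, mul_zero] at h3
    exact absurd h3 (by nlinarith)
  · have hc : Continuous fun z : ℝ × Plane => hessianBilin F q z.2 e + z.1 * K z := by
      have := hK.continuous
      unfold hessianBilin
      fun_prop
    have : ∀ᶠ z : ℝ × Plane in 𝓝 (0, u), hessianBilin F q z.2 e + z.1 * K z ≠ 0 := by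
      refine hc.continuousAt.eventually_ne ?_
      simpa using hB
    filter_upwards [this] with z hz hz0 _ h3
    rw [← eval_dirDeriv, k1, eval_dirDeriv, hd] at h3
    apply hz
    have : z.1 * (hessianBilin F q z.2 e + z.1 * K z) = 0 := by
      rw [← h3, hessianBilin]; simp; ring
    exact (mul_eq_zero.1 this).resolve_left hz0

end PlaneCurve

end

noncomputable section

namespace PlaneCurve

variable {G : MvPolynomial (Fin 2) ℝ}

/-! ### Locally constant functions off the curve and their jumps -/

/-- The function `f`, with values modulo two, is constant on each side of `G = 0` near `p`, and its
two values differ by `l`. -/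
def IsJump (G : MvPolynomial (Fin 2) ℝ) (f : Plane → ZMod 2) (p : Plane) (l : ZMod 2) : Prop :=
  ∃ b, ∀ᶠ y in 𝓝 p, MvPolynomial.eval y G ≠ 0 →
    f y = b + if 0 < MvPolynomial.eval y G then l else 0

lemma IsJump.eventually {f : Plane → ZMod 2} {p : Plane} {l : ZMod 2} (h : IsJump G f p l) :
    ∀ᶠ q in 𝓝 p, IsJump G f q l := by
  obtain ⟨b, hb⟩ := h
  exact (eventually_eventually_nhds.2 hb).mono fun q hq => ⟨b, hq⟩

lemma frequently_eval_pos {p : Plane} (hp : MvPolynomial.eval p G = 0) (hd : differential G p ≠ 0) :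
    ∃ᶠ y in 𝓝 p, 0 < MvPolynomial.eval y G := by
  intro h
  refine hd (IsLocalMax.hasFDerivAt_eq_zero (f := fun y => MvPolynomial.eval y G) ?_
    (hasFDerivAt_eval G p))
  filter_upwards [h] with y hy
  rw [hp]
  exact not_lt.1 hy

lemma frequently_eval_neg {p : Plane} (hp : MvPolynomial.eval p G = 0) (hd : differential G p ≠ 0) :
    ∃ᶠ y in 𝓝 p, MvPolynomial.eval y G < 0 := by
  intro h
  refine hd (IsLocalMin.hasFDerivAt_eq_zero (f := fun y => MvPolynomial.eval y G) ?_
    (hasFDerivAt_eval G p))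
  filter_upwards [h] with y hy
  rw [hp]
  exact not_lt.1 hy

lemma IsJump.unique {f : Plane → ZMod 2} {p : Plane} {l l' : ZMod 2}
    (hp : MvPolynomial.eval p G = 0) (hd : differential G p ≠ 0)
    (h : IsJump G f p l) (h' : IsJump G f p l') : l = l' := by
  obtain ⟨b, hb⟩ := h
  obtain ⟨b', hb'⟩ := h'
  obtain ⟨y, hy, h1, h2⟩ := ((frequently_eval_pos hp hd).and_eventually (hb.and hb')).exists
  obtain ⟨z, hz, h3, h4⟩ := ((frequently_eval_neg hp hd).and_eventually (hb.and hb')).exists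
  have h5 := (h1 hy.ne').symm.trans (h2 hy.ne')
  have h6 := (h3 hz.ne).symm.trans (h4 hz.ne)
  rw [if_pos hy, if_pos hy] at h5
  rw [if_neg hz.le.not_gt, if_neg hz.le.not_gt, add_zero, add_zero] at h6
  rw [h6] at h5
  exact add_left_cancel h5

lemma differential_neg (F : MvPolynomial (Fin 2) ℝ) (q u : Plane) :
    differential (-F) q u = -differential F q u := by
  simp [differential_apply]; ring

lemma hessianForm_neg (F : MvPolynomial (Fin 2) ℝ) (q u : Plane) :
    hessianForm (-F) q u = -hessianForm F q u := by
  simp [hessianForm]; ring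

lemma zmod_two_eq (a b : ZMod 2) : a = b + (a + b) := by revert a b; decide

lemma exists_isJump {f : Plane → ZMod 2} {p : Plane} (hp : MvPolynomial.eval p G = 0)
    (hd : differential G p ≠ 0)
    (hf : ∀ᶠ y in 𝓝 p, MvPolynomial.eval y G ≠ 0 → ∀ᶠ y' in 𝓝 y, f y' = f y) :
    ∃ l, IsJump G f p l := by
  obtain ⟨e, he⟩ : ∃ e, 0 < differential G p e := by
    obtain ⟨e, he⟩ := DFunLike.ne_iff.1 hd
    rw [zero_apply] at he
    rcases lt_or_gt_of_ne he with h | h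
    · exact ⟨-e, by rw [map_neg]; linarith⟩
    · exact ⟨e, h⟩
  -- the two sides of the curve are positive sides of `G` and of `-G`
  obtain ⟨a, ha⟩ := exists_const_of_differential_pos hp he hf
  obtain ⟨b, hb⟩ := exists_const_of_differential_pos (F := -G) (q := p) (e := -e) (f := f)
    (by simp [hp]) (by rw [differential_neg, map_neg, neg_neg]; exact he) (by simpa using hf)
  refine ⟨a + b, b, ?_⟩
  filter_upwards [ha, hb] with y h1 h2 h0
  split_ifs with h
  · rw [h1 h]; exact zmod_two_eq a b
  · rw [add_zero]
    refine h2 ?_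
    rw [map_neg]
    have := lt_of_le_of_ne (not_lt.1 h) h0
    linarith

/-- The function near a node that takes prescribed values on the four sectors; `e` and `e'` are
directions in which the second differential is positive and negative, respectively. -/
def nodeModel (G : MvPolynomial (Fin 2) ℝ) (e e' : Plane) (a a' b b' : ZMod 2) (y : Plane) : ZMod 2 :=
  if 0 < MvPolynomial.eval y G then (if 0 < differential G y e then a else a')
  else (if 0 < differential G y e' then b else b')

section Node

variable {q e e' : Plane}

lemma eventually_differential_ne_zero_of_neg (hq : IsHyperbolicNode G q)
    (he' : hessianForm G q e' < 0) :
    ∀ᶠ y in 𝓝[≠] q, MvPolynomial.eval y G ≤ 0 → differential G y e' ≠ 0 := by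
  have h := eventually_differential_ne_zero (F := -G) (q := q) (e := e') (by simp [hq.1.1])
    (by ext u; rw [differential_neg, differential_eq_zero_iff.2 hq.1.2]; simp)
    (by
      have := hq.2
      rw [eval_det_hessian] at this ⊢
      simpa using this)
    (by rw [hessianForm_neg]; linarith)
  filter_upwards [h] with y hy h0 h1
  exact hy (by rw [map_neg]; linarith) (by rw [differential_neg, h1, neg_zero])

lemma eventually_nodeModel_eq (hq : IsHyperbolicNode G q) (he : 0 < hessianForm G q e)
    (he' : hessianForm G q e' < 0) (a a' b b' : ZMod 2) :
    ∀ᶠ y in 𝓝[≠] q, MvPolynomial.eval y G ≠ 0 →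
      ∀ᶠ y' in 𝓝 y, nodeModel G e e' a a' b b' y' = nodeModel G e e' a a' b b' y := by
  filter_upwards [eventually_differential_ne_zero hq.1.1 (differential_eq_zero_iff.2 hq.1.2) hq.2 he,
    eventually_differential_ne_zero_of_neg hq he'] with y h1 h2 h0
  have c0 := (continuous_eval G).continuousAt (x := y)
  have c1 := (continuous_differential G e).continuousAt (x := y)
  have c2 := (continuous_differential G e').continuousAt (x := y)
  rcases lt_or_gt_of_ne h0 with h | h
  · rcases lt_or_gt_of_ne (h2 h.le) with h' | h'
    · filter_upwards [c0.eventually_lt_const h, c2.eventually_lt_const h'] with z hz hz'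
      simp [nodeModel, h.le.not_gt, hz.le.not_gt, h'.le.not_gt, hz'.le.not_gt]
    · filter_upwards [c0.eventually_lt_const h, c2.eventually_const_lt h'] with z hz hz'
      simp [nodeModel, h.le.not_gt, hz.le.not_gt, h', hz']
  · rcases lt_or_gt_of_ne (h1 h.le) with h' | h'
    · filter_upwards [c0.eventually_const_lt h, c1.eventually_lt_const h'] with z hz hz'
      simp [nodeModel, h, hz, h'.le.not_gt, hz'.le.not_gt]
    · filter_upwards [c0.eventually_const_lt h, c1.eventually_const_lt h'] with z hz hz'
      simp [nodeModel, h, hz, h', hz']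

/-- Every locally constant function is constant on the four sectors of a node. -/
lemma exists_eq_nodeModel (hq : IsHyperbolicNode G q) (he : 0 < hessianForm G q e)
    (he' : hessianForm G q e' < 0) {f : Plane → ZMod 2}
    (hf : ∀ᶠ y in 𝓝 q, MvPolynomial.eval y G ≠ 0 → ∀ᶠ y' in 𝓝 y, f y' = f y) :
    ∃ a a' b b', ∀ᶠ y in 𝓝 q, MvPolynomial.eval y G ≠ 0 → f y = nodeModel G e e' a a' b b' y := by
  have hd := differential_eq_zero_iff.2 hq.1.2
  have hneg : ∀ u, hessianForm G q (-u) = hessianForm G q u := fun u => by simp [hessianForm]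
  have hd' : differential (-G) q = 0 := by ext u; rw [differential_neg, hd]; simp
  obtain ⟨a, ha⟩ := exists_const_of_hessianForm_pos hq.1.1 hd he hf
  obtain ⟨a', ha'⟩ := exists_const_of_hessianForm_pos (e := -e) hq.1.1 hd (by rwa [hneg]) hf
  obtain ⟨b', hb'⟩ := exists_const_of_hessianForm_pos (F := -G) (e := e') (f := f) (q := q)
    (by simp [hq.1.1]) hd' (by rw [hessianForm_neg]; linarith) (by simpa using hf)
  obtain ⟨b, hb⟩ := exists_const_of_hessianForm_pos (F := -G) (e := -e') (f := f) (q := q)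
    (by simp [hq.1.1]) hd' (by rw [hessianForm_neg, hneg]; linarith) (by simpa using hf)
  refine ⟨a, a', b, b', ?_⟩
  have h1 := eventually_nhdsWithin_iff.1
    (eventually_differential_ne_zero hq.1.1 (differential_eq_zero_iff.2 hq.1.2) hq.2 he)
  have h2 := eventually_nhdsWithin_iff.1 (eventually_differential_ne_zero_of_neg hq he')
  filter_upwards [ha, ha', hb, hb', h1, h2] with y k1 k2 k3 k4 h1 h2 h0
  have hyq : y ≠ q := by rintro rfl; exact h0 hq.1.1
  unfold nodeModel
  rcases lt_or_gt_of_ne h0 with h | h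
  · rw [if_neg h.le.not_gt]
    have hp : 0 < MvPolynomial.eval y (-G) := by rw [map_neg]; linarith
    rcases lt_or_gt_of_ne (h2 hyq h.le) with h' | h'
    · rw [if_neg h'.le.not_gt]
      exact k4 hp (by rw [differential_neg]; linarith)
    · rw [if_pos h']
      exact k3 hp (by rw [differential_neg, map_neg]; linarith)
  · rw [if_pos h]
    rcases lt_or_gt_of_ne (h1 hyq h.le) with h' | h'
    · rw [if_neg h'.le.not_gt]
      exact k2 h (by rw [map_neg]; linarith)
    · rw [if_pos h']
      exact k1 h h'

/-- Leaving the node along a curve, the derivative in a direction `e` has the sign of the second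
differential at the initial velocity and `e`. -/
lemma eventually_differential_pos (hd : differential G q = 0) {γ : ℝ → Plane} {u : Plane}
    (h0 : γ 0 = q) (hγ : HasDerivAt γ u 0) (hB : 0 < hessianBilin G q u e) :
    ∀ᶠ s in 𝓝[>] 0, 0 < differential G (γ s) e := by
  have h := hasDerivAt_eval_comp (dirDeriv G e) hγ
  simp only [eval_dirDeriv, h0] at h
  change HasDerivAt _ (hessianBilin G q u e) 0 at h
  have := (hasDerivAt_iff_tendsto_slope.1 h).eventually_const_lt hB
  filter_upwards [nhdsWithin_mono 0 (fun x hx => ne_of_gt hx) this, self_mem_nhdsWithin] with s hs hs0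
  rw [slope_def_field, h0, hd] at hs
  simp only [zero_apply, sub_zero] at hs
  exact (div_pos_iff_of_pos_right hs0).1 hs

lemma eventually_differential_neg (hd : differential G q = 0) {γ : ℝ → Plane} {u : Plane}
    (h0 : γ 0 = q) (hγ : HasDerivAt γ u 0) (hB : hessianBilin G q u e < 0) :
    ∀ᶠ s in 𝓝[>] 0, differential G (γ s) e < 0 := by
  have := eventually_differential_pos (e := -e) hd h0 hγ (by
    rw [hessianBilin_eq] at hB ⊢
    simp only [Pi.neg_apply]
    linarith)
  filter_upwards [this] with s hs
  rw [map_neg] at hs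
  linarith

/-- The jump of the model function along a half-branch of the curve that leaves the node with
velocity `u`. -/
lemma isJump_nodeModel (hd : differential G q = 0) {γ : ℝ → Plane} {u : Plane}
    (h0 : γ 0 = q) (hγ : HasDerivAt γ u 0) (hB : hessianBilin G q u e ≠ 0)
    (hB' : hessianBilin G q u e' ≠ 0) (a a' b b' : ZMod 2) :
    ∀ᶠ s in 𝓝[>] 0, IsJump G (nodeModel G e e' a a' b b') (γ s)
      ((if 0 < hessianBilin G q u e then a else a') +
        if 0 < hessianBilin G q u e' then b else b') := by
  have key : ∀ᶠ s in 𝓝[>] 0, (∀ᶠ y in 𝓝 (γ s),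
      (0 < differential G y e ↔ 0 < hessianBilin G q u e)) := by
    rcases lt_or_gt_of_ne hB with h | h
    · filter_upwards [eventually_differential_neg hd h0 hγ h] with s hs
      filter_upwards [(continuous_differential G e).continuousAt.eventually_lt_const hs] with y hy
      simp [h.le.not_gt, hy.le.not_gt]
    · filter_upwards [eventually_differential_pos hd h0 hγ h] with s hs
      filter_upwards [(continuous_differential G e).continuousAt.eventually_const_lt hs] with y hy
      simp [h, hy]
  have key' : ∀ᶠ s in 𝓝[>] 0, (∀ᶠ y in 𝓝 (γ s),
      (0 < differential G y e' ↔ 0 < hessianBilin G q u e')) := by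
    rcases lt_or_gt_of_ne hB' with h | h
    · filter_upwards [eventually_differential_neg hd h0 hγ h] with s hs
      filter_upwards [(continuous_differential G e').continuousAt.eventually_lt_const hs] with y hy
      simp [h.le.not_gt, hy.le.not_gt]
    · filter_upwards [eventually_differential_pos hd h0 hγ h] with s hs
      filter_upwards [(continuous_differential G e').continuousAt.eventually_const_lt hs] with y hy
      simp [h, hy]
  filter_upwards [key, key'] with s hs hs'
  refine ⟨if 0 < hessianBilin G q u e' then b else b', ?_⟩
  filter_upwards [hs, hs'] with y h1 h2 _
  unfold nodeModel
  simp only [h1, h2]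
  by_cases h3 : 0 < MvPolynomial.eval y G
  · rw [if_pos h3, if_pos h3]; exact zmod_two_eq _ _
  · rw [if_neg h3, if_neg h3, add_zero]

end Node

/-- Tangent directions `v`, `w` at a node, with directions `e = v + w` and `e' = v - w` in the
sectors between them. -/
lemma exists_node_frame {q : Plane} (hq : IsHyperbolicNode G q) :
    ∃ v w e e', (∀ u, IsTangent G q u ↔ (u = v ∨ u = -v) ∨ (u = w ∨ u = -w)) ∧
      0 < hessianForm G q e ∧ hessianForm G q e' < 0 ∧
      0 < hessianBilin G q v e ∧ hessianBilin G q v e' < 0 ∧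
      0 < hessianBilin G q w e ∧ 0 < hessianBilin G q w e' := by
  have hd := differential_eq_zero_iff.2 hq.1.2
  obtain ⟨v, w, hv, hw, hvw, h⟩ := exists_isTangent_of_node hq
  -- in the coordinates given by `v` and `w`, the Hessian form is a multiple of the product of coordinates
  have key : ∀ w : Plane, (∀ u, IsTangent G q u ↔ (u = v ∨ u = -v) ∨ (u = w ∨ u = -w)) →
      0 < hessianBilin G q v w → ∃ v w e e',
      (∀ u, IsTangent G q u ↔ (u = v ∨ u = -v) ∨ (u = w ∨ u = -w)) ∧
      0 < hessianForm G q e ∧ hessianForm G q e' < 0 ∧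
      0 < hessianBilin G q v e ∧ hessianBilin G q v e' < 0 ∧
      0 < hessianBilin G q w e ∧ 0 < hessianBilin G q w e' := by
    intro w h hB
    have h1 := ((h v).2 (Or.inl (Or.inl rfl))).hessian hd
    have h2 := ((h w).2 (Or.inr (Or.inl rfl))).hessian hd
    refine ⟨v, w, v + w, v - w, h, ?_⟩
    rw [hessianBilin_eq] at hB
    unfold hessianForm at h1 h2
    simp only [hessianBilin_eq, hessianForm, Pi.add_apply, Pi.sub_apply]
    refine ⟨?_, ?_, ?_, ?_, ?_, ?_⟩ <;> nlinarith
  have hne : hessianBilin G q v w ≠ 0 := by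
    intro h0
    have h3 := hessianForm_mul_hessianForm G q w v
    have h1 := ((h v).2 (Or.inl (Or.inl rfl))).hessian hd
    have h4 : hessianBilin G q w v = 0 := by
      rw [hessianBilin_eq] at h0 ⊢; linarith
    rw [h1, h4] at h3
    have h5 : 0 < dot w (rot v) ^ 2 := by positivity
    have := hq.2
    nlinarith
  rcases lt_or_gt_of_ne hne with hB | hB
  · refine key (-w) (fun u => ?_) ?_
    · rw [h u, neg_neg, or_comm (a := u = w)]
    · rw [hessianBilin_eq] at hB ⊢
      simp only [Pi.neg_apply]
      linarith
  · exact key w h hB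

lemma hessianBilin_neg_left (q u e : Plane) :
    hessianBilin G q (-u) e = -hessianBilin G q u e := by
  rw [hessianBilin_eq, hessianBilin_eq]; simp only [Pi.neg_apply]; ring

/-- A one-dimensional cycle modulo two on the curve: a labelling `lab` of its smooth points that is
locally constant along the branches, and whose label changes by `inc q`, on both branches, at a node
`q`. -/
structure IsCycle (G : MvPolynomial (Fin 2) ℝ) (lab inc : Plane → ZMod 2) : Prop where
  smooth : ∀ q v, IsTangent G q v → differential G q ≠ 0 →
    ∀ᶠ s in 𝓝 0, lab (flowCurve G q v s) = lab q
  node : ∀ q v, IsTangent G q v → differential G q = 0 →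
    ∃ c, (∀ᶠ s in 𝓝[>] 0, lab (flowCurve G q v s) = c) ∧
      ∀ᶠ s in 𝓝[>] 0, lab (flowCurve G q (-v) s) = c + inc q

/-- The function `f` is locally constant off the curve, with jumps given by the labelling `lab`. -/
structure IsBoundary (G : MvPolynomial (Fin 2) ℝ) (f lab : Plane → ZMod 2) : Prop where
  locally_const : ∀ y, MvPolynomial.eval y G ≠ 0 → ∀ᶠ y' in 𝓝 y, f y' = f y
  jump : ∀ p, MvPolynomial.eval p G = 0 → differential G p ≠ 0 → IsJump G f p (lab p)

lemma eventually_flowCurve_smooth (hn : IsNodal G) (hs : (realSingularPoints G).Finite) {q v : Plane}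
    (hv : IsTangent G q v) : ∀ᶠ s in 𝓝[≠] 0, differential G (flowCurve G q v s) ≠ 0 := by
  obtain ⟨h1, h2, h3⟩ := flowCurve_spec hn hs hv
  have hne := (h1 0).hasDerivAt.eventually_ne (c := q)
    (by rw [h3]; exact ne_zero_of_normSq_eq_one hv.unit)
  have ht : Tendsto (flowCurve G q v) (𝓝[≠] 0) (𝓝[≠] q) := by
    refine tendsto_nhdsWithin_iff.2 ⟨?_, hne⟩
    have := h1.continuous.tendsto 0
    rw [h2] at this
    exact this.mono_left nhdsWithin_le_nhds
  filter_upwards [ht.eventually (eventually_smooth hs q)] with s hs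
  exact hs (h1 s).mem

lemma eventually_differential_of_smooth {q : Plane} (hd : differential G q ≠ 0) :
    ∀ᶠ p in 𝓝 q, differential G p ≠ 0 := by
  obtain ⟨u, hu⟩ := DFunLike.ne_iff.1 hd
  filter_upwards [(continuous_differential G u).continuousAt.eventually_ne hu] with p hp h0
  rw [h0] at hp
  exact hp rfl

/-- The jumps of a locally constant function form a cycle. -/
theorem exists_isCycle (hn : IsNodal G) (hs : (realSingularPoints G).Finite) {f : Plane → ZMod 2}
    (hf : ∀ y, MvPolynomial.eval y G ≠ 0 → ∀ᶠ y' in 𝓝 y, f y' = f y) :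
    ∃ lab inc, IsCycle G lab inc ∧ IsBoundary G f lab := by
  have hex : ∀ p, ∃ l, MvPolynomial.eval p G = 0 → differential G p ≠ 0 → IsJump G f p l := by
    intro p
    by_cases hp : MvPolynomial.eval p G = 0 ∧ differential G p ≠ 0
    · obtain ⟨l, hl⟩ := exists_isJump hp.1 hp.2 (Eventually.of_forall hf)
      exact ⟨l, fun _ _ => hl⟩
    · exact ⟨0, fun h h' => absurd ⟨h, h'⟩ hp⟩
  choose lab hlab using hex
  have hinc : ∀ q, ∃ i, ∀ v, IsTangent G q v → differential G q = 0 →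
      ∃ c, (∀ᶠ s in 𝓝[>] 0, lab (flowCurve G q v s) = c) ∧
        ∀ᶠ s in 𝓝[>] 0, lab (flowCurve G q (-v) s) = c + i := by
    intro q
    by_cases hq : IsHyperbolicNode G q
    swap
    · exact ⟨0, fun v hv h0 => absurd (hn q ⟨hv.mem, differential_eq_zero_iff.1 h0⟩) hq⟩
    have hd := differential_eq_zero_iff.2 hq.1.2
    obtain ⟨v, w, e, e', ht, he, he', hve, hve', hwe, hwe'⟩ := exists_node_frame hq
    -- `a`, `a'` and `b`, `b'` are the values of `f` on the two pairs of opposite sectors; each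
    -- half-branch separates a sector of one pair from a sector of the other
    obtain ⟨a, a', b, b', hab⟩ := exists_eq_nodeModel hq he he' (Eventually.of_forall hf)
    have key : ∀ u, IsTangent G q u → hessianBilin G q u e ≠ 0 ∧ hessianBilin G q u e' ≠ 0 ∧
        ∀ᶠ s in 𝓝[>] 0, lab (flowCurve G q u s) =
        (if 0 < hessianBilin G q u e then a else a') +
          if 0 < hessianBilin G q u e' then b else b' := by
      intro u hu
      obtain ⟨h1, h2, h3⟩ := flowCurve_spec hn hs hu
      have hB : hessianBilin G q u e ≠ 0 ∧ hessianBilin G q u e' ≠ 0 := by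
        rcases (ht u).1 hu with (rfl | rfl) | rfl | rfl
        · exact ⟨hve.ne', hve'.ne⟩
        · rw [hessianBilin_neg_left, hessianBilin_neg_left]
          exact ⟨neg_ne_zero.2 hve.ne', neg_ne_zero.2 hve'.ne⟩
        · exact ⟨hwe.ne', hwe'.ne'⟩
        · rw [hessianBilin_neg_left, hessianBilin_neg_left]
          exact ⟨neg_ne_zero.2 hwe.ne', neg_ne_zero.2 hwe'.ne'⟩
      refine ⟨hB.1, hB.2, ?_⟩
      have hder := (h1 0).hasDerivAt
      rw [h3] at hder
      have hc := h1.continuous.tendsto 0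
      rw [h2] at hc
      filter_upwards [isJump_nodeModel hd h2 hder hB.1 hB.2 a a' b b',
        nhdsWithin_mono 0 (fun x hx => ne_of_gt hx) (eventually_flowCurve_smooth hn hs hu),
        nhdsWithin_le_nhds (hc.eventually (eventually_eventually_nhds.2 hab))] with s hj hsm hs'
      refine IsJump.unique (h1 s).mem hsm (hlab _ (h1 s).mem hsm) ?_
      obtain ⟨c, hc⟩ := hj
      exact ⟨c, by filter_upwards [hc, hs'] with y h1 h2 h0; rw [h2 h0, h1 h0]⟩
    refine ⟨a + a' + b + b', fun u hu _ => ⟨_, (key u hu).2.2, ?_⟩⟩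
    filter_upwards [(key (-u) hu.neg).2.2] with s hs
    rw [hs, hessianBilin_neg_left, hessianBilin_neg_left]
    have hz : ∀ a a' b b' : ZMod 2, (a + b = a' + b' + (a + a' + b + b')) ∧
        (a + b' = a' + b + (a + a' + b + b')) ∧ (a' + b = a + b' + (a + a' + b + b')) ∧
        (a' + b' = a + b + (a + a' + b + b')) := by decide
    obtain ⟨z1, z2, z3, z4⟩ := hz a a' b b'
    rcases lt_or_gt_of_ne (key u hu).1 with k1 | k1 <;>
      rcases lt_or_gt_of_ne (key u hu).2.1 with k2 | k2 <;>
      simp only [k1, k2, k1.le.not_gt, k2.le.not_gt, neg_pos, if_true, if_false] <;> assumption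
  choose inc hinc using hinc
  refine ⟨lab, inc, ⟨fun q v hv hd => ?_, fun q v hv hd => hinc q v hv hd⟩, hf, hlab⟩
  obtain ⟨h1, h2, h3⟩ := flowCurve_spec hn hs hv
  have hc := h1.continuous.tendsto 0
  rw [h2] at hc
  filter_upwards [hc.eventually (hlab q hv.mem hd).eventually,
    hc.eventually (eventually_differential_of_smooth hd)] with s hs' hsm
  exact IsJump.unique (h1 s).mem hsm (hlab _ (h1 s).mem hsm) hs'

/-- A cycle is, near each point, the jump of some locally constant function. -/
lemma IsCycle.exists_local (hn : IsNodal G) (hs : (realSingularPoints G).Finite)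
    {lab inc : Plane → ZMod 2} (hc : IsCycle G lab inc) (q : Plane) :
    ∃ g : Plane → ZMod 2, ∀ᶠ p in 𝓝 q,
      (MvPolynomial.eval p G ≠ 0 → ∀ᶠ y in 𝓝 p, g y = g p) ∧
      (MvPolynomial.eval p G = 0 → differential G p ≠ 0 → IsJump G g p (lab p)) := by
  by_cases hq : MvPolynomial.eval q G = 0
  swap
  · refine ⟨fun _ => 0, ?_⟩
    filter_upwards [(continuous_eval G).continuousAt.eventually_ne hq] with p hp
    exact ⟨fun _ => Eventually.of_forall fun _ => rfl, fun h => absurd h hp⟩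
  by_cases hd : differential G q = 0
  · have hnode := hn q ⟨hq, differential_eq_zero_iff.1 hd⟩
    obtain ⟨v, w, e, e', ht, he, he', hve, hve', hwe, hwe'⟩ := exists_node_frame hnode
    have htv : IsTangent G q v := (ht v).2 (Or.inl (Or.inl rfl))
    have htw : IsTangent G q w := (ht w).2 (Or.inr (Or.inl rfl))
    obtain ⟨cv, hv1, hv2⟩ := hc.node q v htv hd
    obtain ⟨cw, hw1, hw2⟩ := hc.node q w htw hd
    -- the sectors carry the values with jumps `cv`, `cv + inc q`, `cw`, `cw + inc q` along the four
    -- half-branches, one of the values being normalized to zero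
    refine ⟨nodeModel G e e' 0 (inc q + cv + cw) cw cv, ?_⟩
    have key : ∀ u, IsTangent G q u → ∀ᶠ s in 𝓝[>] 0,
        IsJump G (nodeModel G e e' 0 (inc q + cv + cw) cw cv) (flowCurve G q u s)
          (lab (flowCurve G q u s)) := by
      intro u hu
      obtain ⟨h1, h2, h3⟩ := flowCurve_spec hn hs hu
      have hder := (h1 0).hasDerivAt
      rw [h3] at hder
      have hz : ∀ i cv cw : ZMod 2, 0 + cv = cv ∧ i + cv + cw + cw = cv + i ∧ 0 + cw = cw ∧
          i + cv + cw + cv = cw + i := by decide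
      obtain ⟨z1, z2, z3, z4⟩ := hz (inc q) cv cw
      rcases (ht u).1 hu with (rfl | rfl) | rfl | rfl
      · filter_upwards [hv1, isJump_nodeModel hd h2 hder hve.ne' hve'.ne 0 (inc q + cv + cw) cw cv]
          with s e1 e2
        rw [e1]
        simpa [hve, hve'.le.not_gt] using e2
      · filter_upwards [hv2, isJump_nodeModel hd h2 hder (e := e) (e' := e')
          (by rw [hessianBilin_neg_left]; exact neg_ne_zero.2 hve.ne')
          (by rw [hessianBilin_neg_left]; exact neg_ne_zero.2 hve'.ne)
          0 (inc q + cv + cw) cw cv] with s e1 e2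
        rw [e1, ← z2]
        simpa [hessianBilin_neg_left, hve.le.not_gt, hve'] using e2
      · filter_upwards [hw1, isJump_nodeModel hd h2 hder hwe.ne' hwe'.ne' 0 (inc q + cv + cw) cw cv]
          with s e1 e2
        rw [e1]
        simpa [hwe, hwe'] using e2
      · filter_upwards [hw2, isJump_nodeModel hd h2 hder (e := e) (e' := e')
          (by rw [hessianBilin_neg_left]; exact neg_ne_zero.2 hwe.ne')
          (by rw [hessianBilin_neg_left]; exact neg_ne_zero.2 hwe'.ne')
          0 (inc q + cv + cw) cw cv] with s e1 e2
        rw [e1, ← z4]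
        simpa [hessianBilin_neg_left, hwe.le.not_gt, hwe'.le.not_gt] using e2
    obtain ⟨η, hη, hkey⟩ : ∃ η > 0, ∀ u ∈ {u | IsTangent G q u}, ∀ s ∈ Ioo 0 η,
        IsJump G (nodeModel G e e' 0 (inc q + cv + cw) cw cv) (flowCurve G q u s)
          (lab (flowCurve G q u s)) := by
      have : ∀ᶠ s in 𝓝[>] 0, ∀ u ∈ {u | IsTangent G q u},
          IsJump G (nodeModel G e e' 0 (inc q + cv + cw) cw cv) (flowCurve G q u s)
          (lab (flowCurve G q u s)) := by
        rw [eventually_all_finite (finite_isTangent hn q)]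
        exact key
      obtain ⟨η, hη, h⟩ := mem_nhdsGT_iff_exists_Ioo_subset.1 this
      exact ⟨η, hη, fun u hu s hs => h hs u hu⟩
    filter_upwards [eventually_nhdsWithin_iff.1
      (eventually_nodeModel_eq hnode he he' 0 (inc q + cv + cw) cw cv),
      eventually_eq_flowCurve hn hs hq hη] with p hp hp'
    refine ⟨fun h0 => hp (by rintro rfl; exact h0 hq) h0, fun h0 h1 => ?_⟩
    obtain ⟨v', hv'⟩ := exists_isTangent hn h0
    obtain ⟨u, hu, t, ht', rfl, -⟩ := hp' v' hv'
    rw [abs_lt] at ht'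
    obtain ⟨f1, f2, f3⟩ := flowCurve_spec hn hs hu
    obtain ⟨g1, g2, g3⟩ := flowCurve_spec hn hs hu.neg
    rcases lt_trichotomy t 0 with ht0 | rfl | ht0
    · have := f1.eq_of_eq_neg hn g1 (s := 0) (t := 0) (by rw [f2, g2]) (by rw [f3, g3, neg_neg]) t
      rw [add_zero, add_zero] at this
      rw [this]
      exact hkey (-u) hu.neg (-t) ⟨by linarith, by linarith⟩
    · rw [f2] at h1
      exact absurd hd h1
    · exact hkey u hu t ⟨ht0, ht'.2⟩
  · refine ⟨fun y => if 0 < MvPolynomial.eval y G then lab q else 0, ?_⟩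
    have hlab : ∀ᶠ p in 𝓝 q, MvPolynomial.eval p G = 0 → lab p = lab q := by
      obtain ⟨η, hη, h⟩ : ∃ η > 0, ∀ u ∈ {u | IsTangent G q u}, ∀ s, |s| < η →
          lab (flowCurve G q u s) = lab q := by
        have : ∀ᶠ s in 𝓝 0, ∀ u ∈ {u | IsTangent G q u}, lab (flowCurve G q u s) = lab q := by
          rw [eventually_all_finite (finite_isTangent hn q)]
          exact fun u hu => hc.smooth q u hu hd
        obtain ⟨η, hη, h⟩ := Metric.eventually_nhds_iff.1 this
        exact ⟨η, hη, fun u hu s hs => h (by simpa using hs) u hu⟩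
      filter_upwards [eventually_eq_flowCurve hn hs hq hη] with p hp h0
      obtain ⟨v', hv'⟩ := exists_isTangent hn h0
      obtain ⟨u, hu, t, ht, rfl, -⟩ := hp v' hv'
      exact h u hu t ht
    filter_upwards [hlab] with p hp
    refine ⟨fun h0 => ?_, fun h0 h1 => ⟨0, Eventually.of_forall fun y _ => by rw [hp h0, zero_add]⟩⟩
    have c0 := (continuous_eval G).continuousAt (x := p)
    rcases lt_or_gt_of_ne h0 with h | h
    · filter_upwards [c0.eventually_lt_const h] with y hy
      rw [if_neg hy.le.not_gt, if_neg h.le.not_gt]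
    · filter_upwards [c0.eventually_const_lt h] with y hy
      rw [if_pos hy, if_pos h]

lemma frequently_eval_ne_zero (hn : IsNodal G) (q : Plane) :
    ∃ᶠ y in 𝓝 q, MvPolynomial.eval y G ≠ 0 := by
  by_cases hq : MvPolynomial.eval q G = 0
  · by_cases hd : differential G q = 0
    · obtain ⟨-, -, e, -, -, he, -⟩ := exists_node_frame (hn q ⟨hq, differential_eq_zero_iff.1 hd⟩)
      obtain ⟨P, hP, h1, h2⟩ := exists_taylor G q
      have hc : Continuous fun s : ℝ => P (s, e) := hP.continuous.comp (by fun_prop)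
      have hpos : ∀ᶠ s in 𝓝 0, 0 < P (s, e) :=
        hc.continuousAt.eventually_const_lt (by linarith [h2 e])
      have hlim : Tendsto (fun s : ℝ => q + s • e) (𝓝[≠] 0) (𝓝 q) := by
        have : Continuous fun s : ℝ => q + s • e := by fun_prop
        simpa using (this.tendsto 0).mono_left nhdsWithin_le_nhds
      refine hlim.frequently (Eventually.frequently ?_)
      filter_upwards [nhdsWithin_le_nhds hpos, self_mem_nhdsWithin] with s hs hs0
      rw [h1, hq, hd, zero_apply, mul_zero, zero_add, zero_add]
      exact mul_ne_zero (pow_ne_zero _ hs0) hs.ne'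
    · exact (frequently_eval_pos hq hd).mono fun y hy => hy.ne'
  · exact fun h => h.self_of_nhds hq

lemma dense_compl_realZeroSet (hn : IsNodal G) : Dense (realZeroSet G)ᶜ := by
  intro q
  rw [mem_closure_iff_frequently]
  exact frequently_eval_ne_zero hn q

lemma mem_compl_realZeroSet {q : Plane} : q ∈ (realZeroSet G)ᶜ ↔ MvPolynomial.eval q G ≠ 0 := Iff.rfl

lemma isOpen_compl_realZeroSet (G : MvPolynomial (Fin 2) ℝ) : IsOpen (realZeroSet G)ᶜ :=
  (isClosed_eq (continuous_eval G) continuous_const).isOpen_compl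

/-- Every cycle in the plane is a boundary. -/
theorem IsCycle.exists_isBoundary (hn : IsNodal G) (hs : (realSingularPoints G).Finite)
    {lab inc : Plane → ZMod 2} (hc : IsCycle G lab inc) : ∃ f, IsBoundary G f lab := by
  choose g hg using hc.exists_local hn hs
  obtain ⟨f, hf⟩ := exists_glued (D := (realZeroSet G)ᶜ) (g := g) (dense_compl_realZeroSet hn) (by
    intro q
    have hiso : ∀ᶠ p in 𝓝 q, p ≠ q → MvPolynomial.eval p G = 0 → differential G p ≠ 0 :=
      eventually_nhdsWithin_iff.1 (eventually_smooth hs q)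
    filter_upwards [hg q, hiso] with p hp hp'
    -- near `q`, the local functions at `q` and at a nearby point have the same jumps
    by_cases hpq : p = q
    · subst hpq
      exact ⟨0, Eventually.of_forall fun y => sub_self _⟩
    by_cases h0 : MvPolynomial.eval p G = 0
    · obtain ⟨b, hb⟩ := hp.2 h0 (hp' hpq h0)
      obtain ⟨b', hb'⟩ := (hg p).self_of_nhds.2 h0 (hp' hpq h0)
      refine ⟨b - b', eventually_nhdsWithin_iff.2 ?_⟩
      filter_upwards [hb, hb'] with y h1 h2 h3
      rw [h1 h3, h2 h3]
      abel
    · refine ⟨g q p - g p p, nhdsWithin_le_nhds ?_⟩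
      filter_upwards [hp.1 h0, (hg p).self_of_nhds.1 h0] with y h1 h2
      rw [h1, h2])
  refine ⟨f, fun y hy => ?_, fun p hp hd => ?_⟩
  · obtain ⟨c, hc⟩ := hf y (mem_univ y)
    rw [(isOpen_compl_realZeroSet G).nhdsWithin_eq hy] at hc
    have h1 := hc.self_of_nhds
    filter_upwards [hc, (hg y).self_of_nhds.1 hy] with z h2 h3
    rw [← h1, h3] at h2
    exact sub_left_injective h2
  · obtain ⟨c, hc⟩ := hf p (mem_univ p)
    obtain ⟨b, hb⟩ := (hg p).self_of_nhds.2 hp hd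
    refine ⟨b + c, ?_⟩
    filter_upwards [eventually_nhdsWithin_iff.1 hc, hb] with y h1 h2 h0
    have := h1 h0
    rw [h2 h0, sub_eq_iff_eq_add] at this
    rw [this]
    abel

/-- Two functions with the same jumps differ by a constant, since the complement of the finitely many
nodes is connected. -/
lemma IsBoundary.sub_eq (hn : IsNodal G) (hs : (realSingularPoints G).Finite)
    {f f' lab : Plane → ZMod 2} (h : IsBoundary G f lab) (h' : IsBoundary G f' lab) {x y : Plane}
    (hx : MvPolynomial.eval x G ≠ 0) (hy : MvPolynomial.eval y G ≠ 0) : f' x - f x = f' y - f y := by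
  have hconn : IsPreconnected (realSingularPoints G)ᶜ := by
    refine (hs.countable.isPathConnected_compl_of_one_lt_rank ?_).isConnected.isPreconnected
    rw [rank_fin_fun]
    norm_num
  refine eq_of_eventually_const (g := fun y => f' y - f y) (dense_compl_realZeroSet hn)
    hs.isClosed.isOpen_compl hconn (fun q hq => ?_) ⟨fun h0 => hx h0.1, hx⟩ ⟨fun h0 => hy h0.1, hy⟩
  by_cases h0 : MvPolynomial.eval q G = 0
  · have hd : differential G q ≠ 0 := fun hd => hq ⟨h0, differential_eq_zero_iff.1 hd⟩
    obtain ⟨b, hb⟩ := h.jump q h0 hd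
    obtain ⟨b', hb'⟩ := h'.jump q h0 hd
    refine ⟨b' - b, eventually_nhdsWithin_iff.2 ?_⟩
    filter_upwards [hb, hb'] with y h1 h2 h3
    rw [h1 h3, h2 h3]
    abel
  · refine ⟨f' q - f q, nhdsWithin_le_nhds ?_⟩
    filter_upwards [h.locally_const q h0, h'.locally_const q h0] with y h1 h2
    rw [h1, h2]

end PlaneCurve

end

noncomputable section

namespace PlaneCurve

variable {G : MvPolynomial (Fin 2) ℝ}

/-! ### Parameters on the branches -/

namespace BranchSystem

variable (B : BranchSystem G)

/-- A set of representatives of the parameters on a branch modulo its period. -/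
def window (b : B.Branch) : Set ℝ := {t | B.period b = 0 ∨ 0 ≤ t ∧ t < B.period b}

lemma exists_mem_window (b : B.Branch) (t : ℝ) : ∃ n : ℤ, t + n * B.period b ∈ B.window b := by
  by_cases h : B.period b = 0
  · exact ⟨0, Or.inl h⟩
  · have hpos : 0 < B.period b := lt_of_le_of_ne (B.period_nonneg b) (Ne.symm h)
    obtain ⟨n, hn, -⟩ := existsUnique_add_zsmul_mem_Ico hpos t 0
    refine ⟨n, Or.inr ?_⟩
    simpa using hn

lemma eq_of_mem_window {b : B.Branch} {t t' : ℝ} (ht : t ∈ B.window b) (ht' : t' ∈ B.window b)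
    {n : ℤ} (h : t' = t + n * B.period b) : t' = t := by
  rcases ht with h0 | ht
  · simpa [h0] using h
  rcases ht' with h0 | ht'
  · simpa [h0] using h
  have hpos : 0 < B.period b := ht.1.trans_lt ht.2
  have h1 : (n : ℝ) < 1 := by
    by_contra! hc
    nlinarith
  have h2 : (-1 : ℝ) < n := by
    by_contra! hc
    nlinarith
  have h3 : n = 0 := by
    have h1' : n < 1 := by exact_mod_cast h1
    have h2' : -1 < n := by exact_mod_cast h2
    omega
  simpa [h3] using h

/-- The parameters of the points over `q`, one from each class modulo the period. -/
def params (q : Plane) : Set (B.Branch × ℝ) := {x | x.2 ∈ B.window x.1 ∧ B.curve x.1 x.2 = q}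

/-- The velocity at a parameter. -/
def vel (x : B.Branch × ℝ) : Plane := deriv (B.curve x.1) x.2

lemma deriv_add_period (b : B.Branch) (n : ℤ) (t : ℝ) :
    deriv (B.curve b) (t + n * B.period b) = deriv (B.curve b) t := by
  rw [← deriv_comp_add_const]
  congr 1
  exact funext fun s => B.add_period b n s

lemma exists_mem_params {q v : Plane} (hv : IsTangent G q v) :
    ∃ x ∈ B.params q, B.vel x = v ∨ B.vel x = -v := by
  obtain ⟨b, t, h1, h2⟩ := B.exists_param q v hv
  obtain ⟨n, hn⟩ := B.exists_mem_window b t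
  exact ⟨(b, t + n * B.period b), ⟨hn, by rw [← h1]; exact B.add_period b n t⟩, by
    rw [vel, B.deriv_add_period]; exact h2⟩

lemma isTangent_vel (hn : IsNodal G) {q : Plane} {x : B.Branch × ℝ} (hx : x ∈ B.params q) :
    IsTangent G q (B.vel x) := by
  have := (B.isUnitCurve x.1).isTangent hn x.2
  rwa [hx.2] at this

lemma params_eq_of_vel (hn : IsNodal G) {q : Plane} {x y : B.Branch × ℝ} (hx : x ∈ B.params q)
    (hy : y ∈ B.params q) (h : B.vel x = B.vel y ∨ B.vel x = -B.vel y) : x = y := by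
  obtain ⟨b, t⟩ := x
  obtain ⟨b', t'⟩ := y
  obtain rfl : b = b' := B.branch_eq b b' t t' (hx.2.trans hy.2.symm) h
  obtain ⟨n, h1⟩ := B.param_eq hn (hx.2.trans hy.2.symm) h
  have := B.eq_of_mem_window hx.1 hy.1 h1
  rw [show t' = t from this]

/-- A smooth point has exactly one parameter. -/
lemma params_of_smooth (hn : IsNodal G) {q : Plane} (hd : differential G q ≠ 0)
    {x y : B.Branch × ℝ} (hx : x ∈ B.params q) (hy : y ∈ B.params q) : x = y :=
  B.params_eq_of_vel hn hx hy (eq_or_eq_neg_of_smooth hd (B.isTangent_vel hn hx)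
    (B.isTangent_vel hn hy))

/-- A node has exactly two parameters. -/
lemma params_of_node (hn : IsNodal G) {q : Plane} (hq : IsHyperbolicNode G q) :
    ∃ x y, x ≠ y ∧ B.params q = {x, y} ∧ dot (B.vel y) (rot (B.vel x)) ≠ 0 := by
  obtain ⟨v, w, hv, hw, hvw, h⟩ := exists_isTangent_of_node hq
  obtain ⟨x, hx, hxv⟩ := B.exists_mem_params ((h v).2 (Or.inl (Or.inl rfl)))
  obtain ⟨y, hy, hyw⟩ := B.exists_mem_params ((h w).2 (Or.inr (Or.inl rfl)))
  have hdot : dot (B.vel y) (rot (B.vel x)) ≠ 0 := by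
    simp only [dot, rot_zero, rot_one] at hvw ⊢
    rcases hxv with h1 | h1 <;> rcases hyw with h2 | h2 <;> simp only [h1, h2, Pi.neg_apply] <;>
      intro h0 <;> apply hvw <;> linarith
  refine ⟨x, y, ?_, ?_, hdot⟩
  · rintro rfl
    apply hdot
    simp [dot]; ring
  · ext z
    simp only [mem_insert_iff, mem_singleton_iff]
    constructor
    · intro hz
      rcases (h _).1 (B.isTangent_vel hn hz) with h1 | h1
      · left
        refine B.params_eq_of_vel hn hz hx ?_
        rcases hxv with h2 | h2 <;> rcases h1 with h1 | h1 <;> simp [h1, h2]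
      · right
        refine B.params_eq_of_vel hn hz hy ?_
        rcases hyw with h2 | h2 <;> rcases h1 with h1 | h1 <;> simp [h1, h2]
    · rintro (rfl | rfl) <;> assumption

/-- The parameters of the nodes. -/
def NodeParam : Type := {x : B.Branch × ℝ // x.2 ∈ B.window x.1 ∧ differential G (B.curve x.1 x.2) = 0}

lemma finite_nodeParam (hn : IsNodal G) (hs : (realSingularPoints G).Finite) :
    Finite B.NodeParam := by
  have h : (⋃ q ∈ realSingularPoints G, B.params q).Finite := by
    refine hs.biUnion fun q hq => ?_
    obtain ⟨x, y, -, h, -⟩ := B.params_of_node hn (hn q hq)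
    rw [h]
    simp
  refine Set.Finite.subset h fun x hx => ?_
  simp only [mem_iUnion]
  exact ⟨B.curve x.1 x.2, ⟨(B.isUnitCurve x.1 x.2).mem, differential_eq_zero_iff.1 hx.2⟩, hx.1, rfl⟩

/-- The node at a node parameter. -/
def NodeParam.node {B : BranchSystem G} (x : B.NodeParam) : realSingularPoints G :=
  ⟨B.curve x.1.1 x.1.2, (B.isUnitCurve x.1.1 x.1.2).mem, differential_eq_zero_iff.1 x.2.2⟩

/-- The branch of a node parameter. -/
def NodeParam.branch {B : BranchSystem G} (x : B.NodeParam) : B.Branch := x.1.1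

/-- The position of a node parameter on its branch. -/
def NodeParam.time {B : BranchSystem G} (x : B.NodeParam) : ℝ := x.1.2

lemma exists_nodeParam_pair (hn : IsNodal G) (q : realSingularPoints G) :
    ∃ x y : B.NodeParam, x ≠ y ∧ ∀ z : B.NodeParam, z.node = q ↔ z = x ∨ z = y := by
  obtain ⟨x, y, hxy, h, -⟩ := B.params_of_node hn (hn q q.2)
  have hd := differential_eq_zero_iff.2 q.2.2
  have hx : x ∈ B.params q := by rw [h]; simp
  have hy : y ∈ B.params q := by rw [h]; simp
  refine ⟨⟨x, hx.1, by rw [hx.2]; exact hd⟩, ⟨y, hy.1, by rw [hy.2]; exact hd⟩, ?_, fun z => ?_⟩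
  · intro h0
    exact hxy (congrArg Subtype.val h0)
  · have : z.node = q ↔ z.1 ∈ B.params q := by
      rw [Subtype.ext_iff]
      exact ⟨fun h => ⟨z.2.1, h⟩, fun h => h.2⟩
    rw [this, h]
    simp only [mem_insert_iff, mem_singleton_iff]
    exact or_congr ⟨fun h => Subtype.ext h, congrArg Subtype.val⟩
      ⟨fun h => Subtype.ext h, congrArg Subtype.val⟩

lemma eventually_smooth_curve (hs : (realSingularPoints G).Finite) (b : B.Branch)
    (t : ℝ) : ∀ᶠ s in 𝓝[≠] t, differential G (B.curve b s) ≠ 0 := by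
  have h1 := B.isUnitCurve b
  have hne := (h1 t).hasDerivAt.eventually_ne (c := B.curve b t)
    (ne_zero_of_normSq_eq_one (h1 t).unit)
  have ht : Tendsto (B.curve b) (𝓝[≠] t) (𝓝[≠] (B.curve b t)) :=
    tendsto_nhdsWithin_iff.2 ⟨(h1.continuous.tendsto t).mono_left nhdsWithin_le_nhds, hne⟩
  filter_upwards [ht.eventually (eventually_smooth hs _)] with s hs
  exact hs (h1 s).mem

/-! ### Partial sums along the branches -/

section Sums

variable [Fintype B.NodeParam]

open Classical in
/-- The total increment, on a branch, of a labelling with increments `d` at the nodes. -/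
def totalInc (d : realSingularPoints G → ZMod 2) (b : B.Branch) : ZMod 2 :=
  ∑ x : B.NodeParam with x.branch = b, d x.node

open Classical in
/-- The increment, on a branch, up to the parameter `t`. -/
def partialInc (d : realSingularPoints G → ZMod 2) (b : B.Branch) (t : ℝ) : ZMod 2 :=
  ∑ x : B.NodeParam with x.branch = b ∧ x.time < t, d x.node

variable {B}

open Classical in
/-- The increments at the nodes, extended by zero to the plane. -/
def localInc (d : realSingularPoints G → ZMod 2) (q : Plane) : ZMod 2 :=
  if h : q ∈ realSingularPoints G then d ⟨q, h⟩ else 0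

variable (d : realSingularPoints G → ZMod 2) (b : B.Branch)

lemma partialInc_eventually_left (t : ℝ) :
    ∀ᶠ s in 𝓝[<] t, B.partialInc d b s = B.partialInc d b t := by
  classical
  have : ∀ᶠ s in 𝓝[<] t, ∀ x : B.NodeParam, x.time < t → x.time < s :=
    eventually_all.2 fun x => by
      by_cases h : x.time < t
      · exact ((eventually_gt_nhds h).filter_mono nhdsWithin_le_nhds).mono fun s hs _ => hs
      · exact Eventually.of_forall fun s h' => absurd h' h
  filter_upwards [this, self_mem_nhdsWithin] with s hs hst
  unfold partialInc
  congr 1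
  ext x
  simp only [Finset.mem_filter, Finset.mem_univ, true_and]
  exact and_congr_right fun _ => ⟨fun h => h.trans hst, hs x⟩

/-- The partial sum jumps by the increment at a node. -/
lemma partialInc_eventually_right {t : ℝ} (ht : differential G (B.curve b t) = 0 → t ∈ B.window b) :
    ∀ᶠ s in 𝓝[>] t, B.partialInc d b s = B.partialInc d b t + localInc d (B.curve b t) := by
  classical
  have : ∀ᶠ s in 𝓝[>] t, ∀ x : B.NodeParam, t < x.time → s ≤ x.time :=
    eventually_all.2 fun x => by
      by_cases h : t < x.time
      · exact ((eventually_lt_nhds h).filter_mono nhdsWithin_le_nhds).mono fun s hs _ => hs.le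
      · exact Eventually.of_forall fun s h' => absurd h' h
  filter_upwards [this, self_mem_nhdsWithin] with s hs hst
  rw [mem_Ioi] at hst
  by_cases hd : differential G (B.curve b t) = 0
  · have hq : B.curve b t ∈ realSingularPoints G :=
      ⟨(B.isUnitCurve b t).mem, differential_eq_zero_iff.1 hd⟩
    set x₀ : B.NodeParam := ⟨(b, t), ht hd, hd⟩ with hx₀
    unfold partialInc
    have h1 : (Finset.univ.filter fun x : B.NodeParam => x.branch = b ∧ x.time < s) =
        insert x₀ (Finset.univ.filter fun x : B.NodeParam => x.branch = b ∧ x.time < t) := by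
      ext x
      simp only [Finset.mem_filter, Finset.mem_univ, true_and, Finset.mem_insert]
      constructor
      · rintro ⟨hb, hxs⟩
        rcases lt_trichotomy x.time t with h | h | h
        · exact Or.inr ⟨hb, h⟩
        · exact Or.inl (Subtype.ext (Prod.ext hb h))
        · exact absurd (hs x h) (not_le.2 hxs)
      · rintro (rfl | ⟨hb, hxt⟩)
        · exact ⟨rfl, hst⟩
        · exact ⟨hb, hxt.trans hst⟩
    rw [h1, Finset.sum_insert (by
      simp only [Finset.mem_filter, not_and]
      exact fun _ _ => lt_irrefl t), add_comm, localInc, dif_pos hq]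
    rfl
  · have hq : B.curve b t ∉ realSingularPoints G := fun h => hd (differential_eq_zero_iff.2 h.2)
    rw [localInc, dif_neg hq, add_zero]
    unfold partialInc
    congr 1
    ext x
    simp only [Finset.mem_filter, Finset.mem_univ, true_and]
    refine and_congr_right fun hb => ⟨fun hxs => ?_, fun h => h.trans hst⟩
    rcases lt_trichotomy x.time t with h | h | h
    · exact h
    · exfalso
      apply hd
      have h2 := x.2.2
      have e1 : x.1.1 = b := hb
      have e2 : x.1.2 = t := h
      rwa [e1, e2] at h2
    · exact absurd (hs x h) (not_le.2 hxs)

lemma partialInc_of_forall_le {t : ℝ} (h : ∀ x : B.NodeParam, x.branch = b → t ≤ x.time) :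
    B.partialInc d b t = 0 := by
  classical
  unfold partialInc
  refine Finset.sum_eq_zero fun x hx => ?_
  simp only [Finset.mem_filter] at hx
  exact absurd (h x hx.2.1) (not_le.2 hx.2.2)

lemma partialInc_of_forall_lt {t : ℝ} (h : ∀ x : B.NodeParam, x.branch = b → x.time < t) :
    B.partialInc d b t = B.totalInc d b := by
  classical
  unfold partialInc totalInc
  congr 1
  ext x
  simp only [Finset.mem_filter, Finset.mem_univ, true_and]
  exact ⟨fun hx => hx.1, fun hx => ⟨hx, h x hx⟩⟩

end Sums

end BranchSystem

end PlaneCurve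

end

noncomputable section

namespace PlaneCurve

variable {G : MvPolynomial (Fin 2) ℝ}

/-! ### Cycles in terms of increments at the nodes -/

lemma tendsto_sub_right_nhdsGT (t : ℝ) : Tendsto (fun s => s - t) (𝓝[>] t) (𝓝[>] 0) := by
  refine tendsto_nhdsWithin_iff.2 ⟨(tendsto_sub_const_nhds t).mono_left nhdsWithin_le_nhds, ?_⟩
  filter_upwards [self_mem_nhdsWithin] with s hs
  exact sub_pos.2 (mem_Ioi.1 hs)

lemma tendsto_sub_left_nhdsLT (t : ℝ) : Tendsto (fun s => t - s) (𝓝[<] t) (𝓝[>] 0) := by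
  refine tendsto_nhdsWithin_iff.2 ⟨?_, ?_⟩
  · have : Continuous fun s : ℝ => t - s := by fun_prop
    simpa using (this.tendsto t).mono_left nhdsWithin_le_nhds
  · filter_upwards [self_mem_nhdsWithin] with s hs
    exact sub_pos.2 (mem_Iio.1 hs)

namespace BranchSystem

variable (B : BranchSystem G)

lemma flowCurve_eq (hn : IsNodal G) (hs : (realSingularPoints G).Finite) (b : B.Branch) (t s : ℝ) :
    flowCurve G (B.curve b t) (deriv (B.curve b) t) s = B.curve b (s + t) := by
  obtain ⟨h1, h2, h3⟩ := flowCurve_spec hn hs ((B.isUnitCurve b).isTangent hn t)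
  simpa using h1.eq_of_eq hn (B.isUnitCurve b) h2 h3 s

lemma flowCurve_neg_eq (hn : IsNodal G) (hs : (realSingularPoints G).Finite) (b : B.Branch)
    (t s : ℝ) :
    flowCurve G (B.curve b t) (-deriv (B.curve b) t) s = B.curve b (-s + t) := by
  obtain ⟨h1, h2, h3⟩ := flowCurve_spec hn hs ((B.isUnitCurve b).isTangent hn t).neg
  simpa using h1.eq_of_eq_neg hn (B.isUnitCurve b) h2 h3 s

end BranchSystem

lemma dense_smooth_params (B : BranchSystem G) (hs : (realSingularPoints G).Finite) (b : B.Branch) :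
    Dense {t | differential G (B.curve b t) ≠ 0} := fun t =>
  mem_closure_iff_frequently.2
    ((B.eventually_smooth_curve hs b t).frequently.filter_mono nhdsWithin_le_nhds)

section

variable {B : BranchSystem G} [Fintype B.NodeParam]

/-- Along a branch, the label of a cycle changes by the partial sums of its increments. -/
lemma IsCycle.add_partialInc_eq (hn : IsNodal G) (hs : (realSingularPoints G).Finite)
    {lab inc : Plane → ZMod 2} (hc : IsCycle G lab inc) (b : B.Branch) {U : Set ℝ} (hU : IsOpen U)
    (hUc : IsPreconnected U)
    (hUw : ∀ t ∈ U, differential G (B.curve b t) = 0 → t ∈ B.window b) {t t' : ℝ}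
    (ht : t ∈ U) (htd : differential G (B.curve b t) ≠ 0) (ht' : t' ∈ U)
    (htd' : differential G (B.curve b t') ≠ 0) :
    lab (B.curve b t) + B.partialInc (fun q => inc q) b t =
      lab (B.curve b t') + B.partialInc (fun q => inc q) b t' := by
  -- the sum of label and partial increment is locally constant, also across the nodes
  refine eq_of_eventually_const
    (g := fun t => lab (B.curve b t) + B.partialInc (fun q => inc q) b t)
    (dense_smooth_params B hs b) hU hUc (fun t ht => ?_) ⟨ht, htd⟩ ⟨ht', htd'⟩
  have hv := (B.isUnitCurve b).isTangent hn t
  have hR := BranchSystem.partialInc_eventually_right (fun q => inc q) b (hUw t ht)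
  have hL := BranchSystem.partialInc_eventually_left (B := B) (fun q => inc q) b t
  by_cases hd : differential G (B.curve b t) = 0
  · obtain ⟨c, h1, h2⟩ := hc.node _ _ hv hd
    simp only [B.flowCurve_eq hn hs] at h1
    simp only [B.flowCurve_neg_eq hn hs] at h2
    have hinc : BranchSystem.localInc (G := G) (fun q => inc q) (B.curve b t) = inc (B.curve b t) := by
      rw [BranchSystem.localInc, dif_pos ⟨hv.mem, differential_eq_zero_iff.1 hd⟩]
    rw [hinc] at hR
    refine ⟨c + inc (B.curve b t) + B.partialInc (fun q => inc q) b t, ?_⟩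
    have hne : ∀ᶠ y in 𝓝[≠] t, lab (B.curve b y) + B.partialInc (fun q => inc q) b y =
        c + inc (B.curve b t) + B.partialInc (fun q => inc q) b t := by
      rw [← Iio_union_Ioi, nhdsWithin_union, eventually_sup]
      constructor
      · filter_upwards [hL, (tendsto_sub_left_nhdsLT t).eventually h2] with y e1 e2
        rw [show -(t - y) + t = y by ring] at e2
        rw [e1, e2]
      · filter_upwards [hR, (tendsto_sub_right_nhdsGT t).eventually h1] with y e1 e2
        rw [sub_add_cancel] at e2
        rw [e1, e2]
        ring
    refine hne.filter_mono (nhdsWithin_mono t ?_)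
    rintro y hy rfl
    exact hy hd
  · have h1 := hc.smooth _ _ hv hd
    simp only [B.flowCurve_eq hn hs] at h1
    have hinc : BranchSystem.localInc (G := G) (fun q => inc q) (B.curve b t) = 0 := by
      rw [BranchSystem.localInc, dif_neg fun h => hd (differential_eq_zero_iff.2 h.2)]
    rw [hinc] at hR
    refine ⟨lab (B.curve b t) + B.partialInc (fun q => inc q) b t, nhdsWithin_le_nhds ?_⟩
    have hP : ∀ᶠ y in 𝓝 t,
        B.partialInc (fun q => inc q) b y = B.partialInc (fun q => inc q) b t := by
      have : ∀ᶠ y in 𝓝[≠] t,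
          B.partialInc (fun q => inc q) b y = B.partialInc (fun q => inc q) b t := by
        rw [← Iio_union_Ioi, nhdsWithin_union, eventually_sup]
        exact ⟨hL, hR.mono fun y hy => by rw [hy, add_zero]⟩
      rw [eventually_nhdsWithin_iff] at this
      filter_upwards [this] with y hy
      by_cases h : y = t
      · rw [h]
      · exact hy h
    filter_upwards [hP, (tendsto_sub_const_nhds t).eventually h1] with y e1 e2
    rw [sub_add_cancel] at e2
    rw [e1, e2]

/-- On a closed branch, a cycle is determined by its label at the base point and its increments,
and the increments sum to zero. -/
lemma IsCycle.eq_of_circle (hn : IsNodal G) (hs : (realSingularPoints G).Finite)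
    {lab inc : Plane → ZMod 2} (hc : IsCycle G lab inc) {b : B.Branch} (hb : B.period b ≠ 0) :
    B.totalInc (fun q => inc q) b = 0 ∧ ∀ t ∈ B.window b, differential G (B.curve b t) ≠ 0 →
      lab (B.curve b t) = lab (B.curve b 0) + B.partialInc (fun q => inc q) b t := by
  have hpos : 0 < B.period b := lt_of_le_of_ne (B.period_nonneg b) (Ne.symm hb)
  set T := B.period b with hT
  have hper : ∀ t, B.curve b (t + T) = B.curve b t := fun t => by
    simpa using B.add_period b 1 t
  have hwin : ∀ {t}, t ∈ B.window b ↔ 0 ≤ t ∧ t < T := by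
    intro t
    exact ⟨fun h => h.resolve_left hb, Or.inr⟩
  -- a neighbourhood of `[0, T]` without nodes outside `(0, T)`
  obtain ⟨ε, hε, hsm⟩ : ∃ ε > 0, ∀ t, |t| < ε → differential G (B.curve b t) ≠ 0 := by
    have := (B.isUnitCurve b).continuous.continuousAt.eventually
      (eventually_differential_of_smooth (B.base_smooth b))
    obtain ⟨ε, hε, h⟩ := Metric.eventually_nhds_iff.1 this
    exact ⟨ε, hε, fun t ht => h (by simpa using ht)⟩
  have hUw : ∀ t ∈ Ioo (-ε) (T + ε), differential G (B.curve b t) = 0 → t ∈ B.window b := by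
    intro t ht h0
    rw [hwin]
    constructor
    · by_contra! hlt
      exact hsm t (abs_lt.2 ⟨ht.1, by linarith⟩) h0
    · by_contra! hge
      refine hsm (t - T) (abs_lt.2 ⟨by linarith, by linarith [ht.2]⟩) ?_
      rw [← hper, sub_add_cancel]
      exact h0
  have key : ∀ t ∈ Ioo (-ε) (T + ε), differential G (B.curve b t) ≠ 0 →
      lab (B.curve b t) + B.partialInc (fun q => inc q) b t = lab (B.curve b 0) := by
    intro t ht htd
    rw [hc.add_partialInc_eq hn hs b isOpen_Ioo isPreconnected_Ioo hUw ht htd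
      (t' := 0) ⟨by linarith, by linarith⟩ (B.base_smooth b),
      BranchSystem.partialInc_of_forall_le _ _ fun x hx => ?_, add_zero]
    have h1 := x.2.1
    rw [show x.1.1 = b from hx, hwin] at h1
    exact h1.1
  constructor
  · have hTd : differential G (B.curve b T) ≠ 0 := by
      have := hper 0
      rw [zero_add] at this
      rw [this]
      exact B.base_smooth b
    have h1 := key T ⟨by linarith, by linarith⟩ hTd
    have h2 := hper 0
    rw [zero_add] at h2
    rw [h2, BranchSystem.partialInc_of_forall_lt _ _ fun x hx => ?_] at h1
    · simpa using h1
    · have h1 := x.2.1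
      rw [show x.1.1 = b from hx, hwin] at h1
      exact h1.2
  · intro t ht htd
    rw [hwin] at ht
    have h1 := key t ⟨by linarith, by linarith⟩ htd
    rw [← h1, add_assoc, CharTwo.add_self_eq_zero, add_zero]

/-- On a branch that goes to infinity, a cycle with bounded support is determined by its increments,
and these sum to zero. -/
lemma IsCycle.eq_of_line (hn : IsNodal G) (hs : (realSingularPoints G).Finite)
    {lab inc : Plane → ZMod 2} (hc : IsCycle G lab inc) {b : B.Branch} (hb : B.period b = 0)
    {R : ℝ} (hR : ∀ p, R < ‖p‖ → MvPolynomial.eval p G = 0 → differential G p ≠ 0 ∧ lab p = 0) :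
    B.totalInc (fun q => inc q) b = 0 ∧ ∀ t ∈ B.window b, differential G (B.curve b t) ≠ 0 →
      lab (B.curve b t) = B.partialInc (fun q => inc q) b t := by
  obtain ⟨M, hM⟩ := (Metric.isBounded_iff_subset_closedBall 0).1
    ((B.isUnitCurve b).isBounded_preimage hn hs (fun a ha => by
      obtain ⟨n, rfl⟩ := (B.mem_periods b a).1 ha
      rw [hb, mul_zero]) R)
  have hfar : ∀ t, M < |t| → R < ‖B.curve b t‖ := by
    intro t ht
    by_contra! hle
    have := hM hle
    rw [Metric.mem_closedBall, dist_zero_right, Real.norm_eq_abs] at this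
    linarith
  have htime : ∀ x : B.NodeParam, x.branch = b → |x.time| ≤ M := by
    intro x hx
    by_contra! hlt
    have h1 := (hR _ (hfar _ hlt) (B.isUnitCurve b _).mem).1
    have h2 := x.2.2
    rw [show x.1.1 = b from hx] at h2
    exact h1 h2
  -- all nodes lie between the parameters `-N` and `N`, where the label vanishes
  set N := |M| + 1 with hN
  have hN1 : M < |-N| := by
    rw [abs_neg, abs_of_pos (by positivity)]
    linarith [le_abs_self M]
  have hN2 : M < |N| := by rwa [abs_neg] at hN1
  have hb1 := hR _ (hfar _ hN1) (B.isUnitCurve b _).mem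
  have hb2 := hR _ (hfar _ hN2) (B.isUnitCurve b _).mem
  have key : ∀ t, differential G (B.curve b t) ≠ 0 →
      lab (B.curve b t) + B.partialInc (fun q => inc q) b t = 0 := by
    intro t htd
    rw [hc.add_partialInc_eq hn hs b isOpen_univ isPreconnected_univ
      (fun _ _ _ => Or.inl hb) (mem_univ t) htd (mem_univ (-N)) hb1.1, hb1.2,
      BranchSystem.partialInc_of_forall_le _ _ fun x hx => ?_, add_zero]
    have := (abs_le.1 (htime x hx)).1
    linarith [le_abs_self M]
  constructor
  · have h1 := key N hb2.1
    rwa [hb2.2, zero_add, BranchSystem.partialInc_of_forall_lt _ _ fun x hx => ?_] at h1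
    have := (abs_le.1 (htime x hx)).2
    linarith [le_abs_self M]
  · intro t _ htd
    have h1 := key t htd
    exact CharTwo.add_eq_zero.1 h1

/-- Increments at the nodes whose sum over each branch is zero are the increments of a cycle, with
prescribed labels at the base points of the branches. -/
lemma BranchSystem.exists_isCycle_of_totalInc (hn : IsNodal G) (hs : (realSingularPoints G).Finite)
    (d : realSingularPoints G → ZMod 2) (hd : ∀ b, B.totalInc d b = 0) (k : B.Branch → ZMod 2) :
    ∃ lab inc, IsCycle G lab inc ∧ (∀ q : realSingularPoints G, inc q = d q) ∧
      ∀ b, ∀ t ∈ B.window b, differential G (B.curve b t) ≠ 0 →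
        lab (B.curve b t) = k b + B.partialInc d b t := by
  classical
  -- define the label by the partial sums; a smooth point has only one parameter
  have hlab : ∀ p, ∃ l, differential G p ≠ 0 → ∀ x ∈ B.params p, l = k x.1 + B.partialInc d x.1 x.2 := by
    intro p
    by_cases h : differential G p ≠ 0 ∧ ∃ x, x ∈ B.params p
    · obtain ⟨h1, x, hx⟩ := h
      refine ⟨k x.1 + B.partialInc d x.1 x.2, fun _ y hy => ?_⟩
      rw [B.params_of_smooth hn h1 hx hy]
    · exact ⟨0, fun h1 x hx => absurd ⟨h1, x, hx⟩ h⟩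
  choose lab hlab using hlab
  have hwin : ∀ b, ∀ t ∈ B.window b, differential G (B.curve b t) ≠ 0 →
      lab (B.curve b t) = k b + B.partialInc d b t :=
    fun b t ht h => hlab _ h (b, t) ⟨ht, rfl⟩
  have hright : ∀ b, ∀ t ∈ B.window b, ∀ᶠ s in 𝓝[>] t,
      lab (B.curve b s) = k b + B.partialInc d b t + localInc d (B.curve b t) := by
    intro b t ht
    have h1 : ∀ᶠ s in 𝓝[>] t, s ∈ B.window b := by
      rcases ht with h0 | ht
      · exact Eventually.of_forall fun s => Or.inl h0
      · filter_upwards [(eventually_lt_nhds ht.2).filter_mono nhdsWithin_le_nhds,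
          self_mem_nhdsWithin] with s h1 h2
        exact Or.inr ⟨ht.1.trans (le_of_lt h2), h1⟩
    filter_upwards [h1, partialInc_eventually_right d b (fun _ => ht),
      nhdsWithin_mono t (fun x hx => ne_of_gt hx) (B.eventually_smooth_curve hs b t)] with s e1 e2 e3
    rw [hwin b s e1 e3, e2, add_assoc]
  have hleft : ∀ b, ∀ t ∈ B.window b, ∀ᶠ s in 𝓝[<] t,
      lab (B.curve b s) = k b + B.partialInc d b t := by
    intro b t ht
    have hsm : ∀ᶠ s in 𝓝[<] t, differential G (B.curve b s) ≠ 0 :=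
      nhdsWithin_mono t (fun x hx => ne_of_lt hx) (B.eventually_smooth_curve hs b t)
    by_cases h1 : ∀ᶠ s in 𝓝[<] t, s ∈ B.window b
    · filter_upwards [h1, partialInc_eventually_left d b t, hsm] with s e1 e2 e3
      rw [hwin b s e1 e3, e2]
    -- just before the base point of a closed branch, all increments have been added up
    · rcases ht with h0 | ht
      · exact absurd (Eventually.of_forall fun s => Or.inl h0) h1
      have hpos : 0 < B.period b := ht.1.trans_lt ht.2
      have ht0 : t = 0 := by
        by_contra hne
        apply h1
        filter_upwards [(eventually_gt_nhds (lt_of_le_of_ne ht.1 (Ne.symm hne))).filter_mono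
          nhdsWithin_le_nhds, self_mem_nhdsWithin] with s h2 h3
        exact Or.inr ⟨h2.le, lt_trans h3 ht.2⟩
      subst ht0
      have hx : ∀ x : B.NodeParam, x.branch = b → 0 ≤ x.time ∧ x.time < B.period b := by
        intro x hx
        have := x.2.1
        rw [show x.1.1 = b from hx] at this
        exact this.resolve_left hpos.ne'
      have hlast : ∀ᶠ s in 𝓝[<] (0 : ℝ), ∀ x : B.NodeParam, x.branch = b →
          x.time < s + B.period b := by
        refine eventually_all.2 fun x => ?_
        by_cases hxb : x.branch = b
        · filter_upwards [(eventually_gt_nhds (a := (0 : ℝ)) (b := x.time - B.period b)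
            (by linarith [(hx x hxb).2])).filter_mono nhdsWithin_le_nhds] with s h2 _
          linarith
        · exact Eventually.of_forall fun s h => absurd h hxb
      filter_upwards [hlast, hsm, self_mem_nhdsWithin,
        (eventually_gt_nhds (a := (0 : ℝ)) (b := -B.period b)
          (by linarith)).filter_mono nhdsWithin_le_nhds] with s e1 e2 e3 e4
      rw [mem_Iio] at e3
      have e5 : B.curve b (s + B.period b) = B.curve b s := by simpa using B.add_period b 1 s
      rw [← e5] at e2 ⊢
      rw [hwin b _ (Or.inr ⟨by linarith, by linarith⟩) e2,
        partialInc_of_forall_lt d b e1, hd, partialInc_of_forall_le d b fun x h => (hx x h).1]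
  refine ⟨lab, localInc d, ⟨fun q v hv hq => ?_, fun q v hv hq => ?_⟩, fun q => ?_, hwin⟩
  · obtain ⟨⟨b, t⟩, ⟨ht, rfl⟩, hx⟩ := B.exists_mem_params hv
    simp only [vel] at ht hv hq hx ⊢
    have h0 : localInc d (B.curve b t) = 0 := by
      rw [localInc, dif_neg fun h => hq (differential_eq_zero_iff.2 h.2)]
    have key : ∀ᶠ s in 𝓝 t, lab (B.curve b s) = lab (B.curve b t) := by
      rw [hwin b t ht hq]
      have : ∀ᶠ s in 𝓝[≠] t, lab (B.curve b s) = k b + B.partialInc d b t := by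
        rw [← Iio_union_Ioi, nhdsWithin_union, eventually_sup]
        exact ⟨hleft b t ht, (hright b t ht).mono fun s e => by rw [e, h0, add_zero]⟩
      rw [eventually_nhdsWithin_iff] at this
      filter_upwards [this] with s e
      by_cases hst : s = t
      · rw [hst, hwin b t ht hq]
      · exact e hst
    rcases hx with hx | hx
    · rw [← hx]
      filter_upwards [(tendsto_add_const_nhds_zero t).eventually key] with s e
      rw [B.flowCurve_eq hn hs, e]
    · rw [← neg_eq_iff_eq_neg.2 hx]
      have hlim : Tendsto (fun s : ℝ => -s + t) (𝓝 0) (𝓝 t) := by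
        have : Continuous fun s : ℝ => -s + t := by fun_prop
        simpa using this.tendsto 0
      filter_upwards [hlim.eventually key] with s e
      rw [B.flowCurve_neg_eq hn hs, e]
  · obtain ⟨⟨b, t⟩, ⟨ht, rfl⟩, hx⟩ := B.exists_mem_params hv
    simp only [vel] at ht hv hq hx ⊢
    have hR : ∀ᶠ s in 𝓝[>] (0 : ℝ), lab (flowCurve G (B.curve b t) (deriv (B.curve b) t) s) =
        k b + B.partialInc d b t + localInc d (B.curve b t) := by
      have hlim : Tendsto (fun s : ℝ => s + t) (𝓝[>] 0) (𝓝[>] t) := by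
        refine tendsto_nhdsWithin_iff.2
          ⟨(tendsto_add_const_nhds_zero t).mono_left nhdsWithin_le_nhds, ?_⟩
        filter_upwards [self_mem_nhdsWithin] with s h1
        rw [mem_Ioi] at h1 ⊢
        linarith
      filter_upwards [hlim.eventually (hright b t ht)] with s e
      rw [B.flowCurve_eq hn hs, e]
    have hL : ∀ᶠ s in 𝓝[>] (0 : ℝ), lab (flowCurve G (B.curve b t) (-deriv (B.curve b) t) s) =
        k b + B.partialInc d b t := by
      have hlim : Tendsto (fun s : ℝ => -s + t) (𝓝[>] 0) (𝓝[<] t) := by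
        refine tendsto_nhdsWithin_iff.2 ⟨?_, ?_⟩
        · have : Continuous fun s : ℝ => -s + t := by fun_prop
          simpa using (this.tendsto 0).mono_left nhdsWithin_le_nhds
        · filter_upwards [self_mem_nhdsWithin] with s h1
          rw [mem_Ioi] at h1
          rw [mem_Iio]
          linarith
      filter_upwards [hlim.eventually (hleft b t ht)] with s e
      rw [B.flowCurve_neg_eq hn hs, e]
    rcases hx with hx | hx
    · rw [← hx]
      refine ⟨_, hR, hL.mono fun s e => ?_⟩
      rw [e, add_assoc, CharTwo.add_self_eq_zero, add_zero]
    · rw [← neg_eq_iff_eq_neg.2 hx, neg_neg]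
      exact ⟨_, hL, hR⟩
  · rw [localInc, dif_pos q.2]

end

end PlaneCurve

end

noncomputable section

namespace PlaneCurve

variable {G : MvPolynomial (Fin 2) ℝ}

/-! ### Functions with bounded support and cycles -/

/-- The functions with values modulo two that are locally constant off the curve, vanish on it, and
have bounded support. -/
def boundedFunctions (G : MvPolynomial (Fin 2) ℝ) : Set (Plane → ZMod 2) :=
  {f | (∀ y, MvPolynomial.eval y G ≠ 0 → ∀ᶠ y' in 𝓝 y, f y' = f y) ∧
    (∀ y, MvPolynomial.eval y G = 0 → f y = 0) ∧ ∃ R, ∀ y, R < ‖y‖ → f y = 0}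

lemma isPreconnected_norm_gt {R : ℝ} (hR : 0 ≤ R) : IsPreconnected {y : Plane | R < ‖y‖} := by
  have h0 : IsPreconnected ({0}ᶜ : Set Plane) := by
    refine (isConnected_compl_singleton_of_one_lt_rank ?_ 0).isPreconnected
    rw [rank_fin_fun]
    norm_num
  -- the exterior of the ball is the image of the punctured plane under a radial map
  have h1 : {y : Plane | R < ‖y‖} = (fun y : Plane => (1 + R / ‖y‖) • y) '' ({0}ᶜ : Set Plane) := by
    ext y
    simp only [mem_ofPred_eq, mem_image, mem_compl_iff, mem_singleton_iff]
    constructor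
    · intro hy
      have hy0 : 0 < ‖y‖ := hR.trans_lt hy
      have hc : 0 < 1 - R / ‖y‖ := by
        rw [sub_pos, div_lt_one hy0]
        exact hy
      refine ⟨(1 - R / ‖y‖) • y, smul_ne_zero hc.ne' (norm_pos_iff.1 hy0), ?_⟩
      rw [norm_smul, Real.norm_eq_abs, abs_of_pos hc, smul_smul]
      have : (1 + R / ((1 - R / ‖y‖) * ‖y‖)) * (1 - R / ‖y‖) = 1 := by
        have h2 : ‖y‖ - R ≠ 0 := by linarith
        have h3 : (1 - R / ‖y‖) * ‖y‖ = ‖y‖ - R := by field_simp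
        rw [h3]
        field_simp
        ring
      rw [this, one_smul]
    · rintro ⟨x, hx, rfl⟩
      have hx0 : 0 < ‖x‖ := norm_pos_iff.2 hx
      rw [norm_smul, Real.norm_eq_abs, abs_of_pos (by positivity), add_mul, one_mul,
        div_mul_cancel₀ _ hx0.ne']
      linarith
  rw [h1]
  refine h0.image _ fun x hx => ContinuousAt.continuousWithinAt ?_
  have hx0 : ‖x‖ ≠ 0 := norm_ne_zero_iff.2 hx
  fun_prop (disch := assumption)

lemma exists_norm_smooth (hs : (realSingularPoints G).Finite) :
    ∃ R, 0 ≤ R ∧ ∀ p : Plane, R < ‖p‖ → MvPolynomial.eval p G = 0 → differential G p ≠ 0 := by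
  obtain ⟨R, hR⟩ := isBounded_iff_forall_norm_le.1 hs.isBounded
  refine ⟨max R 0, le_max_right _ _, fun p hp h0 hd => ?_⟩
  have := hR p ⟨h0, differential_eq_zero_iff.1 hd⟩
  exact absurd (this.trans (le_max_left _ _)) (not_le.2 hp)

lemma IsBoundary.lab_eq_zero (hs : (realSingularPoints G).Finite) {f lab : Plane → ZMod 2}
    (hf : f ∈ boundedFunctions G) (h : IsBoundary G f lab) :
    ∃ R, ∀ p, R < ‖p‖ → MvPolynomial.eval p G = 0 → differential G p ≠ 0 ∧ lab p = 0 := by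
  obtain ⟨R₁, -, hR₁⟩ := exists_norm_smooth hs
  obtain ⟨R₂, hR₂⟩ := hf.2.2
  refine ⟨max R₁ R₂, fun p hp h0 => ?_⟩
  have hd := hR₁ p ((le_max_left _ _).trans_lt hp) h0
  refine ⟨hd, (h.jump p h0 hd).unique h0 hd ⟨0, ?_⟩⟩
  have h1 : ∀ᶠ y : Plane in 𝓝 p, R₂ < ‖y‖ :=
    continuous_norm.continuousAt.eventually_const_lt ((le_max_right _ _).trans_lt hp)
  filter_upwards [h1] with y hy _
  rw [hR₂ y hy]
  simp

/-- The increments of a cycle are determined by its labels. -/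
lemma IsCycle.inc_eq (hn : IsNodal G) (hs : (realSingularPoints G).Finite)
    {lab inc lab' inc' : Plane → ZMod 2} (h : IsCycle G lab inc) (h' : IsCycle G lab' inc')
    (he : ∀ p, MvPolynomial.eval p G = 0 → differential G p ≠ 0 → lab p = lab' p)
    (q : realSingularPoints G) : inc q = inc' q := by
  have hd := differential_eq_zero_iff.2 q.2.2
  obtain ⟨v, hv⟩ := exists_isTangent hn q.2.1
  obtain ⟨c, h1, h2⟩ := h.node q v hv hd
  obtain ⟨c', h1', h2'⟩ := h'.node q v hv hd
  have key : ∀ u, IsTangent G (q : Plane) u → ∀ᶠ s in 𝓝[>] 0,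
      lab (flowCurve G q u s) = lab' (flowCurve G q u s) := by
    intro u hu
    filter_upwards [nhdsWithin_mono 0 (fun x hx => ne_of_gt hx)
      (eventually_flowCurve_smooth hn hs hu)] with s hsm
    exact he _ ((flowCurve_spec hn hs hu).1 s).mem hsm
  obtain ⟨s, e1, e2, e3⟩ := (h1.and (h1'.and (key v hv))).exists
  obtain ⟨s', e1', e2', e3'⟩ := (h2.and (h2'.and (key (-v) hv.neg))).exists
  have hcc : c = c' := by rw [← e1, ← e2, e3]
  have := e1'.symm.trans (e3'.trans e2')
  rw [hcc] at this
  exact add_left_cancel this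

section

variable (B : BranchSystem G)

/-- The closed branches. -/
abbrev BranchSystem.Circle : Type := {b : B.Branch // B.period b ≠ 0}

/-- The boundary of a function with bounded support, expressed by its increments at the nodes and
its labels at the base points of the closed branches. -/
def BranchSystem.HasData (f : Plane → ZMod 2)
    (x : (realSingularPoints G → ZMod 2) × (B.Circle → ZMod 2)) : Prop :=
  ∃ lab inc, IsCycle G lab inc ∧ IsBoundary G f lab ∧ (∀ q : realSingularPoints G, inc q = x.1 q) ∧
    ∀ c : B.Circle, lab (B.curve c.1 0) = x.2 c

variable {B}

lemma BranchSystem.HasData.unique (hn : IsNodal G) (hs : (realSingularPoints G).Finite)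
    {f : Plane → ZMod 2}
    {x y : (realSingularPoints G → ZMod 2) × (B.Circle → ZMod 2)}
    (h : B.HasData f x) (h' : B.HasData f y) : x = y := by
  obtain ⟨lab, inc, hc, hb, hi, hk⟩ := h
  obtain ⟨lab', inc', hc', hb', hi', hk'⟩ := h'
  have he : ∀ p, MvPolynomial.eval p G = 0 → differential G p ≠ 0 → lab p = lab' p :=
    fun p hp hd => (hb.jump p hp hd).unique hp hd (hb'.jump p hp hd)
  refine Prod.ext (funext fun q => ?_) (funext fun c => ?_)
  · rw [← hi, ← hi', hc.inc_eq hn hs hc' he]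
  · rw [← hk, ← hk', he _ (B.isUnitCurve _ 0).mem (B.base_smooth c.1)]

/-- Increments at the nodes with sum zero on each branch, and labels of the closed branches. -/
def BranchSystem.cycleData (B : BranchSystem G) [Fintype B.NodeParam] :
    Set ((realSingularPoints G → ZMod 2) × (B.Circle → ZMod 2)) :=
  {x | ∀ b, B.totalInc x.1 b = 0}

variable [Fintype B.NodeParam]

lemma BranchSystem.exists_hasData (hn : IsNodal G) (hs : (realSingularPoints G).Finite)
    {f : Plane → ZMod 2} (hf : f ∈ boundedFunctions G) : ∃ x ∈ B.cycleData, B.HasData f x := by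
  obtain ⟨lab, inc, hc, hb⟩ := exists_isCycle hn hs hf.1
  obtain ⟨R, hR⟩ := hb.lab_eq_zero hs hf
  refine ⟨(fun q => inc q, fun c => lab (B.curve c.1 0)), fun b => ?_,
    lab, inc, hc, hb, fun _ => rfl, fun _ => rfl⟩
  by_cases h : B.period b = 0
  · exact (hc.eq_of_line hn hs h hR).1
  · exact (hc.eq_of_circle hn hs h).1

/-- The label of a cycle at a smooth point, in terms of its data. -/
lemma IsCycle.lab_eq (hn : IsNodal G) (hs : (realSingularPoints G).Finite)
    {lab inc lab' inc' : Plane → ZMod 2} (h : IsCycle G lab inc) (h' : IsCycle G lab' inc')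
    {R R' : ℝ} (hR : ∀ p, R < ‖p‖ → MvPolynomial.eval p G = 0 → differential G p ≠ 0 ∧ lab p = 0)
    (hR' : ∀ p, R' < ‖p‖ → MvPolynomial.eval p G = 0 → differential G p ≠ 0 ∧ lab' p = 0)
    (hi : ∀ q : realSingularPoints G, inc q = inc' q)
    (hk : ∀ c : B.Circle, lab (B.curve c.1 0) = lab' (B.curve c.1 0)) {p : Plane}
    (hp : MvPolynomial.eval p G = 0) (hd : differential G p ≠ 0) : lab p = lab' p := by
  obtain ⟨v, hv⟩ := exists_isTangent hn hp
  obtain ⟨⟨b, t⟩, ⟨ht, rfl⟩, -⟩ := B.exists_mem_params hv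
  have hi' : (fun q : realSingularPoints G => inc q) = fun q : realSingularPoints G => inc' q :=
    funext hi
  by_cases hb : B.period b = 0
  · rw [(h.eq_of_line hn hs hb hR).2 t ht hd, (h'.eq_of_line hn hs hb hR').2 t ht hd, hi']
  · rw [(h.eq_of_circle hn hs hb).2 t ht hd, (h'.eq_of_circle hn hs hb).2 t ht hd, hi',
      hk ⟨b, hb⟩]

/-- The data determine the jumps, the jumps determine the function up to a constant, and the constant is
zero because the support is bounded. -/
lemma BranchSystem.HasData.injective (hn : IsNodal G) (hs : (realSingularPoints G).Finite)
    {f f' : Plane → ZMod 2} (hf : f ∈ boundedFunctions G) (hf' : f' ∈ boundedFunctions G)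
    {x : (realSingularPoints G → ZMod 2) × (B.Circle → ZMod 2)}
    (h : B.HasData f x) (h' : B.HasData f' x) : f = f' := by
  obtain ⟨lab, inc, hc, hb, hi, hk⟩ := h
  obtain ⟨lab', inc', hc', hb', hi', hk'⟩ := h'
  obtain ⟨R, hR⟩ := hb.lab_eq_zero hs hf
  obtain ⟨R', hR'⟩ := hb'.lab_eq_zero hs hf'
  have hlab : ∀ p, MvPolynomial.eval p G = 0 → differential G p ≠ 0 → lab p = lab' p :=
    fun p hp hd => hc.lab_eq (B := B) hn hs hc' hR hR' (fun q => by rw [hi, hi'])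
      (fun c => by rw [hk, hk']) hp hd
  have hb'' : IsBoundary G f' lab := ⟨hb'.locally_const, fun p hp hd => by
    rw [hlab p hp hd]; exact hb'.jump p hp hd⟩
  obtain ⟨r, hr⟩ := hf.2.2
  obtain ⟨r', hr'⟩ := hf'.2.2
  obtain ⟨z, hz, hz0⟩ : ∃ z, MvPolynomial.eval z G ≠ 0 ∧ max r r' < ‖z‖ := by
    obtain ⟨z, hz0, hz⟩ := (dense_compl_realZeroSet hn).exists_mem_open
      (isOpen_lt continuous_const continuous_norm : IsOpen {y : Plane | max r r' < ‖y‖})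
      (by obtain ⟨y, hy⟩ := NormedSpace.exists_lt_norm ℝ Plane (max r r'); exact ⟨y, hy⟩)
    exact ⟨z, hz0, hz⟩
  funext y
  by_cases hy : MvPolynomial.eval y G = 0
  · rw [hf.2.1 y hy, hf'.2.1 y hy]
  · have := hb.sub_eq hn hs hb'' hy hz
    rw [hr z ((le_max_left _ _).trans_lt hz0), hr' z ((le_max_right _ _).trans_lt hz0), sub_zero,
      sub_eq_zero] at this
    exact this.symm

/-- All data with sum zero on each branch occur: the cycle is a boundary, and normalizing its primitive
at infinity makes the support bounded. -/
lemma BranchSystem.exists_of_cycleData (hn : IsNodal G) (hs : (realSingularPoints G).Finite)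
    {x : (realSingularPoints G → ZMod 2) × (B.Circle → ZMod 2)} (hx : x ∈ B.cycleData) :
    ∃ f ∈ boundedFunctions G, B.HasData f x := by
  classical
  have := B.finite
  obtain ⟨lab, inc, hc, hi, hlab⟩ := B.exists_isCycle_of_totalInc hn hs x.1 hx
    (fun b => if h : B.period b ≠ 0 then x.2 ⟨b, h⟩ else 0)
  obtain ⟨f, hf⟩ := hc.exists_isBoundary hn hs
  obtain ⟨R₀, hR₀, hR₀s⟩ := exists_norm_smooth hs
  -- the labels vanish far away: on an unbounded branch, before and after all of its nodes
  have hbr : ∀ b, ∃ R, ∀ t ∈ B.window b, R < ‖B.curve b t‖ →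
      differential G (B.curve b t) ≠ 0 → lab (B.curve b t) = 0 := by
    intro b
    by_cases hb : B.period b = 0
    · obtain ⟨M, hM⟩ : ∃ M, ∀ y : B.NodeParam, |y.time| ≤ M := by
        obtain ⟨M, hM⟩ := (Set.finite_range fun y : B.NodeParam => |y.time|).bddAbove
        exact ⟨M, fun y => hM ⟨y, rfl⟩⟩
      obtain ⟨C, hC⟩ := isBounded_iff_forall_norm_le.1
        (((isCompact_Icc (a := -M) (b := M)).image (B.isUnitCurve b).continuous).isBounded)
      refine ⟨C, fun t ht hCt hd => ?_⟩
      have htM : t < -M ∨ M < t := by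
        by_contra! hcon
        exact absurd (hC _ ⟨t, ⟨hcon.1, hcon.2⟩, rfl⟩) (not_le.2 hCt)
      rw [hlab b t ht hd, dif_neg (not_not.2 hb), zero_add]
      rcases htM with h | h
      · exact BranchSystem.partialInc_of_forall_le _ _ fun y _ => by
          linarith [(abs_le.1 (hM y)).1]
      · rw [BranchSystem.partialInc_of_forall_lt _ _ fun y _ => by linarith [(abs_le.1 (hM y)).2]]
        exact hx b
    · obtain ⟨C, hC⟩ := isBounded_iff_forall_norm_le.1
        (((isCompact_Icc (a := 0) (b := B.period b)).image (B.isUnitCurve b).continuous).isBounded)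
      refine ⟨C, fun t ht hCt hd => ?_⟩
      have ht' := ht.resolve_left hb
      exact absurd (hC _ ⟨t, ⟨ht'.1, ht'.2.le⟩, rfl⟩) (not_le.2 hCt)
  choose R hR using hbr
  obtain ⟨R₁, hR₁⟩ := (Set.finite_range R).bddAbove
  set r := max R₀ R₁ with hr
  have hfar : ∀ p, r < ‖p‖ → MvPolynomial.eval p G = 0 → differential G p ≠ 0 ∧ lab p = 0 := by
    intro p hp h0
    have hd := hR₀s p ((le_max_left _ _).trans_lt hp) h0
    refine ⟨hd, ?_⟩
    obtain ⟨v, hv⟩ := exists_isTangent hn h0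
    obtain ⟨⟨b, t⟩, ⟨ht, rfl⟩, -⟩ := B.exists_mem_params hv
    exact hR b t ht (((hR₁ ⟨b, rfl⟩).trans (le_max_right _ _)).trans_lt hp) hd
  obtain ⟨z, hz0, hz⟩ : ∃ z, z ∈ (realZeroSet G)ᶜ ∧ r < ‖z‖ := by
    obtain ⟨z, hz0, hz⟩ := (dense_compl_realZeroSet hn).exists_mem_open
      (isOpen_lt continuous_const continuous_norm : IsOpen {y : Plane | r < ‖y‖})
      (by obtain ⟨y, hy⟩ := NormedSpace.exists_lt_norm ℝ Plane r; exact ⟨y, hy⟩)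
    exact ⟨z, hz0, hz⟩
  -- so the function is constant far away; subtract this constant
  have hconst : ∀ y, MvPolynomial.eval y G ≠ 0 → r < ‖y‖ → f y = f z := by
    intro y hy hry
    refine eq_of_eventually_const (dense_compl_realZeroSet hn)
      (isOpen_lt continuous_const continuous_norm)
      (isPreconnected_norm_gt (hR₀.trans (le_max_left _ _))) (fun q hq => ?_) ⟨hry, hy⟩ ⟨hz, hz0⟩
    by_cases h0 : MvPolynomial.eval q G = 0
    · obtain ⟨hd, hl⟩ := hfar q hq h0
      obtain ⟨b, hb⟩ := hf.jump q h0 hd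
      refine ⟨b, eventually_nhdsWithin_iff.2 ?_⟩
      filter_upwards [hb] with y h1 h2
      rw [h1 h2, hl]
      simp
    · exact ⟨f q, nhdsWithin_le_nhds (hf.locally_const q h0)⟩
  set F : Plane → ZMod 2 := fun y => if MvPolynomial.eval y G = 0 then 0 else f y - f z with hF
  have hFloc : ∀ y, MvPolynomial.eval y G ≠ 0 → ∀ᶠ y' in 𝓝 y, F y' = F y := by
    intro y hy
    filter_upwards [hf.locally_const y hy, (isOpen_compl_realZeroSet G).mem_nhds hy] with w h1 h2
    simp only [hF]
    rw [if_neg hy, if_neg (mem_compl_realZeroSet.1 h2), h1]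
  refine ⟨F, ⟨hFloc, fun y hy => if_pos hy, r, fun y hy => ?_⟩, lab, inc, hc, ⟨hFloc, ?_⟩, hi, ?_⟩
  · simp only [hF]
    split_ifs with h0
    · rfl
    · rw [hconst y h0 hy, sub_self]
  · intro p hp hd
    obtain ⟨b, hb⟩ := hf.jump p hp hd
    refine ⟨b - f z, ?_⟩
    filter_upwards [hb] with y h1 h2
    simp only [hF]
    rw [if_neg h2, h1 h2]
    ring
  · intro c
    have hpos : 0 < B.period c.1 := lt_of_le_of_ne (B.period_nonneg _) (Ne.symm c.2)
    rw [hlab c.1 0 (Or.inr ⟨le_rfl, hpos⟩) (B.base_smooth _), dif_pos c.2,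
      BranchSystem.partialInc_of_forall_le _ _ fun y hy => ?_, add_zero]
    have := y.2.1
    rw [show y.1.1 = c.1 from hy] at this
    exact (this.resolve_left c.2).1

/-- Functions with bounded support correspond to cycles. -/
theorem BranchSystem.card_boundedFunctions (hn : IsNodal G) (hs : (realSingularPoints G).Finite) :
    Nat.card (boundedFunctions G) = Nat.card B.cycleData := by
  choose! Φ hΦ hΦd using fun f (hf : f ∈ boundedFunctions G) =>
    BranchSystem.exists_hasData (B := B) hn hs hf
  refine Nat.card_congr (Equiv.ofBijective
    (fun f : boundedFunctions G => (⟨Φ f, hΦ f f.2⟩ : B.cycleData)) ⟨?_, ?_⟩)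
  · intro f f' h
    refine Subtype.ext (BranchSystem.HasData.injective (B := B) hn hs f.2 f'.2 (hΦd f f.2) ?_)
    rw [show Φ f = Φ f' from congrArg Subtype.val h]
    exact hΦd f' f'.2
  · rintro ⟨x, hx⟩
    obtain ⟨f, hf, hfx⟩ := BranchSystem.exists_of_cycleData hn hs hx
    exact ⟨⟨f, hf⟩, Subtype.ext ((hΦd f hf).unique hn hs hfx)⟩

end

end PlaneCurve

end

noncomputable section

namespace PlaneCurve

variable {G : MvPolynomial (Fin 2) ℝ}

/-! ### Components of the complement of the curve -/

/-- The bounded components of the complement of the curve. -/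
def boundedComponents (G : MvPolynomial (Fin 2) ℝ) : Set (Set Plane) :=
  {C | (∃ q ∈ (realZeroSet G)ᶜ, C = connectedComponentIn (realZeroSet G)ᶜ q) ∧
    Bornology.IsBounded C}

lemma mem_realZeroSet_of_mem_frontier {q y : Plane}
    (hy : y ∈ frontier (connectedComponentIn (realZeroSet G)ᶜ q)) : y ∈ realZeroSet G := by
  by_contra hyV
  have hopen := (isOpen_compl_realZeroSet G).connectedComponentIn (x := q)
  rw [hopen.frontier_eq] at hy
  have hyo := (isOpen_compl_realZeroSet G).connectedComponentIn (x := y)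
  obtain ⟨z, hz1, hz2⟩ := mem_closure_iff.1 hy.1 _ hyo (mem_connectedComponentIn hyV)
  apply hy.2
  rw [connectedComponentIn_eq hz2, ← connectedComponentIn_eq hz1]
  exact mem_connectedComponentIn hyV

/-- A bounded component of the complement contains a critical point, where `|G|` is largest. -/
lemma exists_criticalPoint_of_isBounded {q : Plane} (hq : q ∈ (realZeroSet G)ᶜ)
    (hb : Bornology.IsBounded (connectedComponentIn (realZeroSet G)ᶜ q)) :
    ∃ c ∈ connectedComponentIn (realZeroSet G)ᶜ q, toComplex c ∈ criticalPoints G := by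
  set C := connectedComponentIn (realZeroSet G)ᶜ q with hC
  have hopen : IsOpen C := (isOpen_compl_realZeroSet G).connectedComponentIn
  have hqC : q ∈ C := mem_connectedComponentIn hq
  obtain ⟨x, hx, hmax⟩ := hb.isCompact_closure.exists_isMaxOn ⟨q, subset_closure hqC⟩
    (continuous_eval (G * G)).continuousOn
  have hqpos : 0 < MvPolynomial.eval q (G * G) := by
    rw [map_mul]
    exact mul_self_pos.2 hq
  have hxpos : 0 < MvPolynomial.eval x (G * G) := hqpos.trans_le (hmax (subset_closure hqC))
  have hx0 : MvPolynomial.eval x G ≠ 0 := by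
    intro h0
    rw [map_mul, h0, mul_zero] at hxpos
    exact lt_irrefl _ hxpos
  have hxC : x ∈ C := by
    by_contra hxC
    apply hx0
    refine mem_realZeroSet_of_mem_frontier (q := q) ?_
    rw [← hC, hopen.frontier_eq]
    exact ⟨hx, hxC⟩
  have hloc : IsLocalMax (fun y => MvPolynomial.eval y (G * G)) x := by
    filter_upwards [hopen.mem_nhds hxC] with y hy
    exact hmax (subset_closure hy)
  have hd := hloc.hasFDerivAt_eq_zero (hasFDerivAt_eval (G * G) x)
  rw [differential_eq_zero_iff] at hd
  refine ⟨x, hxC, toComplex_mem_criticalPoints.2 fun i => ?_⟩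
  have := hd i
  rw [MvPolynomial.pderiv_mul, map_add, map_mul, map_mul] at this
  have h2 : MvPolynomial.eval x G * MvPolynomial.eval x (MvPolynomial.pderiv i G) = 0 := by linarith
  exact (mul_eq_zero.1 h2).resolve_left hx0

lemma finite_boundedComponents (hfin : (criticalPoints G).Finite) :
    (boundedComponents G).Finite := by
  have h1 : (toComplex ⁻¹' criticalPoints G).Finite := hfin.preimage toComplex_injective.injOn
  refine (h1.image fun c => connectedComponentIn (realZeroSet G)ᶜ c).subset ?_
  rintro C ⟨⟨q, hq, rfl⟩, hb⟩
  obtain ⟨c, hc, hcc⟩ := exists_criticalPoint_of_isBounded hq hb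
  exact ⟨c, hcc, (connectedComponentIn_eq hc).symm⟩

/-- A function with bounded support, locally constant off the curve, is an arbitrary choice of a
value on each bounded component. -/
theorem card_boundedFunctions (hfin : (criticalPoints G).Finite) :
    Nat.card (boundedFunctions G) = 2 ^ (boundedComponents G).ncard := by
  classical
  have hfb := finite_boundedComponents hfin
  have := hfb.to_subtype
  have hconst : ∀ f ∈ boundedFunctions G, ∀ q ∈ (realZeroSet G)ᶜ,
      ∀ y ∈ connectedComponentIn (realZeroSet G)ᶜ q, f y = f q := by
    intro f hf q hq y hy
    refine eq_of_eventually_const dense_univ (isOpen_compl_realZeroSet G).connectedComponentIn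
      isPreconnected_connectedComponentIn (fun x hx => ⟨f x, ?_⟩) ⟨hy, mem_univ _⟩
      ⟨mem_connectedComponentIn hq, mem_univ _⟩
    exact nhdsWithin_le_nhds (hf.1 x (connectedComponentIn_subset _ _ hx))
  choose pt hpt using fun C : boundedComponents G => C.2.1
  have hcard : Nat.card (boundedComponents G → ZMod 2) = 2 ^ (boundedComponents G).ncard := by
    rw [Nat.card_fun, Nat.card_zmod, Nat.card_coe_set_eq]
  rw [← hcard]
  refine Nat.card_congr (Equiv.ofBijective
    (fun (f : boundedFunctions G) (C : boundedComponents G) => f.1 (pt C)) ⟨?_, ?_⟩)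
  · rintro ⟨f, hf⟩ ⟨f', hf'⟩ h
    refine Subtype.ext (funext fun y => ?_)
    change f y = f' y
    by_cases hy : MvPolynomial.eval y G = 0
    · rw [hf.2.1 y hy, hf'.2.1 y hy]
    by_cases hb : Bornology.IsBounded (connectedComponentIn (realZeroSet G)ᶜ y)
    · set C : boundedComponents G := ⟨_, ⟨y, hy, rfl⟩, hb⟩ with hC
      have hCy : y ∈ connectedComponentIn (realZeroSet G)ᶜ (pt C) := by
        rw [← (hpt C).2]
        exact mem_connectedComponentIn hy
      rw [hconst f hf _ (hpt C).1 y hCy, hconst f' hf' _ (hpt C).1 y hCy]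
      exact congrFun h C
    -- on an unbounded component, the functions vanish at some far point
    · obtain ⟨R, hR⟩ := hf.2.2
      obtain ⟨R', hR'⟩ := hf'.2.2
      obtain ⟨z, hz, hzR⟩ : ∃ z ∈ connectedComponentIn (realZeroSet G)ᶜ y, max R R' < ‖z‖ := by
        by_contra! hcon
        exact hb (isBounded_iff_forall_norm_le.2 ⟨_, hcon⟩)
      rw [← hconst f hf y hy z hz, ← hconst f' hf' y hy z hz,
        hR z ((le_max_left _ _).trans_lt hzR), hR' z ((le_max_right _ _).trans_lt hzR)]
  · intro g
    set F : Plane → ZMod 2 := fun y =>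
      if h : connectedComponentIn (realZeroSet G)ᶜ y ∈ boundedComponents G then g ⟨_, h⟩ else 0
      with hF
    have hFC : ∀ y z, connectedComponentIn (realZeroSet G)ᶜ y = connectedComponentIn (realZeroSet G)ᶜ z →
        F y = F z := by
      intro y z h
      simp only [hF]
      simp only [h]
    refine ⟨⟨F, ?_, ?_, ?_⟩, ?_⟩
    · intro y hy
      filter_upwards [(isOpen_compl_realZeroSet G).connectedComponentIn.mem_nhds
        (mem_connectedComponentIn (F := (realZeroSet G)ᶜ) hy)] with z hz
      exact hFC _ _ (connectedComponentIn_eq hz).symm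
    · intro y hy
      simp only [hF]
      rw [dif_neg]
      rintro ⟨⟨q, hq, h⟩, -⟩
      rw [connectedComponentIn_eq_empty (fun h0 : y ∈ (realZeroSet G)ᶜ => h0 hy)] at h
      exact (h ▸ mem_connectedComponentIn hq : q ∈ (∅ : Set Plane)).elim
    · obtain ⟨R, hR⟩ := isBounded_iff_forall_norm_le.1
        ((Bornology.isBounded_sUnion hfb).2 fun C hC => hC.2)
      refine ⟨R, fun y hy => ?_⟩
      simp only [hF]
      split_ifs with h
      · obtain ⟨⟨q, hq, h1⟩, -⟩ := id h
        have hyV : y ∈ (realZeroSet G)ᶜ := by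
          by_contra hyV
          rw [connectedComponentIn_eq_empty hyV] at h1
          exact (h1 ▸ mem_connectedComponentIn hq : q ∈ (∅ : Set Plane)).elim
        exact absurd (hR y ⟨_, h, mem_connectedComponentIn hyV⟩) (not_le.2 hy)
      · rfl
    · funext C
      change F (pt C) = g C
      simp only [hF]
      have h1 : connectedComponentIn (realZeroSet G)ᶜ (pt C) = C := (hpt C).2.symm
      have h2 : connectedComponentIn (realZeroSet G)ᶜ (pt C) ∈ boundedComponents G := by
        rw [h1]; exact C.2
      rw [dif_pos h2]
      congr 1
      exact Subtype.ext h1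

end PlaneCurve

end

noncomputable section

namespace PlaneCurve

variable {G : MvPolynomial (Fin 2) ℝ}

/-! ### Counting the components -/

namespace BranchSystem

variable (B : BranchSystem G)

/-- The branches that go to infinity. -/
abbrev Line : Type := {b : B.Branch // B.period b = 0}

open Classical in
/-- The incidence matrix, modulo two, of branches and nodes: the entry counts how often the branch
passes through the node. -/
def incidence [Fintype B.NodeParam] : Matrix B.Branch (realSingularPoints G) (ZMod 2) :=
  Matrix.of fun b q => ∑ x : B.NodeParam, if x.branch = b ∧ x.node = q then 1 else 0

section

variable [Fintype B.NodeParam]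

lemma incidence_mulVec [Fintype (realSingularPoints G)] (d : realSingularPoints G → ZMod 2) :
    B.incidence.mulVec d = B.totalInc d := by
  classical
  ext b
  simp only [Matrix.mulVec, dotProduct, incidence, Matrix.of_apply, totalInc, Finset.sum_mul]
  rw [Finset.sum_comm, Finset.sum_filter]
  refine Finset.sum_congr rfl fun x _ => ?_
  by_cases h : x.branch = b
  · simp [h]
  · simp [h]

lemma incidence_transpose_mulVec [Fintype B.Branch] (h : B.Branch → ZMod 2) (q : realSingularPoints G)
    {x y : B.NodeParam} (hxy : x ≠ y) (hq : ∀ z : B.NodeParam, z.node = q ↔ z = x ∨ z = y) :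
    B.incidence.transpose.mulVec h q = h x.branch + h y.branch := by
  classical
  simp only [Matrix.mulVec, dotProduct, incidence, Matrix.transpose_apply, Matrix.of_apply,
    Finset.sum_mul]
  rw [Finset.sum_comm]
  have h1 : ∀ z : B.NodeParam,
      (∑ b, (if z.branch = b ∧ z.node = q then 1 else 0) * h b) =
        if z = x ∨ z = y then h z.branch else 0 := by
    intro z
    simp only [hq z]
    by_cases hz : z = x ∨ z = y
    · simp [hz]
    · simp [hz]
  simp only [h1]
  rw [← Finset.sum_filter]
  have h2 : (Finset.univ.filter fun z : B.NodeParam => z = x ∨ z = y) = {x, y} := by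
    ext z; simp
  rw [h2, Finset.sum_pair hxy]

/-- The kernel of the transposed incidence matrix consists of the labellings of the branches that agree
where branches meet, since a node lies on two branches, or twice on the same one. -/
lemma mem_ker_transpose_iff [Fintype B.Branch] (hn : IsNodal G) {h : B.Branch → ZMod 2} :
    h ∈ LinearMap.ker B.incidence.transpose.mulVecLin ↔
      ∀ b b' t t', B.curve b t = B.curve b' t' → h b = h b' := by
  rw [LinearMap.mem_ker, Matrix.mulVecLin_apply]
  constructor
  · intro h0 b b' t t' he
    obtain ⟨n, h1⟩ := B.exists_mem_window b t
    obtain ⟨n', h1'⟩ := B.exists_mem_window b' t'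
    set q := B.curve b t with hq
    have hx : (b, t + n * B.period b) ∈ B.params q := ⟨h1, B.add_period b n t⟩
    have hy : (b', t' + n' * B.period b') ∈ B.params q := ⟨h1', by rw [he]; exact B.add_period b' n' t'⟩
    by_cases hd : differential G q = 0
    · have hqs : q ∈ realSingularPoints G := ⟨(B.isUnitCurve b t).mem, differential_eq_zero_iff.1 hd⟩
      obtain ⟨x, y, hxy, hz⟩ := B.exists_nodeParam_pair hn ⟨q, hqs⟩
      have h2 := congrFun h0 ⟨q, hqs⟩
      rw [B.incidence_transpose_mulVec h _ hxy hz, Pi.zero_apply, CharTwo.add_eq_zero] at h2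
      have key : ∀ z : B.Branch × ℝ, z ∈ B.params q → h z.1 = h x.branch := by
        intro z hzq
        rcases (hz ⟨z, hzq.1, by rw [hzq.2]; exact hd⟩).1 (Subtype.ext hzq.2) with e | e
        · rw [← e]; rfl
        · rw [h2, ← e]; rfl
      exact (key _ hx).trans (key _ hy).symm
    · exact congrArg h (congrArg Prod.fst (B.params_of_smooth hn hd hx hy))
  · intro h0
    ext q
    obtain ⟨x, y, hxy, hz⟩ := B.exists_nodeParam_pair hn q
    rw [B.incidence_transpose_mulVec h _ hxy hz, Pi.zero_apply, CharTwo.add_eq_zero]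
    have h1 := (hz x).2 (Or.inl rfl)
    have h2 := (hz y).2 (Or.inr rfl)
    exact h0 _ _ x.time y.time (congrArg Subtype.val (h1.trans h2.symm))

lemma card_cycleData [Fintype (realSingularPoints G)] :
    Nat.card B.cycleData =
      2 ^ (Module.finrank (ZMod 2) (LinearMap.ker B.incidence.mulVecLin) + Nat.card B.Circle) := by
  have := B.finite
  have e : B.cycleData ≃
      LinearMap.ker B.incidence.mulVecLin × (B.Circle → ZMod 2) :=
    { toFun := fun x => (⟨x.1.1, by
        rw [LinearMap.mem_ker, Matrix.mulVecLin_apply, incidence_mulVec]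
        exact funext x.2⟩, x.1.2)
      invFun := fun x => ⟨(x.1.1, x.2), fun b => by
        have := x.1.2
        rw [LinearMap.mem_ker, Matrix.mulVecLin_apply, incidence_mulVec] at this
        exact congrFun this b⟩
      left_inv := fun x => rfl
      right_inv := fun x => rfl }
  rw [Nat.card_congr e, Nat.card_prod, Nat.card_fun, Nat.card_zmod, pow_add,
    Module.natCard_eq_pow_finrank (K := ZMod 2), Nat.card_zmod]

end

lemma exists_branch_mem (hn : IsNodal G) {p : Plane} (hp : p ∈ realZeroSet G) :
    ∃ b t, B.curve b t = p := by
  obtain ⟨v, hv⟩ := exists_isTangent hn hp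
  obtain ⟨x, hx, -⟩ := B.exists_mem_params hv
  exact ⟨x.1, x.2, hx.2⟩

/-- The curve is connected if and only if all labellings of the branches that agree where branches
meet are constant. -/
lemma isPreconnected_iff (hn : IsNodal G) (hs : (realSingularPoints G).Finite) :
    IsPreconnected (realZeroSet G) ↔ ∀ h : B.Branch → ZMod 2,
      (∀ b b' t t', B.curve b t = B.curve b' t' → h b = h b') → ∀ b b', h b = h b' := by
  constructor
  · intro hV h hh b b'
    -- a labelling that agrees where branches meet is a function on the curve, which is locally constant
    have hF : ∀ p, ∃ i, ∀ b t, B.curve b t = p → h b = i := by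
      intro p
      by_cases hp : ∃ b t, B.curve b t = p
      · obtain ⟨b, t, hbt⟩ := hp
        exact ⟨h b, fun b' t' h' => hh b' b t' t (h'.trans hbt.symm)⟩
      · exact ⟨0, fun b t h' => absurd ⟨b, t, h'⟩ hp⟩
    choose F hF using hF
    let _ : TopologicalSpace (ZMod 2) := ⊥
    have : DiscreteTopology (ZMod 2) := ⟨rfl⟩
    have hcont : ContinuousOn F (realZeroSet G) := by
      intro p hp
      refine (continuousWithinAt_const (b := F p)).congr_of_eventuallyEq ?_ rfl
      rw [EventuallyEq, eventually_nhdsWithin_iff]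
      filter_upwards [eventually_eq_flowCurve hn hs hp one_pos] with p' hp' hpV
      obtain ⟨v', hv'⟩ := exists_isTangent hn hpV
      obtain ⟨v, hv, s, -, rfl, -⟩ := hp' v' hv'
      obtain ⟨⟨b, t⟩, ⟨-, rfl⟩, hx⟩ := B.exists_mem_params hv
      simp only [vel] at hx ⊢
      rw [← hF _ b t rfl]
      rcases hx with hx | hx
      · rw [← hx, B.flowCurve_eq hn hs, ← hF _ b _ rfl]
      · rw [← neg_eq_iff_eq_neg.2 hx, B.flowCurve_neg_eq hn hs, ← hF _ b _ rfl]
    rw [hF _ b 0 rfl, hF _ b' 0 rfl]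
    exact hV.constant hcont (B.isUnitCurve b 0).mem (B.isUnitCurve b' 0).mem
  · intro h
    refine isPreconnected_of_forall_constant fun f hf => ?_
    have hcurve : ∀ b t, f (B.curve b t) = f (B.curve b 0) := by
      intro b t
      refine isPreconnected_univ.constant (f := fun t => f (B.curve b t)) ?_ (mem_univ t)
        (mem_univ 0)
      exact hf.comp (B.isUnitCurve b).continuous.continuousOn fun t _ => (B.isUnitCurve b t).mem
    have hconst := h (fun b => if f (B.curve b 0) then 1 else 0) (fun b b' t t' he => by
      rw [← hcurve b t, ← hcurve b' t', he])
    intro p hp p' hp'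
    obtain ⟨b, t, rfl⟩ := B.exists_branch_mem hn hp
    obtain ⟨b', t', rfl⟩ := B.exists_branch_mem hn hp'
    rw [hcurve, hcurve]
    have := hconst b b'
    cases h1 : f (B.curve b 0) <;> cases h2 : f (B.curve b' 0) <;> simp_all

/-- Euler's formula for the curve: the number of bounded components of its complement, in terms of
the numbers of nodes, of unbounded branches, and of connected components of the curve, the last
being the dimension of the space of labellings of the branches that agree where branches meet. -/
theorem ncard_boundedComponents (hfin : (criticalPoints G).Finite) (hn : IsNodal G)
    (hs : (realSingularPoints G).Finite) (hne : (realZeroSet G).Nonempty) :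
    ∃ c : ℕ, 1 ≤ c ∧ (boundedComponents G).ncard + Nat.card B.Line =
      (realSingularPoints G).ncard + c ∧ (c = 1 ↔ IsConnected (realZeroSet G)) := by
  classical
  have := B.finite
  have := B.finite_nodeParam hn hs
  have := hs.to_subtype
  have := Fintype.ofFinite B.Branch
  have := Fintype.ofFinite B.NodeParam
  have := Fintype.ofFinite (realSingularPoints G)
  set M := B.incidence with hM
  set K := LinearMap.ker M.transpose.mulVecLin with hK
  have h1 := PlaneCurve.card_boundedFunctions hfin
  rw [B.card_boundedFunctions hn hs, B.card_cycleData] at h1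
  have h2 := Nat.pow_right_injective le_rfl h1
  have h3 := LinearMap.finrank_range_add_finrank_ker M.mulVecLin
  have h4 := LinearMap.finrank_range_add_finrank_ker M.transpose.mulVecLin
  -- the matrix and its transpose have the same rank, which relates the spaces of cycles and of labellings
  have h5 : M.transpose.rank = M.rank := Matrix.rank_transpose M
  unfold Matrix.rank at h5
  rw [← hK] at h4
  rw [← hM] at h2
  rw [Module.finrank_fintype_fun_eq_card] at h3 h4
  have h6 : Fintype.card B.Branch = Nat.card B.Line + Nat.card B.Circle := by
    rw [← Nat.card_eq_fintype_card, Nat.card_congr (Equiv.sumCompl fun b => B.period b = 0).symm,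
      Nat.card_sum]
  have h7 : Fintype.card (realSingularPoints G) = (realSingularPoints G).ncard := by
    rw [← Nat.card_eq_fintype_card, Nat.card_coe_set_eq]
  obtain ⟨p, hp⟩ := hne
  obtain ⟨b₀, -⟩ := B.exists_branch_mem hn hp
  -- the constant labelling is a nonzero element of the kernel
  have hone : (fun _ : B.Branch => (1 : ZMod 2)) ∈ K := (B.mem_ker_transpose_iff hn).2 fun _ _ _ _ _ => rfl
  have hone0 : (⟨_, hone⟩ : K) ≠ 0 := by
    intro h
    exact one_ne_zero (congrFun (congrArg Subtype.val h) b₀)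
  have hpos : 1 ≤ Module.finrank (ZMod 2) K := by
    have : Nontrivial K := ⟨⟨_, _, hone0⟩⟩
    exact Module.finrank_pos
  refine ⟨Module.finrank (ZMod 2) K, hpos, by omega, ?_⟩
  have hconn : IsConnected (realZeroSet G) ↔ IsPreconnected (realZeroSet G) :=
    ⟨fun h => h.isPreconnected, fun h => ⟨⟨p, hp⟩, h⟩⟩
  rw [hconn, B.isPreconnected_iff hn hs]
  constructor
  · intro h h' hh' b b'
    obtain ⟨a, ha⟩ := (finrank_eq_one_iff_of_nonzero' _ hone0).1 h
      ⟨h', (B.mem_ker_transpose_iff hn).2 hh'⟩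
    have ha' := congrArg Subtype.val ha
    simp only [SetLike.mk_smul_mk] at ha'
    rw [← ha']
    rfl
  · intro h
    refine (finrank_eq_one_iff_of_nonzero' _ hone0).2 fun w => ⟨w.1 b₀, Subtype.ext ?_⟩
    ext b
    have := h w.1 ((B.mem_ker_transpose_iff hn).1 w.2) b₀ b
    simp [this]

end BranchSystem

end PlaneCurve

end

noncomputable section

namespace PlaneCurve

variable {G : MvPolynomial (Fin 2) ℝ}

/-! ### The divide in a large disk -/

lemma normSq_le_two_mul_norm_sq (q : Plane) : normSq q ≤ 2 * ‖q‖ ^ 2 := by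
  have h : ∀ i, q i ^ 2 ≤ ‖q‖ ^ 2 := fun i => by
    rw [← sq_abs (q i)]
    exact pow_le_pow_left₀ (abs_nonneg _) (norm_le_pi_norm q i) 2
  unfold normSq
  linarith [h 0, h 1]

/-- All tangencies of the curve with circles centred at the origin, in particular its singular
points, lie in the open disk of radius `R`. -/
def HasTangenciesInside (G : MvPolynomial (Fin 2) ℝ) (R : ℝ) : Prop :=
  ∀ q, MvPolynomial.eval q G = 0 → MvPolynomial.eval q (angular G) = 0 → normSq q < R ^ 2

lemma eventually_hasTangenciesInside (hfin : (criticalPoints G).Finite) :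
    ∀ᶠ R in atTop, HasTangenciesInside G R := by
  obtain ⟨r, hr⟩ := isBounded_iff_forall_norm_le.1 (isBounded_tangencies hfin)
  -- the factor `2` compensates for the sup norm on the plane
  filter_upwards [eventually_gt_atTop (2 * |r|)] with R hR q h1 h2
  have h3 : ‖q‖ ≤ |r| := (hr q ⟨h1, h2⟩).trans (le_abs_self r)
  have h4 : ‖q‖ ^ 2 ≤ |r| ^ 2 := by gcongr
  have h5 : (2 * |r|) ^ 2 < R ^ 2 := by gcongr
  nlinarith [normSq_le_two_mul_norm_sq q, sq_nonneg |r|]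

section

variable {R : ℝ} (hR : HasTangenciesInside G R)

include hR in
lemma HasTangenciesInside.smooth {q : Plane} (hq : MvPolynomial.eval q G = 0)
    (h : R ^ 2 ≤ normSq q) : differential G q ≠ 0 := by
  intro hd
  rw [differential_eq_zero_iff] at hd
  refine absurd (hR q hq ?_) (not_lt.2 h)
  simp [angular, hd]

include hR in
lemma HasTangenciesInside.not_isLocalExtr (hn : IsNodal G) {γ : ℝ → Plane} (h : IsUnitCurve G γ)
    {t : ℝ} (hm : IsLocalExtr (fun s => normSq (γ s)) t) : normSq (γ t) < R ^ 2 := by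
  have := hm.hasDerivAt_eq_zero (h.hasDerivAt_normSq t)
  exact hR _ (h t).mem (h.angular_eq_zero hn (by linarith))

include hR in
/-- A unit-speed curve that goes to infinity meets the disk in a single arc. -/
lemma HasTangenciesInside.exists_arc (hn : IsNodal G) (hs : (realSingularPoints G).Finite)
    {γ : ℝ → Plane} (h : IsUnitCurve G γ) (hp : ∀ a ∈ periods γ, a = 0) :
    ∃ a b, a < b ∧ (∀ t, normSq (γ t) ≤ R ^ 2 ↔ t ∈ Icc a b) ∧
      (∀ t ∈ Ioo a b, normSq (γ t) < R ^ 2) ∧ normSq (γ a) = R ^ 2 ∧ normSq (γ b) = R ^ 2 := by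
  have hcont : Continuous fun t => normSq (γ t) := continuous_normSq.comp h.continuous
  set S := {t | normSq (γ t) ≤ R ^ 2} with hS
  have hSc : IsCompact S := by
    refine Metric.isCompact_of_isClosed_isBounded (isClosed_le hcont continuous_const)
      ((h.isBounded_preimage hn hs hp |R|).subset fun t ht => ?_)
    exact abs_le_of_sq_le_sq' ((norm_sq_le_normSq _).trans (by rw [sq_abs]; exact ht))
      (abs_nonneg R) |>.2
  obtain ⟨t₀, ht₀⟩ : ∃ t₀, normSq (γ t₀) < R ^ 2 := by
    obtain ⟨t, ht⟩ := h.exists_angular_eq_zero hn hs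
    exact ⟨t, hR _ (h t).mem ht⟩
  -- between two visits of the disk, an excursion would have a point furthest from the origin
  have hord : S.OrdConnected := by
    refine ⟨fun x hx y hy z hz => ?_⟩
    by_contra hzS
    have hz' : R ^ 2 < normSq (γ z) := not_le.1 hzS
    obtain ⟨m, hm, hmax⟩ := isCompact_Icc.exists_isMaxOn ⟨z, hz⟩ hcont.continuousOn
    have hmz : R ^ 2 < normSq (γ m) := hz'.trans_le (hmax hz)
    have hmi : m ∈ Ioo x y := by
      refine ⟨lt_of_le_of_ne hm.1 ?_, lt_of_le_of_ne hm.2 ?_⟩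
      · rintro rfl; exact absurd hx (not_le.2 hmz)
      · rintro rfl; exact absurd hy (not_le.2 hmz)
    have hloc : IsLocalMax (fun s => normSq (γ s)) m := by
      filter_upwards [Icc_mem_nhds hmi.1 hmi.2] with s hs
      exact hmax hs
    exact absurd (hR.not_isLocalExtr hn h (Or.inr hloc)) (not_lt.2 hmz.le)
  have hne : S.Nonempty := ⟨t₀, ht₀.le⟩
  have haS := hSc.sInf_mem hne
  have hbS := hSc.sSup_mem hne
  set a := sInf S with ha
  set b := sSup S with hb
  have hIcc : ∀ t, normSq (γ t) ≤ R ^ 2 ↔ t ∈ Icc a b := fun t =>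
    ⟨fun ht => ⟨csInf_le hSc.bddBelow ht, le_csSup hSc.bddAbove ht⟩, fun ht => hord.out haS hbS ht⟩
  have hga : normSq (γ a) = R ^ 2 := by
    refine le_antisymm haS (ge_of_tendsto ((hcont.tendsto a).mono_left nhdsWithin_le_nhds)
      (x := 𝓝[<] a) ?_)
    filter_upwards [self_mem_nhdsWithin] with s hs
    by_contra! hlt
    exact absurd ((hIcc s).1 hlt.le).1 (not_le.2 hs)
  have hgb : normSq (γ b) = R ^ 2 := by
    refine le_antisymm hbS (ge_of_tendsto ((hcont.tendsto b).mono_left nhdsWithin_le_nhds)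
      (x := 𝓝[>] b) ?_)
    filter_upwards [self_mem_nhdsWithin] with s hs
    by_contra! hlt
    exact absurd ((hIcc s).1 hlt.le).2 (not_le.2 hs)
  have ht₀' := (hIcc t₀).1 ht₀.le
  have hat : a < t₀ := lt_of_le_of_ne ht₀'.1 fun h0 => by rw [← h0, hga] at ht₀; exact lt_irrefl _ ht₀
  refine ⟨a, b, hat.trans_le ht₀'.2, hIcc, fun t ht => ?_, hga, hgb⟩
  have hle := (hIcc t).2 ⟨ht.1.le, ht.2.le⟩
  refine lt_of_le_of_ne hle fun heq => ?_
  have hloc : IsLocalMax (fun s => normSq (γ s)) t := by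
    filter_upwards [Icc_mem_nhds ht.1 ht.2] with s hs
    rw [heq]
    exact (hIcc s).2 hs
  exact absurd (hR.not_isLocalExtr hn h (Or.inr hloc)) (not_lt.2 heq.ge)

include hR in
/-- A closed branch lies in the disk: at its point furthest from the origin it is tangent to a circle. -/
lemma HasTangenciesInside.lt_of_period (hn : IsNodal G) {γ : ℝ → Plane} (h : IsUnitCurve G γ)
    {T : ℝ} (hT : 0 < T) (hp : Function.Periodic γ T) (t : ℝ) : normSq (γ t) < R ^ 2 := by
  have hcont : Continuous fun t => normSq (γ t) := continuous_normSq.comp h.continuous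
  obtain ⟨m, -, hmax⟩ := (isCompact_Icc (a := (0 : ℝ)) (b := T)).exists_isMaxOn
    ⟨0, by simp [hT.le]⟩ hcont.continuousOn
  have hall : ∀ s, normSq (γ s) ≤ normSq (γ m) := by
    intro s
    obtain ⟨y, hy, hys⟩ := hp.exists_mem_Ico₀ hT s
    rw [hys]
    exact hmax ⟨hy.1, hy.2.le⟩
  exact (hall t).trans_lt
    (hR.not_isLocalExtr hn h (Or.inr (show IsLocalMax _ m from Eventually.of_forall hall)))

end

/-- The number of interval branches of a divide is determined by the curve: twice this number is the
number of points of the curve on the boundary circle. -/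
lemma IsDivideOf.two_mul_numIntervals {R : ℝ} {D : Divide R} (hD : IsDivideOf G D) :
    D.numIntervals * 2 = (realZeroSet G ∩ {q | normSq q = R ^ 2}).ncard := by
  have h2 : Nat.card ({0, 1} : Set ℝ) = 2 := by
    rw [Nat.card_coe_set_eq, Set.ncard_pair zero_ne_one]
  have h1 : Nat.card (Fin D.numIntervals × ({0, 1} : Set ℝ)) = D.numIntervals * 2 := by
    rw [Nat.card_prod, Nat.card_fin, h2]
  rw [← h1, ← Set.ncard_univ, ← Set.ncard_image_of_injective _ D.endpoint_injective, image_univ]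
  congr 1
  have hmem : ∀ e : ({0, 1} : Set ℝ), (e : ℝ) ∈ Icc (0 : ℝ) 1 := by
    rintro ⟨e, rfl | rfl⟩ <;> simp
  ext q
  constructor
  · rintro ⟨⟨j, e⟩, rfl⟩
    have hq : D.interval j e ∈ D.carrier := ⟨Sum.inl (j, ⟨e, hmem e⟩), rfl⟩
    rw [hD] at hq
    exact ⟨hq.1, D.endpoint_mem j e e.2⟩
  · rintro ⟨hq, hqR⟩
    have hq' : q ∈ D.carrier := by
      rw [hD]
      exact ⟨hq, le_of_eq hqR⟩
    rcases hq' with ⟨⟨j, t⟩ | ⟨k, t⟩, rfl⟩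
    · have ht : (t : ℝ) ∈ ({0, 1} : Set ℝ) := by
        by_contra hcon
        simp only [mem_insert_iff, mem_singleton_iff, not_or] at hcon
        have := D.interval_mem j t ⟨lt_of_le_of_ne t.2.1 (Ne.symm hcon.1),
          lt_of_le_of_ne t.2.2 hcon.2⟩
        exact absurd hqR (ne_of_lt this)
      exact ⟨(j, ⟨t, ht⟩), rfl⟩
    · exact absurd hqR (ne_of_lt (D.circle_mem k t))

lemma linearIndependent_of_dot_rot {u v : Plane} (h : dot v (rot u) ≠ 0) :
    LinearIndependent ℝ ![u, v] := by
  rw [LinearIndependent.pair_iff]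
  intro s t hst
  have h0 : s * u 0 + t * v 0 = 0 := congrFun hst 0
  have h1 : s * u 1 + t * v 1 = 0 := congrFun hst 1
  simp only [dot, rot_zero, rot_one] at h
  have ht : t * (v 0 * -u 1 + v 1 * u 0) = 0 := by linear_combination -u 1 * h0 + u 0 * h1
  have hs : s * (v 0 * -u 1 + v 1 * u 0) = 0 := by linear_combination v 1 * h0 - v 0 * h1
  exact ⟨(mul_eq_zero.1 hs).resolve_right h, (mul_eq_zero.1 ht).resolve_right h⟩

end PlaneCurve

end

noncomputable section

namespace PlaneCurve

variable {G : MvPolynomial (Fin 2) ℝ}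

lemma IsUnitCurve.contDiff {γ : ℝ → Plane} (h : IsUnitCurve G γ) : ContDiff ℝ ∞ γ :=
  contDiff_iff_contDiffAt.2 fun t => (h t).smooth

lemma hasDerivAt_comp_affine {γ : ℝ → Plane} (h : IsUnitCurve G γ) (a c s : ℝ) :
    HasDerivAt (fun s => γ (a + s * c)) (c • deriv γ (a + s * c)) s := by
  have h1 : HasDerivAt (fun s : ℝ => a + s * c) c s := by
    simpa using ((hasDerivAt_id s).mul_const c).const_add a
  exact (h (a + s * c)).hasDerivAt.scomp s h1

lemma dot_smul_rot_smul (a b : ℝ) (u v : Plane) :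
    dot (b • v) (rot (a • u)) = a * b * dot v (rot u) := by
  simp [dot]; ring

lemma eq_or_eq_or_eq_of_mem_pair {α : Type*} {u w x y z : α} (hx : x ∈ ({u, w} : Set α))
    (hy : y ∈ ({u, w} : Set α)) (hz : z ∈ ({u, w} : Set α)) : x = y ∨ x = z ∨ y = z := by
  rcases hx with rfl | rfl <;> rcases hy with rfl | rfl <;> rcases hz with rfl | rfl <;> simp

section

variable {R : ℝ} (hR : HasTangenciesInside G R)

include hR in
/-- In a disk that contains all tangencies with circles centred at the origin, the curve is a divide,
with one interval for each unbounded branch and one circle for each closed branch. -/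
lemma HasTangenciesInside.exists_divide (hn : IsNodal G) (hs : (realSingularPoints G).Finite)
    (B : BranchSystem G) : ∃ D : Divide R, IsDivideOf G D ∧ D.numIntervals = Nat.card B.Line := by
  have := B.finite
  have harc : ∀ b : B.Line, ∃ x : ℝ × ℝ, x.1 < x.2 ∧
      (∀ t, normSq (B.curve b t) ≤ R ^ 2 ↔ t ∈ Icc x.1 x.2) ∧
      (∀ t ∈ Ioo x.1 x.2, normSq (B.curve b t) < R ^ 2) ∧ normSq (B.curve b x.1) = R ^ 2 ∧
        normSq (B.curve b x.2) = R ^ 2 := by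
    intro b
    obtain ⟨x, y, h⟩ := hR.exists_arc hn hs (B.isUnitCurve b) (fun a ha => by
      obtain ⟨n, rfl⟩ := (B.mem_periods b a).1 ha
      rw [b.2, mul_zero])
    exact ⟨(x, y), h⟩
  choose I hI hIcc hIoo hIa hIb using harc
  have hT : ∀ c : B.Circle, 0 < B.period c := fun c =>
    lt_of_le_of_ne (B.period_nonneg c) (Ne.symm c.2)
  -- intervals and circles are the arcs `[a, b]` of the lines and the periods of the closed branches,
  -- parametrized affinely by `[0, 1]`
  let e : Fin (Nat.card B.Line) ≃ B.Line := (Finite.equivFin B.Line).symm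
  let e' : Fin (Nat.card B.Circle) ≃ B.Circle := (Finite.equivFin B.Circle).symm
  let L : Fin (Nat.card B.Line) → ℝ := fun j => (I (e j)).2 - (I (e j)).1
  have hL : ∀ j, 0 < L j := fun j => sub_pos.2 (hI (e j))
  let iv : Fin (Nat.card B.Line) → ℝ → Plane := fun j s => B.curve (e j) ((I (e j)).1 + s * L j)
  let ci : Fin (Nat.card B.Circle) → ℝ → Plane := fun k s =>
    B.curve (e' k) (0 + s * B.period (e' k))
  have hivd : ∀ j s, s ∈ Icc (0 : ℝ) 1 → derivWithin (iv j) (Icc 0 1) s =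
      L j • deriv (B.curve (e j)) ((I (e j)).1 + s * L j) := fun j s hs =>
    (hasDerivAt_comp_affine (B.isUnitCurve (e j)) _ _ s).hasDerivWithinAt.derivWithin
      (uniqueDiffOn_Icc zero_lt_one s hs)
  have hcid : ∀ k s, deriv (ci k) s =
      B.period (e' k) • deriv (B.curve (e' k)) (0 + s * B.period (e' k)) := fun k s =>
    (hasDerivAt_comp_affine (B.isUnitCurve (e' k)) _ _ s).deriv
  have hunit : ∀ b t, deriv (B.curve b) t ≠ 0 := fun b t =>
    ne_zero_of_normSq_eq_one (B.isUnitCurve b t).unit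
  let C : ImmersedCurves :=
    { numIntervals := Nat.card B.Line
      numCircles := Nat.card B.Circle
      interval := iv
      circle := ci
      interval_smooth := fun j => ((B.isUnitCurve (e j)).contDiff.comp
        (by fun_prop : ContDiff ℝ ∞ fun s : ℝ => (I (e j)).1 + s * L j)).contDiffOn
      interval_immersion := fun j t ht => by
        rw [hivd j t ht]
        exact smul_ne_zero (hL j).ne' (hunit _ _)
      circle_smooth := fun k => (B.isUnitCurve (e' k)).contDiff.comp
        (by fun_prop : ContDiff ℝ ∞ fun s : ℝ => 0 + s * B.period (e' k))
      circle_periodic := fun k s => by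
        have := B.add_period (e' k) 1 (0 + s * B.period (e' k))
        simp only [ci]
        rw [← this]
        congr 1
        push_cast
        ring
      circle_immersion := fun k s => by
        rw [hcid]
        exact smul_ne_zero (hT (e' k)).ne' (hunit _ _) }
  -- the parameters of the divide as parameters on the branches
  let P : C.Param → B.Branch × ℝ := fun x => match x with
    | Sum.inl (j, t) => ((e j : B.Branch), (I (e j)).1 + t * L j)
    | Sum.inr (k, t) => ((e' k : B.Branch), 0 + t * B.period (e' k))
  have hPpoint : ∀ x, C.point x = B.curve (P x).1 (P x).2 := by
    rintro (⟨j, t⟩ | ⟨k, t⟩) <;> rfl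
  have hPwin : ∀ x, (P x).2 ∈ B.window (P x).1 := by
    rintro (⟨j, t⟩ | ⟨k, t⟩)
    · exact Or.inl (e j).2
    · refine Or.inr ⟨?_, ?_⟩
      · have := mul_nonneg t.2.1 (hT (e' k)).le
        simpa [P] using this
      · have := mul_lt_mul_of_pos_right t.2.2 (hT (e' k))
        simpa [P] using this
  have hPvel : ∀ x, ∃ c : ℝ, c ≠ 0 ∧ C.velocity x = c • B.vel (P x) := by
    rintro (⟨j, t⟩ | ⟨k, t⟩)
    · exact ⟨L j, (hL j).ne', hivd j t t.2⟩
    · exact ⟨B.period (e' k), (hT (e' k)).ne', hcid k t⟩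
  have hPinj : Function.Injective P := by
    rintro (⟨j, t⟩ | ⟨k, t⟩) (⟨j', t'⟩ | ⟨k', t'⟩) h
    · simp only [P, Prod.mk.injEq] at h
      obtain rfl : j = j' := e.injective (Subtype.ext h.1)
      have h2 := mul_right_cancel₀ (hL j).ne' (add_left_cancel h.2)
      rw [Subtype.ext h2]
    · simp only [P, Prod.mk.injEq] at h
      exact absurd (h.1 ▸ (e j).2) (e' k').2
    · simp only [P, Prod.mk.injEq] at h
      exact absurd (h.1.symm ▸ (e j').2) (e' k).2
    · simp only [P, Prod.mk.injEq] at h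
      obtain rfl : k = k' := e'.injective (Subtype.ext h.1)
      have h2 := mul_right_cancel₀ (hT (e' k)).ne' (add_left_cancel h.2)
      rw [Subtype.ext h2]
  have hPmem : ∀ x, P x ∈ B.params (C.point x) := fun x => ⟨hPwin x, (hPpoint x).symm⟩
  have hmem : ∀ x, MvPolynomial.eval (C.point x) G = 0 := fun x => by
    rw [hPpoint]
    exact (B.isUnitCurve _ _).mem
  -- a point with two parameters is a node
  have hnode : ∀ x y, x ≠ y → C.point x = C.point y → IsHyperbolicNode G (C.point x) := by
    intro x y hxy h
    by_contra hcon
    have hd : differential G (C.point x) ≠ 0 := fun hd =>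
      hcon (hn _ ⟨hmem x, differential_eq_zero_iff.1 hd⟩)
    exact hxy (hPinj (B.params_of_smooth hn hd (hPmem x) (h ▸ hPmem y)))
  have hIcc01 : ∀ j, ∀ s ∈ Icc (0 : ℝ) 1, (I (e j)).1 + s * L j ∈ Icc (I (e j)).1 (I (e j)).2 := by
    intro j s hs
    have h1 := mul_nonneg hs.1 (hL j).le
    have h2 := mul_le_mul_of_nonneg_right hs.2 (hL j).le
    have h3 : L j = (I (e j)).2 - (I (e j)).1 := rfl
    constructor <;> linarith
  have hend : ∀ j, ∀ s ∈ ({0, 1} : Set ℝ), normSq (iv j s) = R ^ 2 := by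
    rintro j s (rfl | rfl)
    · simp only [iv, zero_mul, add_zero]
      exact hIa (e j)
    · simp only [iv, one_mul, L, add_sub_cancel]
      exact hIb (e j)
  have h01 : ∀ s ∈ ({0, 1} : Set ℝ), s ∈ Icc (0 : ℝ) 1 := by
    rintro s (rfl | rfl) <;> simp
  let D : Divide R :=
    { toImmersedCurves := C
      circle_mem := fun k t => hR.lt_of_period hn (B.isUnitCurve (e' k)) (hT (e' k)) (fun s => by
        simpa using B.add_period (e' k) 1 s) _
      interval_mem := fun j t ht => by
        refine hIoo (e j) _ ?_
        have h1 := mul_pos ht.1 (hL j)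
        have h2 := mul_lt_mul_of_pos_right ht.2 (hL j)
        have h3 : L j = (I (e j)).2 - (I (e j)).1 := rfl
        constructor <;> linarith
      endpoint_mem := hend
      endpoint_injective := by
        rintro ⟨j, s⟩ ⟨j', s'⟩ h
        change iv j s = iv j' s' at h
        have hd := hR.smooth (q := iv j s) (B.isUnitCurve _ _).mem (hend j s s.2).ge
        let x : C.Param := Sum.inl (j, ⟨s, h01 s s.2⟩)
        let y : C.Param := Sum.inl (j', ⟨s', h01 s' s'.2⟩)
        have h1 : P y ∈ B.params (C.point x) := by
          have h2 : C.point x = C.point y := h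
          rw [h2]
          exact hPmem y
        have h3 : x = y := hPinj (B.params_of_smooth hn hd (hPmem x) h1)
        simp only [x, y, Sum.inl.injEq, Prod.mk.injEq, Subtype.mk.injEq] at h3
        exact Prod.ext h3.1 (Subtype.ext h3.2)
      boundary_transversal := fun j s hs => by
        change dot (iv j s) (derivWithin (iv j) (Icc 0 1) s) ≠ 0
        rw [hivd j s (h01 s hs)]
        intro h0
        have h1 : L j * dot (iv j s) (deriv (B.curve (e j)) ((I (e j)).1 + s * L j)) = 0 := by
          refine Eq.trans ?_ h0
          simp only [dot, Pi.smul_apply, smul_eq_mul]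
          ring
        have h2 := (B.isUnitCurve (e j)).angular_eq_zero hn
          ((mul_eq_zero.1 h1).resolve_left (hL j).ne')
        exact absurd (hR _ (B.isUnitCurve _ _).mem h2) (not_lt.2 (hend j s hs).ge)
      transversal := fun x y hxy h => by
        obtain ⟨u, w, -, hp, hdot⟩ := B.params_of_node hn (hnode x y hxy h)
        have hx := hPmem x
        have hy := hPmem y
        rw [← h] at hy
        rw [hp] at hx hy
        obtain ⟨c, hc, hvx⟩ := hPvel x
        obtain ⟨c', hc', hvy⟩ := hPvel y
        have hne : P x ≠ P y := fun h0 => hxy (hPinj h0)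
        change LinearIndependent ℝ ![C.velocity x, C.velocity y]
        rw [hvx, hvy]
        apply linearIndependent_of_dot_rot
        rw [dot_smul_rot_smul]
        refine mul_ne_zero (mul_ne_zero hc hc') ?_
        rcases hx with hx | hx <;> rcases hy with hy | hy
        · exact absurd (hx.trans hy.symm) hne
        · rw [hx, show P y = w from hy]
          exact hdot
        · rw [show P x = w from hx, hy]
          intro h0
          apply hdot
          simp only [dot, rot_zero, rot_one] at h0 ⊢
          linarith
        · exact absurd (Eq.trans hx (Eq.symm hy)) hne
      no_triple := fun x y z hxy hxz hyz h => by
        obtain ⟨u, w, -, hp, -⟩ := B.params_of_node hn (hnode x y hxy h.1)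
        have hx := hPmem x
        have hy := hPmem y
        have hz := hPmem z
        have e1 : C.point x = C.point y := h.1
        have e2 : C.point x = C.point z := h.2
        rw [← e1] at hy
        rw [← e2] at hz
        rw [hp] at hx hy hz
        exact eq_or_eq_or_eq_of_mem_pair hx hy hz |>.elim (fun h0 => hxy (hPinj h0))
          fun h0 => h0.elim (fun h0 => hxz (hPinj h0)) fun h0 => hyz (hPinj h0) }
  refine ⟨D, ?_, rfl⟩
  ext q
  constructor
  · rintro ⟨x, rfl⟩
    refine ⟨hmem x, ?_⟩
    rcases x with ⟨j, t⟩ | ⟨k, t⟩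
    · exact (hIcc (e j) _).2 (hIcc01 j t t.2)
    · exact (D.circle_mem k t).le
  · rintro ⟨hq, hqR⟩
    obtain ⟨v, hv⟩ := exists_isTangent hn hq
    obtain ⟨⟨b, t⟩, ⟨ht, rfl⟩, -⟩ := B.exists_mem_params hv
    simp only at ht hq hqR ⊢
    by_cases hb : B.period b = 0
    · obtain ⟨j, hj⟩ := e.surjective ⟨b, hb⟩
      have hj' : (e j : B.Branch) = b := congrArg Subtype.val hj
      have htI : t ∈ Icc (I (e j)).1 (I (e j)).2 := by
        refine (hIcc (e j) t).1 ?_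
        rw [hj']
        exact hqR
      refine ⟨Sum.inl (j, ⟨(t - (I (e j)).1) / L j, div_nonneg (sub_nonneg.2 htI.1) (hL j).le,
        (div_le_one (hL j)).2 ?_⟩), ?_⟩
      · simp only [L]
        linarith [htI.2]
      · change B.curve (e j) ((I (e j)).1 + (t - (I (e j)).1) / L j * L j) = B.curve b t
        rw [div_mul_cancel₀ _ (hL j).ne', add_sub_cancel, hj']
    · obtain ⟨k, hk⟩ := e'.surjective ⟨b, hb⟩
      have hk' : (e' k : B.Branch) = b := congrArg Subtype.val hk
      have ht' := ht.resolve_left hb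
      have hTk : B.period (e' k) = B.period b := by rw [hk']
      refine ⟨Sum.inr (k, ⟨t / B.period (e' k), div_nonneg ht'.1 (hT _).le,
        (div_lt_one (hT _)).2 (by rw [hTk]; exact ht'.2)⟩), ?_⟩
      change B.curve (e' k) (0 + t / B.period (e' k) * B.period (e' k)) = B.curve b t
      rw [div_mul_cancel₀ _ (hT _).ne', zero_add, hk']

end

/-- The number of interval branches is the number of unbounded branches. -/
theorem BranchSystem.hasNumIntervalBranches (B : BranchSystem G) (hfin : (criticalPoints G).Finite)
    (hn : IsNodal G) (hs : (realSingularPoints G).Finite) :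
    HasNumIntervalBranches G (Nat.card B.Line) := by
  filter_upwards [eventually_hasTangenciesInside hfin] with R hR
  obtain ⟨D, hD, hDn⟩ := hR.exists_divide hn hs B
  refine ⟨⟨D, hD⟩, fun D' hD' => ?_⟩
  have h1 := hD.two_mul_numIntervals
  have h2 := hD'.two_mul_numIntervals
  omega

end PlaneCurve

end

noncomputable section

namespace PlaneCurve

variable {G : MvPolynomial (Fin 2) ℝ}

/-! ### Counting the critical points -/

lemma finite_realSingularPoints (hfin : (criticalPoints G).Finite) :
    (realSingularPoints G).Finite :=
  (hfin.preimage toComplex_injective.injOn).subset fun _ hq => toComplex_mem_criticalPoints.2 hq.2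

/-- The number of critical points, with multiplicities, is at least their number, with equality if and
only if all of them are nondegenerate. -/
lemma exists_numCriticalPoints (hfin : (criticalPoints G).Finite) :
    ∃ n : ℕ, numCriticalPoints G = n ∧ (criticalPoints G).ncard ≤ n ∧
      (n = (criticalPoints G).ncard ↔
        ∀ p ∈ criticalPoints G, MvPolynomial.aeval p (hessian G).det ≠ 0) := by
  choose! m hm hm1 hm2 using fun p (hp : p ∈ criticalPoints G) => exists_milnorNumber_eq hfin hp
  have hcard : (criticalPoints G).ncard = ∑ p ∈ hfin.toFinset, 1 := by
    rw [Finset.sum_const, smul_eq_mul, mul_one, Set.ncard_eq_toFinset_card _ hfin]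
  have hle : ∀ p ∈ hfin.toFinset, 1 ≤ m p := fun p hp => hm1 p (hfin.mem_toFinset.1 hp)
  refine ⟨∑ p ∈ hfin.toFinset, m p, ?_, ?_, ?_⟩
  · rw [numCriticalPoints, finsum_mem_eq_finite_toFinset_sum _ hfin, Nat.cast_sum]
    exact Finset.sum_congr rfl fun p hp => hm p (hfin.mem_toFinset.1 hp)
  · rw [hcard]
    exact Finset.sum_le_sum hle
  · rw [hcard, eq_comm, Finset.sum_eq_sum_iff_of_le hle]
    constructor
    · intro h p hp
      exact (hm2 p hp).1 (h p (hfin.mem_toFinset.2 hp)).symm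
    · intro h p hp
      rw [hfin.mem_toFinset] at hp
      exact ((hm2 p hp).2 (h p hp)).symm

/-- The real critical points off the curve. -/
def offCurveCriticalPoints (G : MvPolynomial (Fin 2) ℝ) : Set Plane :=
  {c | c ∈ (realZeroSet G)ᶜ ∧ toComplex c ∈ criticalPoints G}

lemma finite_offCurveCriticalPoints (hfin : (criticalPoints G).Finite) :
    (offCurveCriticalPoints G).Finite :=
  (hfin.preimage toComplex_injective.injOn).subset fun _ hq => hq.2

/-- The real critical points are the real singular points and those off the curve. -/
lemma ncard_criticalPoints (hfin : (criticalPoints G).Finite) :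
    (realSingularPoints G).ncard + (offCurveCriticalPoints G).ncard ≤ (criticalPoints G).ncard ∧
      ((criticalPoints G).ncard = (realSingularPoints G).ncard + (offCurveCriticalPoints G).ncard ↔
        ∀ p ∈ criticalPoints G, ∃ q, toComplex q = p) := by
  have hunion : (realSingularPoints G).ncard + (offCurveCriticalPoints G).ncard =
      (toComplex '' (toComplex ⁻¹' criticalPoints G)).ncard := by
    rw [Set.ncard_image_of_injective _ toComplex_injective,
      ← Set.ncard_union_eq _ (finite_realSingularPoints hfin) (finite_offCurveCriticalPoints hfin)]
    · congr 1
      ext q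
      simp only [mem_union, mem_preimage]
      constructor
      · rintro (h | h)
        · exact toComplex_mem_criticalPoints.2 h.2
        · exact h.2
      · intro h
        by_cases h0 : MvPolynomial.eval q G = 0
        · exact Or.inl ⟨h0, toComplex_mem_criticalPoints.1 h⟩
        · exact Or.inr ⟨h0, h⟩
    · rw [Set.disjoint_left]
      exact fun q h h' => h'.1 h.1
  have hsub : toComplex '' (toComplex ⁻¹' criticalPoints G) ⊆ criticalPoints G :=
    image_preimage_subset _ _
  rw [hunion]
  refine ⟨Set.ncard_le_ncard hsub hfin, fun h p hp => ?_, fun h => ?_⟩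
  · rw [← Set.eq_of_subset_of_ncard_le hsub h.le hfin] at hp
    obtain ⟨q, -, hq⟩ := hp
    exact ⟨q, hq⟩
  · congr 1
    refine (Subset.antisymm hsub fun p hp => ?_).symm
    obtain ⟨q, rfl⟩ := h p hp
    exact ⟨q, hp, rfl⟩

/-- Every bounded component contains a critical point; hence the number of critical points off the
curve is at least the number of bounded components, and equality is a condition on each component. -/
lemma ncard_boundedComponents_le (hfin : (criticalPoints G).Finite) :
    (boundedComponents G).ncard ≤ (offCurveCriticalPoints G).ncard ∧
      ((offCurveCriticalPoints G).ncard = (boundedComponents G).ncard ↔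
        (∀ q ∈ (realZeroSet G)ᶜ, Bornology.IsBounded (connectedComponentIn (realZeroSet G)ᶜ q) →
          ∃! c : Plane, c ∈ connectedComponentIn (realZeroSet G)ᶜ q ∧
            toComplex c ∈ criticalPoints G) ∧
        ∀ q ∈ (realZeroSet G)ᶜ, ¬ Bornology.IsBounded (connectedComponentIn (realZeroSet G)ᶜ q) →
          ∀ c ∈ connectedComponentIn (realZeroSet G)ᶜ q, toComplex c ∉ criticalPoints G) := by
  have hpt : ∀ C ∈ boundedComponents G, ∃ c ∈ C, toComplex c ∈ criticalPoints G := by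
    rintro C ⟨⟨q, hq, rfl⟩, hb⟩
    exact exists_criticalPoint_of_isBounded hq hb
  -- different components contain different critical points
  choose! pt hpt hptc using hpt
  have hcomp : ∀ C ∈ boundedComponents G, ∀ c ∈ C, c ∈ (realZeroSet G)ᶜ ∧
      connectedComponentIn (realZeroSet G)ᶜ c = C := by
    rintro C ⟨⟨q, hq, rfl⟩, hb⟩ c hc
    exact ⟨connectedComponentIn_subset _ _ hc, (connectedComponentIn_eq hc).symm⟩
  have hinj : InjOn pt (boundedComponents G) := by
    intro C hC C' hC' h
    rw [← (hcomp C hC _ (hpt C hC)).2, h, (hcomp C' hC' _ (hpt C' hC')).2]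
  have hsub : pt '' boundedComponents G ⊆ offCurveCriticalPoints G := by
    rintro _ ⟨C, hC, rfl⟩
    exact ⟨(hcomp C hC _ (hpt C hC)).1, hptc C hC⟩
  have hfinO := finite_offCurveCriticalPoints hfin
  rw [← hinj.ncard_image]
  refine ⟨Set.ncard_le_ncard hsub hfinO, fun h => ?_, fun h => ?_⟩
  · have heq := Set.eq_of_subset_of_ncard_le hsub h.le hfinO
    have hall : ∀ c ∈ (realZeroSet G)ᶜ, toComplex c ∈ criticalPoints G →
        ∃ C ∈ boundedComponents G, C = connectedComponentIn (realZeroSet G)ᶜ c ∧ c = pt C := by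
      intro c hc hcc
      have : c ∈ pt '' boundedComponents G := by
        rw [heq]
        exact ⟨hc, hcc⟩
      obtain ⟨C, hC, rfl⟩ := this
      exact ⟨C, hC, (hcomp C hC _ (hpt C hC)).2.symm, rfl⟩
    constructor
    · intro q hq hb
      have hC : connectedComponentIn (realZeroSet G)ᶜ q ∈ boundedComponents G := ⟨⟨q, hq, rfl⟩, hb⟩
      refine ⟨pt _, ⟨hpt _ hC, hptc _ hC⟩, fun c hc => ?_⟩
      obtain ⟨C', -, h1, h2⟩ := hall c (connectedComponentIn_subset _ _ hc.1) hc.2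
      rw [h2, h1, ← connectedComponentIn_eq hc.1]
    · intro q hq hb c hc hcc
      obtain ⟨C', hC', h1, -⟩ := hall c (connectedComponentIn_subset _ _ hc) hcc
      rw [connectedComponentIn_eq hc, ← h1] at hb
      exact hb hC'.2
  · congr 1
    refine (Subset.antisymm hsub fun c hc => ?_).symm
    by_cases hb : Bornology.IsBounded (connectedComponentIn (realZeroSet G)ᶜ c)
    · have hC : connectedComponentIn (realZeroSet G)ᶜ c ∈ boundedComponents G := ⟨⟨c, hc.1, rfl⟩, hb⟩
      exact ⟨_, hC, (h.1 c hc.1 hb).unique ⟨hpt _ hC, hptc _ hC⟩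
        ⟨mem_connectedComponentIn hc.1, hc.2⟩⟩
    · exact absurd hc.2 (h.2 c hc.1 hb c (mem_connectedComponentIn hc.1))

/-- The curve contains a branch, which is not a point. -/
lemma nontrivial_realZeroSet (hn : IsNodal G) (hs : (realSingularPoints G).Finite)
    (hne : (realZeroSet G).Nonempty) : (realZeroSet G).Nontrivial := by
  obtain ⟨q, hq⟩ := hne
  obtain ⟨v, hv⟩ := exists_isTangent hn hq
  have h := (flowCurve_spec hn hs hv).1
  by_contra hcon
  rw [Set.not_nontrivial_iff] at hcon
  exact h.not_const q fun t => hcon (h t).mem hq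

end PlaneCurve

end

theorem mainTheorem6 (G : MvPolynomial (Fin 2) ℝ)
    (hfin : (PlaneCurve.criticalPoints G).Finite)
    (hne : (PlaneCurve.realZeroSet G).Nonempty)
    (hnodes : ∀ q ∈ PlaneCurve.realSingularPoints G, PlaneCurve.IsHyperbolicNode G q) :
    ∃ ξ ν ι : ℕ,
      PlaneCurve.numCriticalPoints G = ξ ∧
      {q | PlaneCurve.IsHyperbolicNode G q}.encard = ν ∧
      PlaneCurve.HasNumIntervalBranches G ι ∧
      (ξ : ℤ) ≥ 2 * ν - ι + 1 ∧
      ((ξ : ℤ) = 2 * ν - ι + 1 ↔ PlaneCurve.IsExpressive G) := by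
  have hs := PlaneCurve.finite_realSingularPoints hfin
  obtain ⟨B⟩ := PlaneCurve.nonempty_branchSystem hfin hnodes hs
  obtain ⟨ξ, hξ, hξ1, hξ2⟩ := PlaneCurve.exists_numCriticalPoints hfin
  obtain ⟨hr1, hr2⟩ := PlaneCurve.ncard_criticalPoints hfin
  obtain ⟨hb1, hb2⟩ := PlaneCurve.ncard_boundedComponents_le hfin
  obtain ⟨c, hc1, hc2, hc3⟩ := B.ncard_boundedComponents hfin hnodes hs hne
  have hnode : {q | PlaneCurve.IsHyperbolicNode G q} = PlaneCurve.realSingularPoints G :=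
    Subset.antisymm (fun _ hq => hq.1) hnodes
  refine ⟨ξ, (PlaneCurve.realSingularPoints G).ncard, Nat.card B.Line, hξ, ?_,
    B.hasNumIntervalBranches hfin hnodes hs, by omega, ?_⟩
  · rw [hnode, hs.cast_ncard_eq]
  constructor
  · intro h
    have e1 : ξ = (PlaneCurve.criticalPoints G).ncard := by omega
    have e2 : (PlaneCurve.criticalPoints G).ncard = (PlaneCurve.realSingularPoints G).ncard +
      (PlaneCurve.offCurveCriticalPoints G).ncard := by omega
    have e3 : (PlaneCurve.offCurveCriticalPoints G).ncard =
      (PlaneCurve.boundedComponents G).ncard := by omega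
    have e4 : c = 1 := by omega
    exact ⟨hr2.1 e2, hξ2.1 e1, (hb2.1 e3).1, (hb2.1 e3).2, hc3.1 e4,
      PlaneCurve.nontrivial_realZeroSet hnodes hs hne⟩
  · intro h
    have e1 := hξ2.2 h.morse
    have e2 := hr2.2 h.real
    have e3 := hb2.2 ⟨h.bounded_component, h.unbounded_component⟩
    have e4 := hc3.2 h.connected
    omega
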